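/- Let $M$, $J$, $U$ be finite sets (of machines, jobs and groups), let $g\colon U\to M$ be a map, and let $y\in[0,1]^{U\times J}$ satisfy $\sum_{j\in J}y_{uj}\le 1$ for every $u\in U$ and $\sum_{u\in U}y_{uj}=1$ for every $j\in J$. Say that a machine $i\in M$ dominates a job $j\in J$ if $\sum_{u\in U:\,g(u)=i}y_{uj}>\frac12$. There is an efficient randomized algorithm which, given $M,J,U,g,y$, outputs a random assignment $\sigma\colon J\to U$ such that: (a) for all $u\in U$ and $j\in J$: $\Pr[\sigma(j)=u]=y_{uj}$; (b) for any two distinct jobs $j,j'\in J$ and any two (possibly identical) groups $u,u'\in U$ with $g(u)=g(u')$: $\Pr[\sigma(j)=u,\ \sigma(j')=u']\le y_{uj}\,y_{u'j'}$; (c) for any two distinct jobs $j,j'\in J$ and any group $u\in U$ such that $g(u)$ dominates neither $j$ nor $j'$: $\Pr[\sigma(j)=\sigma(j')=u]\le(1-0.1561)\,y_{uj}\,y_{uj'}$. Here "efficient" means that the algorithm is a single program, independent of the instance, for a random access machine that stores natural and real numbers, adds, subtracts and compares numbers of either kind, uses natural numbers as array indices and loop bounds, and can flip a coin whose probability of heads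 is a quotient $p/q$ of two computed numbers (clipped to $[0,1]$); and that for every instance and all outcomes of the coins the number of its steps is bounded by a fixed polynomial in $|M|+|U|+|J|$. -/

import Mathlib

namespace SNC

/-! ## Instances of the rounding problem -/

/-- An instance: finite sets `M`, `U`, `J` of machines, groups and jobs (numbered), a map `g` from
groups to machines, and a fractional assignment `y` of jobs to groups in which every group
receives total mass at most one and every job is fully assigned. -/
structure Instance where
  numMachines : ℕ
  numGroups : ℕ
  numJobs : ℕ
  g : Fin numGroups → Fin numMachines
  y : Fin numGroups → Fin numJobs → ℝ
  y_mem : ∀ u j, y u j ∈ Set.Icc (0 : ℝ) 1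
  group_le_one : ∀ u, ∑ j, y u j ≤ 1
  job_eq_one : ∀ j, ∑ u, y u j = 1

/-- Machine `i` dominates job `j`: more than half of `j` lies in groups belonging to `i`. -/
def Instance.Dominates (I : Instance) (i : Fin I.numMachines) (j : Fin I.numJobs) : Prop :=
  1 / 2 < ∑ u with I.g u = i, I.y u j

/-! ## Randomized random access machines with real numbers

The memory consists of arrays (with two indices) of natural numbers and of real numbers.
On both kinds of numbers a program can only add, subtract and compare; natural numbers serve as
indices (indirect addressing) and as bounds of loops. Randomness comes from biased coins whose
probability is the quotient of two computed numbers. There is no multiplication, no division and no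
rounding: for a fixed program, every number present after `t` steps is an integer combination of
`1` and of the input numbers with coefficients of `O(t + 1)` bits, so counting every instruction as one step does not
hide any work in the size of the numbers. -/

/-- The memory of the machine, together with the number of steps made so far. Programs have no
access to the clock. -/
structure State where
  nat : ℕ → ℕ → ℕ → ℕ
  real : ℕ → ℕ → ℕ → ℝ
  clock : ℕ

/-- Expressions for natural numbers; `read a i j` is the entry `(i, j)` of the array `a`. -/
inductive NatExpr where
  | lit (k : ℕ)
  | read (a : ℕ) (i j : NatExpr)
  | add (e₁ e₂ : NatExpr)
  | sub (e₁ e₂ : NatExpr)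

/-- Expressions for real numbers. -/
inductive RealExpr where
  | ofNat (e : NatExpr)
  | read (a : ℕ) (i j : NatExpr)
  | add (e₁ e₂ : RealExpr)
  | sub (e₁ e₂ : RealExpr)

/-- Tests. -/
inductive Test where
  | natLt (e₁ e₂ : NatExpr)
  | realLt (e₁ e₂ : RealExpr)
  | not (b : Test)
  | and (b₁ b₂ : Test)

/-- Programs. `flip p q c d` continues with `c` with probability `p / q` and with `d` otherwise.
`loop a e c` evaluates `e` once, to a number `k`, and then runs `c` for the values `0, …, k - 1`
of the entry `(0, 0)` of the array `a`. -/
inductive Program where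
  | skip
  | setNat (a : ℕ) (i j e : NatExpr)
  | setReal (a : ℕ) (i j : NatExpr) (e : RealExpr)
  | seq (c d : Program)
  | ite (b : Test) (c d : Program)
  | flip (p q : RealExpr) (c d : Program)
  | loop (a : ℕ) (e : NatExpr) (c : Program)

/-- One step on the clock. -/
def State.tick (s : State) : State := { s with clock := s.clock + 1 }

/-- Store the natural number `v` in the entry `(i, j)` of the array `a`. -/
def State.setNat (s : State) (a i j v : ℕ) : State :=
  { s with nat := fun a' i' j' => if a' = a ∧ i' = i ∧ j' = j then v else s.nat a' i' j' }

open Classical in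
/-- Store the real number `v` in the entry `(i, j)` of the array `a`. -/
noncomputable def State.setReal (s : State) (a i j : ℕ) (v : ℝ) : State :=
  { s with real := fun a' i' j' => if a' = a ∧ i' = i ∧ j' = j then v else s.real a' i' j' }

/-- Value of an expression; subtraction of natural numbers is truncated at `0`. -/
def NatExpr.eval (s : State) : NatExpr → ℕ
  | lit k => k
  | read a i j => s.nat a (i.eval s) (j.eval s)
  | add e₁ e₂ => e₁.eval s + e₂.eval s
  | sub e₁ e₂ => e₁.eval s - e₂.eval s

/-- Value of an expression. -/
noncomputable def RealExpr.eval (s : State) : RealExpr → ℝ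
  | ofNat e => (e.eval s : ℝ)
  | read a i j => s.real a (i.eval s) (j.eval s)
  | add e₁ e₂ => e₁.eval s + e₂.eval s
  | sub e₁ e₂ => e₁.eval s - e₂.eval s

/-- Truth of a test. -/
def Test.Holds (s : State) : Test → Prop
  | natLt e₁ e₂ => e₁.eval s < e₂.eval s
  | realLt e₁ e₂ => e₁.eval s < e₂.eval s
  | not b => ¬ b.Holds s
  | and b₁ b₂ => b₁.Holds s ∧ b₂.Holds s

/-- A coin that shows `true` with probability `x` (clipped to the interval `[0, 1]`). -/
noncomputable def coin (x : ℝ) : PMF Bool :=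
  PMF.ofFintype (fun b => cond b (ENNReal.ofReal (min x 1)) (1 - ENNReal.ofReal (min x 1))) (by simp)

/-- Run a randomized transformation `f` of states for the values `0, …, k - 1` of the loop counter,
which is the entry `(0, 0)` of the array `a`; every round costs one step on top of `f`. -/
noncomputable def iterate (a : ℕ) (f : State → PMF State) : ℕ → State → PMF State
  | 0, s => PMF.pure s
  | k + 1, s => (iterate a f k s).bind fun s' => f (s'.setNat a 0 0 k).tick

open Classical in
/-- The distribution of the final state (with the final clock) of a program started in `s`. Every
assignment, branching, coin flip, start of a loop and round of a loop is one step. -/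
noncomputable def Program.run : Program → State → PMF State
  | skip, s => PMF.pure s.tick
  | setNat a i j e, s => PMF.pure (s.setNat a (i.eval s) (j.eval s) (e.eval s)).tick
  | setReal a i j e, s => PMF.pure (s.setReal a (i.eval s) (j.eval s) (e.eval s)).tick
  | seq c d, s => (c.run s).bind d.run
  | ite b c d, s => if b.Holds s then c.run s.tick else d.run s.tick
  | flip p q c d, s =>
      (coin (p.eval s / q.eval s)).bind fun x => if x = true then c.run s.tick else d.run s.tick
  | loop a e c, s => iterate a c.run (e.eval s) s.tick

/-- The state in which a program is started on an instance: the numbers of machines, groups and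
jobs are the entries `(0, 0)`, `(1, 0)`, `(2, 0)` of the array `0` of natural numbers, the map `g`
is in the array `1` of natural numbers, and `y` is in the array `0` of real numbers. All other
entries are zero. -/
def Instance.start (I : Instance) : State where
  nat a i j :=
    if a = 0 ∧ i = 0 ∧ j = 0 then I.numMachines
    else if a = 0 ∧ i = 1 ∧ j = 0 then I.numGroups
    else if a = 0 ∧ i = 2 ∧ j = 0 then I.numJobs
    else if h : a = 1 ∧ i < I.numGroups ∧ j = 0 then (I.g ⟨i, h.2.1⟩ : ℕ)
    else 0
  real a i j :=
    if h : a = 0 ∧ i < I.numGroups ∧ j < I.numJobs then I.y ⟨i, h.2.1⟩ ⟨j, h.2.2⟩ else 0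
  clock := 0

/-- The program `c` makes, on the instance `I`, at most `T` steps, whatever the coins show. -/
def Program.HaltsWithin (c : Program) (I : Instance) (T : ℕ) : Prop :=
  ∀ s ∈ (c.run I.start).support, s.clock ≤ T

/-- The program `c`, on the instance `I`, outputs a random assignment of jobs to groups with
distribution `μ`: the group of job `j` is found in the entry `(j, 0)` of the array `2` of natural
numbers. -/
def Program.Outputs (c : Program) (I : Instance)
    (μ : PMF (Fin I.numJobs → Fin I.numGroups)) : Prop :=
  (c.run I.start).map (fun s (j : Fin I.numJobs) => s.nat 2 j 0) = μ.map (fun σ j => (σ j : ℕ))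

end SNC

/-! Put `x = 2y`, so that every job has mass 2. For each job independently, lay the groups side by
side on `[0, 2]`, machine by machine, and take the groups containing `t` and `t + 1` for a uniform
`t` in `[0, 1]`. The group `u` is hit `x u j` times on average, and a machine that does not dominate
the job is hit at most once. Sending every job to one of its two half-edges by a fair choice already
gives the marginals `y`; the work lies in correlating these choices.

Half-edges at a common group are matched at random. Each job has two half-edges, so the links
arrange the jobs in paths and cycles. A phase for every job selects one of its half-edges; a link is
satisfied if both or neither of its half-edges are selected. A global fair coin may reverse all
phases. Two jobs linked at their selected half-edges then form a block driven by one coin: one job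
goes to its selected half-edge, the other to its opposite one. Jobs of one block are never on the
same machine (`Links.mach_chosen_ne`), jobs of different blocks are independent, so (a) and (b) hold
whatever the phases are (`ev_chosen`, `ev_chosen_pair`). A satisfied link lies inside a block for at
least one of the two values of the global coin, which at least halves the probability that its jobs
meet there.

Only odd cycles prevent all links from being satisfied. The links are treated as in Kruskal's
algorithm, in the order of random levels, so an unsatisfied link has the largest level on an odd
cycle. On odd cycles of three or five links some link is joinable: even if it is unsatisfied, one of
its jobs can join the block of the other without a conflict of machines. Joinable links are treated
last. Hence any other unsatisfied link has the largest of at least seven levels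
(`Links.levelMax_of_not_sat`), which has probability at most `0.143864`, that is `1/7` and an
allowance for ties.

Each half-edge is put into the first class with probability `1 - 2x/5`. At a group the first class
plays a random round of a round robin; a lone member of it is matched to a random member of the
second class. This thinning keeps the number of competitors in the first class below a Poisson
variable of rate `1.03` times their mass, and two half-edges at one group are linked with
probability at least `0.3647` (`PairLaw.link_probability`). Finally `1/2 * 0.3647 * (1 - 0.143864) >
0.1561`, which is (c) (`PairLaw.ev_meetBound`).

On the machine, `Mix` couples the random memory with an abstract random label of known law, `Hoare`
treats deterministic facts about the memory, and all sampling is reservoir sampling, which needs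
only additions and coins `p / q`. Loops are bounded by literals or sizes of the instance, whence the
polynomial running time. -/

namespace SNC

/-! ## Clock-free semantics -/

/-- The state with its clock reset. -/
def State.unclock (s : State) : State := { s with clock := 0 }

/-- The clock-free counterpart of `iterate`. -/
noncomputable def execIter (a : ℕ) (f : State → PMF State) : ℕ → State → PMF State
  | 0, s => PMF.pure s
  | k + 1, s => (execIter a f k s).bind fun s' => f (s'.setNat a 0 0 k)

open Classical in
/-- The distribution of the final state when the clock is ignored. -/
noncomputable def Program.exec : Program → State → PMF State
  | skip, s => PMF.pure s
  | setNat a i j e, s => PMF.pure (s.setNat a (i.eval s) (j.eval s) (e.eval s))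
  | setReal a i j e, s => PMF.pure (s.setReal a (i.eval s) (j.eval s) (e.eval s))
  | seq c d, s => (c.exec s).bind d.exec
  | ite b c d, s => if b.Holds s then c.exec s else d.exec s
  | flip p q c d, s =>
      (coin (p.eval s / q.eval s)).bind fun x => if x = true then c.exec s else d.exec s
  | loop a e c, s => execIter a c.exec (e.eval s) s

theorem NatExpr.eval_unclock (s : State) (e : NatExpr) : e.eval s.unclock = e.eval s := by
  induction e with
  | lit k => rfl
  | read a i j hi hj => simp only [NatExpr.eval, hi, hj]; rfl
  | add _ _ h₁ h₂ => simp only [NatExpr.eval, h₁, h₂]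
  | sub _ _ h₁ h₂ => simp only [NatExpr.eval, h₁, h₂]

theorem RealExpr.eval_unclock (s : State) (e : RealExpr) : e.eval s.unclock = e.eval s := by
  induction e with
  | ofNat k => simp only [RealExpr.eval, NatExpr.eval_unclock]
  | read a i j => simp only [RealExpr.eval, NatExpr.eval_unclock]; rfl
  | add _ _ h₁ h₂ => simp only [RealExpr.eval, h₁, h₂]
  | sub _ _ h₁ h₂ => simp only [RealExpr.eval, h₁, h₂]

theorem Test.holds_unclock (s : State) (b : Test) : b.Holds s.unclock ↔ b.Holds s := by
  induction b with
  | natLt _ _ => simp only [Test.Holds, NatExpr.eval_unclock]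
  | realLt _ _ => simp only [Test.Holds, RealExpr.eval_unclock]
  | not _ h => simp only [Test.Holds, h]
  | and _ _ h₁ h₂ => simp only [Test.Holds, h₁, h₂]

/-- No expression or test reads the clock, so erasing it commutes with every instruction.
Probabilities can thus be computed with `exec`, and the clock matters only for the running time. -/
theorem Program.map_run (c : Program) (s : State) :
    (c.run s).map State.unclock = c.exec s.unclock := by
  induction c generalizing s with
  | skip => simp only [run, exec, PMF.pure_map]; rfl
  | setNat a i j e =>
    simp only [run, exec, PMF.pure_map, NatExpr.eval_unclock]; rfl
  | setReal a i j e =>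
    simp only [run, exec, PMF.pure_map, NatExpr.eval_unclock, RealExpr.eval_unclock]; rfl
  | seq c d hc hd =>
    simp only [run, exec, PMF.map_bind, ← hc, PMF.bind_map, Function.comp_def, hd]
  | ite b c d hc hd =>
    simp only [run, exec]
    by_cases hb : b.Holds s
    · rw [if_pos hb, if_pos ((Test.holds_unclock s b).2 hb)]
      exact hc s.tick
    · rw [if_neg hb, if_neg (mt (Test.holds_unclock s b).1 hb)]
      exact hd s.tick
  | flip p q c d hc hd =>
    simp only [run, exec, PMF.map_bind, RealExpr.eval_unclock]
    congr 1
    funext x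
    cases x
    · exact hd s.tick
    · exact hc s.tick
  | loop a e c hc =>
    simp only [run, exec, NatExpr.eval_unclock]
    suffices h : ∀ n, ∀ s : State, (iterate a c.run n s).map State.unclock
        = execIter a c.exec n s.unclock from h _ _
    intro n
    induction n with
    | zero => intro s; simp only [iterate, execIter, PMF.pure_map]
    | succ k ih =>
      intro s
      simp only [iterate, execIter, PMF.map_bind, ← ih, PMF.bind_map]
      congr 1
      funext s'
      rw [hc]; rfl

/-! ## Running time -/

/-- A polynomial bound for the value of the expressions that `Program.tame` allows as loop bounds. -/
noncomputable def NatExpr.boundPoly : NatExpr → Polynomial ℕ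
  | lit k => Polynomial.C k
  | _ => Polynomial.X

/-- A polynomial bound for the number of steps. -/
noncomputable def Program.cost : Program → Polynomial ℕ
  | skip => 1
  | setNat _ _ _ _ => 1
  | setReal _ _ _ _ => 1
  | seq c d => c.cost + d.cost
  | ite _ c d => 1 + c.cost + d.cost
  | flip _ _ c d => 1 + c.cost + d.cost
  | loop _ e c => 1 + e.boundPoly * (c.cost + 1)

/-- The expression is a literal or one of the sizes of the instance. -/
def NatExpr.isSize : NatExpr → Bool
  | lit _ => true
  | read 0 (lit i) (lit 0) => decide (i < 3)
  | _ => false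

/-- The program never writes to the array of sizes, and its loops are bounded by literals or
by sizes. -/
def Program.tame : Program → Bool
  | skip => true
  | setNat a _ _ _ => a != 0
  | setReal _ _ _ _ => true
  | seq c d => c.tame && d.tame
  | ite _ c d => c.tame && d.tame
  | flip _ _ c d => c.tame && d.tame
  | loop a e c => a != 0 && e.isSize && c.tame

theorem NatExpr.eval_le_of_isSize {e : NatExpr} (he : e.isSize = true) {s : State} {N : ℕ}
    (hs : ∀ i < 3, s.nat 0 i 0 ≤ N) : e.eval s ≤ e.boundPoly.eval N := by
  unfold NatExpr.isSize at he
  split at he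
  · simp [NatExpr.eval, boundPoly]
  · simpa [NatExpr.eval, boundPoly] using hs _ (by simpa using he)
  · simp at he

theorem State.setNat_nat_zero {s : State} {a i j v : ℕ} (ha : a ≠ 0) :
    (s.setNat a i j v).nat 0 = s.nat 0 := by
  funext i' j'
  simp [State.setNat, ha.symm]

/-- The array of sizes is never overwritten, so a loop bound read from it stays below `N`
throughout. This invariance is proved together with the bound on the clock because the induction
needs it for the second half of a sequence and for later rounds of a loop. -/
theorem Program.run_bound {c : Program} (hc : c.tame = true) {N : ℕ} {s : State}
    (hs : ∀ i < 3, s.nat 0 i 0 ≤ N) {s' : State} (h : s' ∈ (c.run s).support) :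
    s'.nat 0 = s.nat 0 ∧ s'.clock ≤ s.clock + c.cost.eval N := by
  induction c generalizing s s' with
  | skip =>
    simp only [run, PMF.support_pure, Set.mem_singleton_iff] at h
    subst h
    exact ⟨rfl, by simp [cost, State.tick]⟩
  | setNat a i j e =>
    simp only [run, PMF.support_pure, Set.mem_singleton_iff] at h
    subst h
    simp only [tame, bne_iff_ne] at hc
    exact ⟨State.setNat_nat_zero hc, by simp [cost, State.tick, State.setNat]⟩
  | setReal a i j e =>
    simp only [run, PMF.support_pure, Set.mem_singleton_iff] at h
    subst h
    exact ⟨rfl, by simp [cost, State.tick, State.setReal]⟩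
  | seq c d ihc ihd =>
    simp only [tame, Bool.and_eq_true] at hc
    simp only [run, PMF.mem_support_bind_iff] at h
    obtain ⟨t, ht, h⟩ := h
    obtain ⟨h₁, h₂⟩ := ihc hc.1 hs ht
    obtain ⟨h₃, h₄⟩ := ihd hc.2 (by simpa [h₁] using hs) h
    exact ⟨h₃.trans h₁, by simp only [cost, Polynomial.eval_add]; omega⟩
  | ite b c d ihc ihd =>
    simp only [tame, Bool.and_eq_true] at hc
    simp only [run] at h
    simp only [cost, Polynomial.eval_add, Polynomial.eval_one]
    split_ifs at h
    · obtain ⟨h₁, h₂⟩ := ihc hc.1 (s := s.tick) hs h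
      exact ⟨h₁, by simp only [State.tick] at h₂; omega⟩
    · obtain ⟨h₁, h₂⟩ := ihd hc.2 (s := s.tick) hs h
      exact ⟨h₁, by simp only [State.tick] at h₂; omega⟩
  | flip p q c d ihc ihd =>
    simp only [tame, Bool.and_eq_true] at hc
    simp only [run, PMF.mem_support_bind_iff] at h
    obtain ⟨x, -, h⟩ := h
    simp only [cost, Polynomial.eval_add, Polynomial.eval_one]
    split_ifs at h
    · obtain ⟨h₁, h₂⟩ := ihc hc.1 (s := s.tick) hs h
      exact ⟨h₁, by simp only [State.tick] at h₂; omega⟩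
    · obtain ⟨h₁, h₂⟩ := ihd hc.2 (s := s.tick) hs h
      exact ⟨h₁, by simp only [State.tick] at h₂; omega⟩
  | loop a e c ih =>
    simp only [tame, Bool.and_eq_true, bne_iff_ne] at hc
    simp only [run] at h
    have key : ∀ n, ∀ t ∈ (iterate a c.run n s.tick).support,
        t.nat 0 = s.nat 0 ∧ t.clock ≤ s.clock + 1 + n * (c.cost.eval N + 1) := by
      intro n
      induction n with
      | zero =>
        intro t ht
        simp only [iterate, PMF.support_pure, Set.mem_singleton_iff] at ht
        subst ht
        exact ⟨rfl, by simp [State.tick]⟩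
      | succ k ihk =>
        intro t ht
        simp only [iterate, PMF.mem_support_bind_iff] at ht
        obtain ⟨r, hr, ht⟩ := ht
        obtain ⟨h₁, h₂⟩ := ihk r hr
        have h₀ : ((r.setNat a 0 0 k).tick).nat 0 = s.nat 0 :=
          (State.setNat_nat_zero (s := r) hc.1.1).trans h₁
        obtain ⟨h₃, h₄⟩ := ih hc.2 (s := (r.setNat a 0 0 k).tick) (by simpa [h₀] using hs) ht
        refine ⟨h₃.trans h₀, ?_⟩
        have : ((r.setNat a 0 0 k).tick).clock = r.clock + 1 := rfl
        rw [this] at h₄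
        ring_nf at h₂ h₄ ⊢
        omega
    obtain ⟨h₁, h₂⟩ := key _ _ h
    refine ⟨h₁, h₂.trans ?_⟩
    have := NatExpr.eval_le_of_isSize hc.1.2 hs
    simp only [cost, Polynomial.eval_add, Polynomial.eval_one, Polynomial.eval_mul]
    have := Nat.mul_le_mul_right (c.cost.eval N + 1) this
    omega

/-! ## Frames -/

/-- The program does not write to the array `b` of natural numbers. -/
def Program.keepsNat (b : ℕ) : Program → Bool
  | skip => true
  | setNat a _ _ _ => a != b
  | setReal _ _ _ _ => true
  | seq c d => c.keepsNat b && d.keepsNat b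
  | ite _ c d => c.keepsNat b && d.keepsNat b
  | flip _ _ c d => c.keepsNat b && d.keepsNat b
  | loop a _ c => a != b && c.keepsNat b

/-- The program does not write to the array `b` of real numbers. -/
def Program.keepsReal (b : ℕ) : Program → Bool
  | skip => true
  | setNat _ _ _ _ => true
  | setReal a _ _ _ => a != b
  | seq c d => c.keepsReal b && d.keepsReal b
  | ite _ c d => c.keepsReal b && d.keepsReal b
  | flip _ _ c d => c.keepsReal b && d.keepsReal b
  | loop _ _ c => c.keepsReal b

/-- The state `s'` agrees with `s` on all arrays to which `c` does not write. -/
def Program.Frame (c : Program) (s s' : State) : Prop :=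
  (∀ b, c.keepsNat b = true → s'.nat b = s.nat b) ∧
    ∀ b, c.keepsReal b = true → s'.real b = s.real b

theorem State.setNat_nat_ne {s : State} {a b i j v : ℕ} (h : a ≠ b) :
    (s.setNat a i j v).nat b = s.nat b := by
  funext i' j'
  simp [State.setNat, h.symm]

theorem State.setReal_real_ne {s : State} {a b i j : ℕ} {v : ℝ} (h : a ≠ b) :
    (s.setReal a i j v).real b = s.real b := by
  funext i' j'
  simp [State.setReal, h.symm]

/-- All possible final states of `c` satisfy `Q`. -/
def Hoare (c : Program) (s : State) (Q : State → Prop) : Prop := ∀ s' ∈ (c.exec s).support, Q s'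

theorem Hoare.mono {c : Program} {s : State} {Q Q' : State → Prop} (h : Hoare c s Q)
    (hQ : ∀ s', Q s' → Q' s') : Hoare c s Q' := fun s' hs' => hQ s' (h s' hs')

theorem Hoare.and {c : Program} {s : State} {Q Q' : State → Prop} (h : Hoare c s Q)
    (h' : Hoare c s Q') : Hoare c s fun t => Q t ∧ Q' t := fun s' hs' => ⟨h s' hs', h' s' hs'⟩

@[simp] theorem hoare_skip {s : State} {Q : State → Prop} : Hoare .skip s Q ↔ Q s := by
  simp [Hoare, Program.exec]

@[simp] theorem hoare_setNat {a : ℕ} {i j e : NatExpr} {s : State} {Q : State → Prop} :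
    Hoare (.setNat a i j e) s Q ↔ Q (s.setNat a (i.eval s) (j.eval s) (e.eval s)) := by
  simp [Hoare, Program.exec]

@[simp] theorem hoare_setReal {a : ℕ} {i j : NatExpr} {e : RealExpr} {s : State}
    {Q : State → Prop} :
    Hoare (.setReal a i j e) s Q ↔ Q (s.setReal a (i.eval s) (j.eval s) (e.eval s)) := by
  simp [Hoare, Program.exec]

@[simp] theorem hoare_seq {c d : Program} {s : State} {Q : State → Prop} :
    Hoare (.seq c d) s Q ↔ Hoare c s fun t => Hoare d t Q := by
  simp only [Hoare, Program.exec, PMF.mem_support_bind_iff]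
  exact ⟨fun h t ht s' hs' => h s' ⟨t, ht, hs'⟩, fun h s' ⟨t, ht, hs'⟩ => h t ht s' hs'⟩

theorem hoare_ite {b : Test} {c d : Program} {s : State} {Q : State → Prop} :
    Hoare (.ite b c d) s Q ↔ (b.Holds s → Hoare c s Q) ∧ (¬ b.Holds s → Hoare d s Q) := by
  simp only [Hoare, Program.exec]
  split_ifs with h <;> simp [h]

theorem hoare_iter {a : ℕ} {c : Program} {P : ℕ → State → Prop} {n : ℕ} {s : State}
    (h₀ : P 0 s) (h : ∀ k < n, ∀ t, P k t → Hoare c (t.setNat a 0 0 k) (P (k + 1))) :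
    ∀ s' ∈ (execIter a c.exec n s).support, P n s' := by
  induction n with
  | zero => simpa [execIter] using h₀
  | succ k ih =>
    intro s' hs'
    simp only [execIter, PMF.mem_support_bind_iff] at hs'
    obtain ⟨t, ht, hs'⟩ := hs'
    exact h k k.lt_succ_self t (ih (fun l hl => h l (hl.trans k.lt_succ_self)) t ht) s' hs'

/-- Since `keepsNat` and `keepsReal` compute, the preservation of an array by a concrete program is
afterwards obtained by `rfl`. -/
theorem Program.exec_frame (c : Program) (s : State) : Hoare c s (c.Frame s) := by
  induction c generalizing s with
  | skip => exact hoare_skip.2 ⟨fun _ _ => rfl, fun _ _ => rfl⟩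
  | setNat a i j e =>
    simp only [hoare_setNat, Frame, keepsNat, keepsReal, bne_iff_ne]
    exact ⟨fun b hb => State.setNat_nat_ne hb, fun b _ => rfl⟩
  | setReal a i j e =>
    simp only [hoare_setReal, Frame, keepsNat, keepsReal, bne_iff_ne]
    exact ⟨fun b _ => rfl, fun b hb => State.setReal_real_ne hb⟩
  | seq c d hc hd =>
    rw [hoare_seq]
    refine (hc s).mono fun t ht => (hd t).mono fun s' hs' => ?_
    simp only [Frame, keepsNat, keepsReal, Bool.and_eq_true] at ht hs' ⊢
    exact ⟨fun b hb => (hs'.1 b hb.2).trans (ht.1 b hb.1),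
      fun b hb => (hs'.2 b hb.2).trans (ht.2 b hb.1)⟩
  | ite b c d hc hd =>
    rw [hoare_ite]
    refine ⟨fun _ => (hc s).mono fun t ht => ?_, fun _ => (hd s).mono fun t ht => ?_⟩ <;>
      simp only [Frame, keepsNat, keepsReal, Bool.and_eq_true]
    · exact ⟨fun b hb => ht.1 b hb.1, fun b hb => ht.2 b hb.1⟩
    · exact ⟨fun b hb => ht.1 b hb.2, fun b hb => ht.2 b hb.2⟩
  | flip p q c d hc hd =>
    intro s' hs'
    simp only [exec, PMF.mem_support_bind_iff] at hs'
    obtain ⟨x, -, hs'⟩ := hs'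
    simp only [Frame, keepsNat, keepsReal, Bool.and_eq_true]
    split_ifs at hs'
    · exact ⟨fun b hb => (hc s s' hs').1 b hb.1, fun b hb => (hc s s' hs').2 b hb.1⟩
    · exact ⟨fun b hb => (hd s s' hs').1 b hb.2, fun b hb => (hd s s' hs').2 b hb.2⟩
  | loop a e c hc =>
    refine hoare_iter (P := fun _ t => (loop a e c).Frame s t) ⟨fun _ _ => rfl, fun _ _ => rfl⟩
      fun k _ t ht => (hc _).mono fun s' hs' => ?_
    simp only [Frame, keepsNat, keepsReal, Bool.and_eq_true, bne_iff_ne] at ht hs' ⊢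
    refine ⟨fun b hb => ?_, fun b hb => (hs'.2 b hb).trans (ht.2 b hb)⟩
    rw [hs'.1 b hb.2, State.setNat_nat_ne hb.1, ht.1 b hb]

theorem Hoare.frame {c : Program} {s : State} {Q : State → Prop} (h : Hoare c s Q) :
    Hoare c s fun t => c.Frame s t ∧ Q t := (c.exec_frame s).and h

/-- The rule for loops: the invariant may use that the loop respects its frame. -/
theorem hoare_loop {a : ℕ} {e : NatExpr} {c : Program} {s : State} (P : ℕ → State → Prop)
    (h₀ : P 0 s) (h : ∀ k < e.eval s, ∀ t, (Program.loop a e c).Frame s t → P k t →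
      Hoare c (t.setNat a 0 0 k) (P (k + 1))) :
    Hoare (.loop a e c) s (P (e.eval s)) := by
  have key := hoare_iter (a := a) (c := c) (n := e.eval s) (s := s)
    (P := fun k t => (Program.loop a e c).Frame s t ∧ P k t)
    ⟨⟨fun _ _ => rfl, fun _ _ => rfl⟩, h₀⟩ fun k hk t ht => ?_
  · exact fun s' hs' => (key s' hs').2
  refine (h k hk t ht.1 ht.2).frame.mono fun s' hs' => ⟨?_, hs'.2⟩
  obtain ⟨⟨h₁, h₂⟩, -⟩ := hs'
  obtain ⟨⟨h₃, h₄⟩, -⟩ := ht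
  simp only [Program.Frame, Program.keepsNat, Program.keepsReal, Bool.and_eq_true,
    bne_iff_ne] at h₁ h₂ h₃ h₄ ⊢
  refine ⟨fun b hb => ?_, fun b hb => (h₂ b hb).trans (h₄ b hb)⟩
  rw [h₁ b hb.2, State.setNat_nat_ne hb.1, h₃ b hb]

/-! ## Mixtures -/

/-- The random state with distribution `p` comes with a random label of distribution `D`, to which
it is almost surely related by `Q`. -/
def Mix {α : Type*} (p : PMF State) (D : PMF α) (Q : α → State → Prop) : Prop :=
  ∃ γ : PMF (α × State), γ.map Prod.fst = D ∧ γ.map Prod.snd = p ∧ ∀ x ∈ γ.support, Q x.1 x.2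

section Mix

theorem map_const' {α β : Type*} (p : PMF α) (b : β) : p.map (fun _ => b) = PMF.pure b :=
  PMF.map_const p b

variable {α β ι : Type*}

theorem Mix.mono {p : PMF State} {D : PMF α} {Q Q' : α → State → Prop} (h : Mix p D Q)
    (hQ : ∀ a s, Q a s → Q' a s) : Mix p D Q' := by
  obtain ⟨γ, h₁, h₂, h₃⟩ := h
  exact ⟨γ, h₁, h₂, fun x hx => hQ _ _ (h₃ x hx)⟩

theorem Mix.of_pure {a : α} {s : State} {Q : α → State → Prop} (h : Q a s) :
    Mix (PMF.pure s) (PMF.pure a) Q :=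
  ⟨PMF.pure (a, s), by simp [PMF.pure_map], by simp [PMF.pure_map], by simpa using h⟩

/-- Gluing of couplings: draw a pair from the first coupling and continue with a coupling that
depends on it. The next label may depend only on the label, the next state only on the state. -/
theorem Mix.bind {p : PMF State} {D : PMF α} {Q : α → State → Prop} (h : Mix p D Q)
    {f : State → PMF State} {G : α → PMF β} {Q' : β → State → Prop}
    (h' : ∀ a s, Q a s → Mix (f s) (G a) Q') : Mix (p.bind f) (D.bind G) Q' := by
  classical
  obtain ⟨γ, h₁, h₂, h₃⟩ := h
  have key : ∀ x : α × State, ∃ δ : PMF (β × State), δ.map Prod.fst = G x.1 ∧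
      δ.map Prod.snd = f x.2 ∧ (Q x.1 x.2 → ∀ y ∈ δ.support, Q' y.1 y.2) := by
    intro x
    by_cases hx : Q x.1 x.2
    · obtain ⟨δ, h₁, h₂, h₃⟩ := h' _ _ hx
      exact ⟨δ, h₁, h₂, fun _ => h₃⟩
    -- Outside the support of the first coupling nothing is required; the independent coupling is
    -- only a default with the correct marginals.
    · refine ⟨(G x.1).bind fun b => (f x.2).map (Prod.mk b), ?_, ?_, fun h => absurd h hx⟩
      · simp only [PMF.map_bind, PMF.map_comp, Function.comp_def, map_const', PMF.bind_pure]
      · simp only [PMF.map_bind, PMF.map_comp, Function.comp_def, PMF.bind_const]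
        exact PMF.map_id _
  choose δ hδ₁ hδ₂ hδ₃ using key
  refine ⟨γ.bind δ, ?_, ?_, ?_⟩
  · simp only [PMF.map_bind, hδ₁, ← h₁, PMF.bind_map, Function.comp_def]
  · simp only [PMF.map_bind, hδ₂, ← h₂, PMF.bind_map, Function.comp_def]
  · intro y hy
    obtain ⟨x, hx, hy⟩ := (PMF.mem_support_bind_iff _ _ _).1 hy
    exact hδ₃ x (h₃ x hx) y hy

theorem Mix.bind_left {q : PMF ι} {f : ι → PMF State} {G : ι → PMF β} {Q : β → State → Prop}
    (h : ∀ i, Mix (f i) (G i) Q) : Mix (q.bind f) (q.bind G) Q := by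
  choose δ h₁ h₂ h₃ using h
  refine ⟨q.bind δ, by simp only [PMF.map_bind, h₁], by simp only [PMF.map_bind, h₂], ?_⟩
  intro y hy
  obtain ⟨x, hx, hy⟩ := (PMF.mem_support_bind_iff _ _ _).1 hy
  exact h₃ x y hy

theorem Mix.map {p : PMF State} {D : PMF α} {Q : α → State → Prop} (h : Mix p D Q)
    {φ : α → β} {Q' : β → State → Prop} (hQ : ∀ a s, Q a s → Q' (φ a) s) :
    Mix p (D.map φ) Q' := by
  obtain ⟨γ, h₁, h₂, h₃⟩ := h
  refine ⟨γ.map (Prod.map φ id), ?_, ?_, ?_⟩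
  · rw [PMF.map_comp, ← h₁, PMF.map_comp]; rfl
  · rw [PMF.map_comp, ← h₂]; rfl
  · intro y hy
    obtain ⟨x, hx, rfl⟩ := (PMF.mem_support_map_iff _ _ _).1 hy
    exact hQ _ _ (h₃ x hx)

theorem Mix.of_hoare {c : Program} {s : State} {a : α} {Q : α → State → Prop}
    (h : Hoare c s (Q a)) : Mix (c.exec s) (PMF.pure a) Q := by
  refine ⟨(c.exec s).map (Prod.mk a), ?_, ?_, ?_⟩
  · simp only [PMF.map_comp, Function.comp_def, map_const']
  · simp only [PMF.map_comp, Function.comp_def]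
    exact PMF.map_id _
  · intro y hy
    obtain ⟨x, hx, rfl⟩ := (PMF.mem_support_map_iff _ _ _).1 hy
    exact h x hx

/-- For a phase whose randomness, if any, need not be recorded: the label and its law stay the same.
-/
theorem Mix.hoare {p : PMF State} {D : PMF α} {Q Q' : α → State → Prop} (h : Mix p D Q)
    {c : Program} (hc : ∀ a s, Q a s → Hoare c s (Q' a)) : Mix (p.bind c.exec) D Q' := by
  have := h.bind (f := c.exec) (G := PMF.pure) (Q' := Q') fun a s has => Mix.of_hoare (hc a s has)
  rwa [PMF.bind_pure] at this

theorem Mix.seq {c d : Program} {s : State} {D : PMF α} {Q : α → State → Prop} {G : α → PMF β}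
    {Q' : β → State → Prop} (h : Mix (c.exec s) D Q)
    (h' : ∀ a t, Q a t → Mix (d.exec t) (G a) Q') :
    Mix ((Program.seq c d).exec s) (D.bind G) Q' := h.bind h'

/-- The distributions of the labels in a loop. -/
noncomputable def iterLabel (G : ℕ → α → PMF α) (a : α) : ℕ → PMF α
  | 0 => PMF.pure a
  | k + 1 => (iterLabel G a k).bind (G k)

theorem Mix.loop {a : ℕ} {e : NatExpr} {c : Program} {s : State} {G : ℕ → α → PMF α} {x : α}
    (Q : ℕ → α → State → Prop) (h₀ : Q 0 x s)
    (h : ∀ k < e.eval s, ∀ y t, (Program.loop a e c).Frame s t → Q k y t →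
      Mix (c.exec (t.setNat a 0 0 k)) (G k y) (Q (k + 1))) :
    Mix ((Program.loop a e c).exec s) (iterLabel G x (e.eval s)) (Q (e.eval s)) := by
  have key : ∀ n ≤ e.eval s, Mix (execIter a c.exec n s) (iterLabel G x n)
      fun y t => (Program.loop a e c).Frame s t ∧ Q n y t := by
    intro n hn
    induction n with
    | zero => exact Mix.of_pure ⟨⟨fun _ _ => rfl, fun _ _ => rfl⟩, h₀⟩
    | succ k ih =>
      refine (ih (by omega)).bind fun y t ht => ?_
      obtain ⟨γ, h₁, h₂, h₃⟩ := h k (by omega) y t ht.1 ht.2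
      refine ⟨γ, h₁, h₂, fun z hz => ⟨?_, h₃ z hz⟩⟩
      have hz' : z.2 ∈ (c.exec (t.setNat a 0 0 k)).support := by
        rw [← h₂, PMF.mem_support_map_iff]
        exact ⟨z, hz, rfl⟩
      obtain ⟨h₅, h₆⟩ := c.exec_frame _ _ hz'
      obtain ⟨⟨h₇, h₈⟩, -⟩ := ht
      simp only [Program.Frame, Program.keepsNat, Program.keepsReal, Bool.and_eq_true,
        bne_iff_ne] at h₅ h₆ h₇ h₈ ⊢
      refine ⟨fun b hb => ?_, fun b hb => (h₆ b hb).trans (h₈ b hb)⟩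
      rw [h₅ b hb.2, State.setNat_nat_ne hb.1, h₇ b hb]
  exact (key _ le_rfl).mono fun _ _ h => h.2

end Mix

/-! ## Expectations over finite types -/

section Ev

variable {α β : Type*} [Fintype α] [Fintype β]

/-- The expectation of `f` under `p`. -/
noncomputable def ev (p : PMF α) (f : α → ℝ) : ℝ := ∑ a, (p a).toReal * f a

theorem ev_mono {p : PMF α} {f f' : α → ℝ} (h : ∀ a, f a ≤ f' a) : ev p f ≤ ev p f' :=
  Finset.sum_le_sum fun a _ => mul_le_mul_of_nonneg_left (h a) ENNReal.toReal_nonneg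

theorem ev_nonneg {p : PMF α} {f : α → ℝ} (h : ∀ a, 0 ≤ f a) : 0 ≤ ev p f :=
  Finset.sum_nonneg fun a _ => mul_nonneg ENNReal.toReal_nonneg (h a)

theorem ev_add (p : PMF α) (f f' : α → ℝ) : ev p (fun a => f a + f' a) = ev p f + ev p f' := by
  simp only [ev, mul_add, Finset.sum_add_distrib]

theorem ev_sub (p : PMF α) (f f' : α → ℝ) : ev p (fun a => f a - f' a) = ev p f - ev p f' := by
  simp only [ev, mul_sub, Finset.sum_sub_distrib]

theorem ev_mul_left (p : PMF α) (c : ℝ) (f : α → ℝ) : ev p (fun a => c * f a) = c * ev p f := by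
  simp only [ev, Finset.mul_sum]
  exact Finset.sum_congr rfl fun a _ => by ring

theorem ev_mul_right (p : PMF α) (c : ℝ) (f : α → ℝ) : ev p (fun a => f a * c) = ev p f * c := by
  simp only [ev, Finset.sum_mul]
  exact Finset.sum_congr rfl fun a _ => by ring

theorem ev_sum {ι : Type*} (s : Finset ι) (p : PMF α) (f : ι → α → ℝ) :
    ev p (fun a => ∑ i ∈ s, f i a) = ∑ i ∈ s, ev p (f i) := by
  simp only [ev, Finset.mul_sum]
  exact Finset.sum_comm

theorem sum_toReal (p : PMF α) : ∑ a, (p a).toReal = 1 := by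
  rw [← ENNReal.toReal_sum fun a _ => p.apply_ne_top a, ← tsum_fintype (L := .unconditional α),
    p.tsum_coe]
  rfl

@[simp] theorem ev_const (p : PMF α) (c : ℝ) : ev p (fun _ => c) = c := by
  simp only [ev, ← Finset.sum_mul, sum_toReal, one_mul]

@[simp] theorem ev_pure (a : α) (f : α → ℝ) : ev (PMF.pure a) f = f a := by
  classical
  simp only [ev, PMF.pure_apply]
  rw [Finset.sum_eq_single a (fun b _ hb => by simp [hb]) (by simp)]
  simp

theorem ev_bind (p : PMF α) (q : α → PMF β) (f : β → ℝ) :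
    ev (p.bind q) f = ev p fun a => ev (q a) f := by
  simp only [ev, PMF.bind_apply, tsum_fintype]
  simp_rw [ENNReal.toReal_sum fun a _ => ENNReal.mul_ne_top (p.apply_ne_top a)
    ((q a).apply_ne_top _), ENNReal.toReal_mul, Finset.sum_mul, Finset.mul_sum]
  rw [Finset.sum_comm]
  exact Finset.sum_congr rfl fun a _ => Finset.sum_congr rfl fun b _ => by ring

theorem ev_map (p : PMF α) (φ : α → β) (f : β → ℝ) :
    ev (p.map φ) f = ev p fun a => f (φ a) := by
  rw [PMF.map, ev_bind]
  simp only [Function.comp_apply, ev_pure]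

theorem ev_comm (p : PMF α) (q : PMF β) (f : α → β → ℝ) :
    ev p (fun a => ev q (f a)) = ev q fun b => ev p fun a => f a b := by
  simp only [ev, Finset.mul_sum]
  rw [Finset.sum_comm]
  exact Finset.sum_congr rfl fun a _ => Finset.sum_congr rfl fun b _ => by ring

theorem coin_true {x : ℝ} (h₀ : 0 ≤ x) (h₁ : x ≤ 1) : (coin x true).toReal = x := by
  simp [coin, min_eq_left h₁, ENNReal.toReal_ofReal h₀]

theorem coin_false {x : ℝ} (h₀ : 0 ≤ x) (h₁ : x ≤ 1) : (coin x false).toReal = 1 - x := by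
  have := sum_toReal (coin x)
  rw [Fintype.sum_bool, coin_true h₀ h₁] at this
  linarith

theorem ev_coin {x : ℝ} (h₀ : 0 ≤ x) (h₁ : x ≤ 1) (f : Bool → ℝ) :
    ev (coin x) f = x * f true + (1 - x) * f false := by
  rw [ev, Fintype.sum_bool, coin_true h₀ h₁, coin_false h₀ h₁]

/-- Test against indicators of points. Laws produced by sampling loops are identified through their
expectations. -/
theorem ext_ev {p q : PMF α} (h : ∀ f : α → ℝ, ev p f = ev q f) : p = q := by
  classical
  ext a
  have := h fun b => if b = a then 1 else 0
  simp only [ev, mul_ite, mul_one, mul_zero, Finset.sum_ite_eq', Finset.mem_univ, if_true] at this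
  exact (ENNReal.toReal_eq_toReal_iff' (p.apply_ne_top a) (q.apply_ne_top a)).1 this

end Ev

/-! ## Products -/

section Pi

variable {ι : Type*} [Fintype ι] [DecidableEq ι] {A : ι → Type*} [∀ i, Fintype (A i)]

/-- The product of finitely many distributions on finite types. -/
noncomputable def piPMF (D : ∀ i, PMF (A i)) : PMF (∀ i, A i) :=
  PMF.ofFintype (fun ω => ∏ i, D i (ω i)) (by
    rw [← Fintype.piFinset_univ, ← Finset.prod_univ_sum]
    exact Finset.prod_eq_one fun i _ => by
      rw [← tsum_fintype (L := .unconditional _), (D i).tsum_coe])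

theorem ev_piPMF_prod (D : ∀ i, PMF (A i)) (f : ∀ i, A i → ℝ) :
    ev (piPMF D) (fun ω => ∏ i, f i (ω i)) = ∏ i, ev (D i) (f i) := by
  simp only [ev, piPMF, PMF.ofFintype_apply, ENNReal.toReal_prod, ← Finset.prod_mul_distrib]
  rw [Finset.prod_univ_sum, Fintype.piFinset_univ]

/-- Redrawing one coordinate of a product. With a new law this describes a loop that fills cells one
by one; with the old law it is the resampling identity behind the independence statements. -/
theorem piPMF_bind_update (D : ∀ i, PMF (A i)) (k : ι) (d : PMF (A k)) :
    ((piPMF D).bind fun ω => d.map (Function.update ω k)) = piPMF (Function.update D k d) := by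
  classical
  ext η
  rw [PMF.bind_apply, tsum_fintype]
  -- The outcome `η` arises only from those `ω` that agree with it off `k`. Writing this condition
  -- as a product over the coordinates lets the sum over `ω` factorize.
  have key : ∀ ω : ∀ i, A i, (d.map (Function.update ω k)) η
      = d (η k) * ∏ i, (if i = k then 1 else if ω i = η i then 1 else 0) := by
    intro ω
    rw [PMF.map_apply, tsum_fintype]
    by_cases h : ∀ i, i ≠ k → ω i = η i
    · have hη : ∀ a, η = Function.update ω k a ↔ a = η k := by
        intro a
        constructor
        · intro h'
          rw [h', Function.update_self]
        · rintro rfl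
          funext i
          by_cases hi : i = k
          · subst hi; simp
          · rw [Function.update_of_ne hi, h i hi]
      simp only [hη, Finset.sum_ite_eq', Finset.mem_univ, if_true]
      rw [Finset.prod_eq_one fun i _ => ?_, mul_one]
      by_cases hi : i = k
      · simp [hi]
      · simp [hi, h i hi]
    · push Not at h
      obtain ⟨i, hi, hne⟩ := h
      rw [Finset.sum_eq_zero fun a _ => ?_, Finset.prod_eq_zero (Finset.mem_univ i) (by simp [hi, hne]),
        mul_zero]
      rw [if_neg]
      rintro rfl
      exact hne (by rw [Function.update_of_ne hi])
  simp only [key, piPMF, PMF.ofFintype_apply]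
  have h₁ : ∀ ω : ∀ i, A i, (∏ i, D i (ω i)) *
      (d (η k) * ∏ i, (if i = k then 1 else if ω i = η i then 1 else 0))
      = d (η k) * ∏ i, D i (ω i) * (if i = k then 1 else if ω i = η i then 1 else 0) := by
    intro ω
    rw [Finset.prod_mul_distrib]
    ring
  simp only [h₁]
  rw [← Finset.mul_sum, ← Fintype.piFinset_univ,
    ← Finset.prod_univ_sum (f := fun i a => D i a * (if i = k then 1 else if a = η i then 1 else 0)),
    Fintype.prod_eq_mul_prod_compl k, Fintype.prod_eq_mul_prod_compl k, Function.update_self]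
  rw [← mul_assoc]
  congr 1
  · simp only [if_true, mul_one]
    rw [← tsum_fintype (L := .unconditional _), (D k).tsum_coe, mul_one]
  · refine Finset.prod_congr rfl fun i hi => ?_
    have hi : i ≠ k := by simpa using hi
    rw [Function.update_of_ne hi]
    simp [hi]

theorem ev_piPMF_resample (D : ∀ i, PMF (A i)) (k : ι) (f : (∀ i, A i) → ℝ) :
    ev (piPMF D) f = ev (piPMF D) fun ω => ev (D k) fun a => f (Function.update ω k a) := by
  conv_lhs => rw [← Function.update_eq_self k D, ← piPMF_bind_update, ev_bind]
  simp only [ev_map]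

/-- A function of one coordinate is independent of a function of the other coordinates. -/
theorem ev_piPMF_mul (D : ∀ i, PMF (A i)) (k : ι) (f : A k → ℝ) (F : (∀ i, A i) → ℝ)
    (hF : ∀ ω a, F (Function.update ω k a) = F ω) :
    ev (piPMF D) (fun ω => f (ω k) * F ω) = ev (D k) f * ev (piPMF D) F := by
  rw [ev_piPMF_resample D k]
  simp only [Function.update_self, hF, ev_mul_right, ev_mul_left]

theorem ev_piPMF_apply (D : ∀ i, PMF (A i)) (k : ι) (f : A k → ℝ) :
    ev (piPMF D) (fun ω => f (ω k)) = ev (D k) f := by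
  simpa using ev_piPMF_mul D k f (fun _ => 1) (fun _ _ => rfl)

theorem piPMF_pure (x : ∀ i, A i) : piPMF (fun i => PMF.pure (x i)) = PMF.pure x := by
  classical
  ext η
  simp only [piPMF, PMF.ofFintype_apply, PMF.pure_apply]
  by_cases h : η = x
  · subst h; simp
  · rw [if_neg h]
    obtain ⟨i, hi⟩ := Function.ne_iff.1 h
    exact Finset.prod_eq_zero (Finset.mem_univ i) (by simp [hi])

end Pi

theorem ev_piPMF_curry {ι κ A : Type*} [Fintype ι] [DecidableEq ι] [Fintype κ] [DecidableEq κ]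
    [Fintype A] (D : ι → κ → PMF A) (f : (ι → κ → A) → ℝ) :
    ev (piPMF fun i => piPMF (D i)) f
      = ev (piPMF fun x : ι × κ => D x.1 x.2) fun ω => f fun i k => ω (i, k) := by
  simp only [ev, piPMF, PMF.ofFintype_apply]
  refine Fintype.sum_equiv (Equiv.curry ι κ A).symm _ _ fun ω => ?_
  congr 2
  exact (Fintype.prod_prod_type fun x : ι × κ => D x.1 x.2 (ω x.1 x.2)).symm

/-- The maximum of a fixed coordinate over independent copies. -/
theorem ev_piPMF_forall_le {ι A : Type*} [Fintype ι] [DecidableEq ι] [Fintype A] (p : PMF A)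
    (r : A → A → Prop) [∀ a b, Decidable (r a b)] (s : Finset ι) {k : ι} (hk : k ∉ s) :
    ev (piPMF fun _ : ι => p) (fun ω => if ∀ i ∈ s, r (ω i) (ω k) then 1 else 0)
      = ev p fun a => (ev p fun b => if r b a then 1 else 0) ^ s.card := by
  classical
  rw [ev_piPMF_resample _ k, ev_comm]
  refine congrArg _ (funext fun a => ?_)
  have : ∀ ω : ι → A, (if ∀ i ∈ s, r (Function.update ω k a i) (Function.update ω k a k)
      then (1 : ℝ) else 0) = ∏ i, if i ∈ s then (if r (ω i) a then 1 else 0) else 1 := by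
    intro ω
    have h : ∀ i ∈ s, Function.update ω k a i = ω i := fun i hi =>
      Function.update_of_ne (ne_of_mem_of_not_mem hi hk) _ _
    rw [Finset.prod_ite_mem, Finset.univ_inter, Finset.prod_ite_zero]
    simp only [Function.update_self, Finset.prod_const_one]
    refine if_congr (forall₂_congr fun i hi => by rw [h i hi]) rfl rfl
  simp only [this]
  rw [ev_piPMF_prod (fun _ => p) fun i b => if i ∈ s then (if r b a then 1 else 0) else 1]
  have h₂ : ∀ i, ev p (fun b => if i ∈ s then (if r b a then (1 : ℝ) else 0) else 1)
      = if i ∈ s then ev p (fun b => if r b a then 1 else 0) else 1 := by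
    intro i
    split_ifs <;> simp
  simp only [h₂]
  rw [Finset.prod_ite_mem, Finset.univ_inter, Finset.prod_const]

theorem ev_piPMF_pair {ι : Type*} [Fintype ι] [DecidableEq ι] {A : ι → Type*}
    [∀ i, Fintype (A i)] (D : ∀ i, PMF (A i)) {k l : ι} (h : k ≠ l) (f : A k → ℝ) (f' : A l → ℝ) :
    ev (piPMF D) (fun ω => f (ω k) * f' (ω l)) = ev (D k) f * ev (D l) f' := by
  rw [ev_piPMF_mul D k f fun ω => f' (ω l)]
  · rw [ev_piPMF_apply]
  · intro ω a
    rw [Function.update_of_ne h.symm]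

/-! ## Events and mixtures -/

section Events

variable {α : Type*} [Fintype α]

theorem ofReal_ev_map_fst {β : Type*} (γ : PMF (α × β)) {G : α → ℝ} (h₀ : ∀ a, 0 ≤ G a) :
    ENNReal.ofReal (ev (γ.map Prod.fst) G) = ∑' x, γ x * ENNReal.ofReal (G x.1) := by
  rw [ev, ENNReal.ofReal_sum_of_nonneg fun a _ => mul_nonneg ENNReal.toReal_nonneg (h₀ a),
    ENNReal.tsum_prod', tsum_fintype]
  refine Finset.sum_congr rfl fun a _ => ?_
  rw [ENNReal.ofReal_mul ENNReal.toReal_nonneg, ENNReal.ofReal_toReal (PMF.apply_ne_top _ a),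
    show ∑' b, γ (a, b) * ENNReal.ofReal (G (a, b).1)
      = (∑' b, γ (a, b)) * ENNReal.ofReal (G a) from
        ENNReal.tsum_mul_right (f := fun b => γ (a, b)) (a := ENNReal.ofReal (G a)), PMF.map_apply]
  congr 1
  rw [ENNReal.tsum_prod', tsum_eq_single a fun b hb => by simp [hb.symm]]
  simp

/-- Conditioning on the label. The bound `G` depends on the label alone, while the state may hold
further data, such as the phases, which the label does not record. -/
theorem Mix.outer_le {p : PMF State} {D : PMF α} {Q : α → State → Prop} (h : Mix p D Q)
    {f : State → PMF State} {S : Set State} {G : α → ℝ}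
    (hG : ∀ a s, Q a s → (f s).toOuterMeasure S ≤ ENNReal.ofReal (G a)) (h₀ : ∀ a, 0 ≤ G a) :
    (p.bind f).toOuterMeasure S ≤ ENNReal.ofReal (ev D G) := by
  obtain ⟨γ, rfl, rfl, h₃⟩ := h
  rw [ofReal_ev_map_fst γ h₀, PMF.bind_map, PMF.toOuterMeasure_bind_apply]
  refine ENNReal.tsum_le_tsum fun x => ?_
  by_cases hx : γ x = 0
  · simp [hx]
  · gcongr
    exact hG _ _ (h₃ x ((PMF.mem_support_iff _ _).2 hx))

theorem Mix.outer_eq {p : PMF State} {D : PMF α} {Q : α → State → Prop} (h : Mix p D Q)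
    {f : State → PMF State} {S : Set State} {G : α → ℝ}
    (hG : ∀ a s, Q a s → (f s).toOuterMeasure S = ENNReal.ofReal (G a)) (h₀ : ∀ a, 0 ≤ G a) :
    (p.bind f).toOuterMeasure S = ENNReal.ofReal (ev D G) := by
  obtain ⟨γ, rfl, rfl, h₃⟩ := h
  rw [ofReal_ev_map_fst γ h₀, PMF.bind_map, PMF.toOuterMeasure_bind_apply]
  refine tsum_congr fun x => ?_
  by_cases hx : γ x = 0
  · simp [hx]
  · simp only [Function.comp_apply]
    rw [hG _ _ (h₃ x ((PMF.mem_support_iff _ _).2 hx))]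

end Events

/-! ## Loops that fill cells independently -/

/-- After `k` rounds the coordinates below `k` are fresh samples and the others are point masses at
their initial values. -/
theorem iterLabel_update {n : ℕ} {A : Fin n → Type*} [∀ i, Fintype (A i)] (d : ∀ i, PMF (A i))
    (x : ∀ i, A i) (k : ℕ) :
    iterLabel (fun k ω => if h : k < n then (d ⟨k, h⟩).map (Function.update ω ⟨k, h⟩)
      else PMF.pure ω) x k
      = piPMF fun i : Fin n => if (i : ℕ) < k then d i else PMF.pure (x i) := by
  induction k with
  | zero => simp only [iterLabel, not_lt_zero, if_false, piPMF_pure]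
  | succ k ih =>
    rw [iterLabel, ih]
    by_cases h : k < n
    · simp only [h, dif_pos]
      rw [piPMF_bind_update]
      congr 1
      funext i
      by_cases hi : i = ⟨k, h⟩
      · subst hi
        simp
      · rw [Function.update_of_ne hi]
        have : (i : ℕ) ≠ k := fun h' => hi (Fin.ext h')
        have : (i : ℕ) < k + 1 ↔ (i : ℕ) < k := by omega
        simp only [this]
    · simp only [h, dif_neg, not_false_iff, PMF.bind_pure]
      congr 1
      funext i
      have := i.2
      rw [if_pos (by omega), if_pos (by omega)]

/-- A loop whose `k`-th round fills the `k`-th cell with a sample of `d k`. -/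
theorem Mix.loop_pi {n : ℕ} {A : Fin n → Type*} [∀ i, Fintype (A i)] (d : ∀ i, PMF (A i))
    {a : ℕ} {e : NatExpr} {c : Program} {s : State} (hn : e.eval s = n)
    (cell : ∀ i, A i → State → Prop)
    (h : ∀ k : Fin n, ∀ t, (Program.loop a e c).Frame s t →
      Mix (c.exec (t.setNat a 0 0 k)) (d k) fun b t' => cell k b t' ∧
        ∀ i < k, ∀ b', cell i b' t → cell i b' t') :
    Mix ((Program.loop a e c).exec s) (piPMF d) fun ω t => ∀ i, cell i (ω i) t := by
  -- The initial label is arbitrary, since every coordinate is overwritten by the end of the loop.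
  choose x _ using fun i => (d i).support_nonempty
  have := Mix.loop (a := a) (e := e) (c := c) (s := s) (x := x)
    (G := fun k ω => if h : k < n then (d ⟨k, h⟩).map (Function.update ω ⟨k, h⟩) else PMF.pure ω)
    (fun k ω t => ∀ i : Fin n, (i : ℕ) < k → cell i (ω i) t) (by simp) ?_
  · rw [iterLabel_update, hn] at this
    simp only [Fin.is_lt, if_true] at this
    exact this.mono fun ω t ht i => ht i trivial
  · intro k hk ω t hF ht
    rw [hn] at hk
    simp only [hk, dif_pos]
    refine (h ⟨k, hk⟩ t hF).map ?_
    rintro b t' ⟨h₁, h₂⟩ i hi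
    by_cases hik : i = ⟨k, hk⟩
    · subst hik
      simpa using h₁
    · have : (i : ℕ) ≠ k := fun h' => hik (Fin.ext h')
      rw [Function.update_of_ne hik]
      exact h₂ i (by simp only [Fin.lt_def]; omega) _ (ht i (by omega))

theorem Mix.frame {α : Type*} {c : Program} {s : State} {D : PMF α} {Q : α → State → Prop}
    (h : Mix (c.exec s) D Q) : Mix (c.exec s) D fun a t => c.Frame s t ∧ Q a t := by
  obtain ⟨γ, h₁, h₂, h₃⟩ := h
  refine ⟨γ, h₁, h₂, fun x hx => ⟨c.exec_frame s _ ?_, h₃ x hx⟩⟩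
  rw [← h₂, PMF.mem_support_map_iff]
  exact ⟨x, hx, rfl⟩

theorem Mix.flip {α : Type*} {p q : RealExpr} {c d : Program} {s : State} {G : Bool → PMF α}
    {Q : α → State → Prop} (hc : Mix (c.exec s) (G true) Q) (hd : Mix (d.exec s) (G false) Q) :
    Mix ((Program.flip p q c d).exec s) ((coin (p.eval s / q.eval s)).bind G) Q := by
  rw [Program.exec]
  refine Mix.bind_left fun b => ?_
  cases b
  · simpa using hd
  · simpa using hc

/-! ## Reservoir sampling -/

/-- The mixture that replaces a sample by `a` with probability `x`. -/
noncomputable def replaceBy {α : Type*} (D : PMF α) (x : ℝ) (a : α) : PMF α :=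
  (coin x).bind fun b => if b = true then PMF.pure a else D

/-- The step of reservoir sampling, in the unnormalized form that remains meaningful when the total
weight is still zero. -/
theorem ev_replaceBy {α : Type*} [Fintype α] {D : PMF α} {w W : ℝ} (hw : 0 ≤ w) (hW : 0 ≤ W)
    (a : α) (f : α → ℝ) :
    (W + w) * ev (replaceBy D (w / (W + w)) a) f = W * ev D f + w * f a := by
  -- For `w = 0` also `W + w` may vanish; the quotient is `0` in either case and the sample is kept.
  rcases hw.eq_or_lt with rfl | hw
  · rw [zero_div, replaceBy, ev_bind, ev_coin le_rfl zero_le_one]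
    simp
  · have h : 0 < W + w := by linarith
    rw [replaceBy, ev_bind, ev_coin (by positivity) (by rw [div_le_one h]; linarith)]
    simp only [if_true, ev_pure, Bool.false_eq_true, if_false]
    field_simp
    ring

/-! ## The systematic pair of groups of a job -/

section PairLaw

variable {n : ℕ}

/-- Groups are ordered by machine first. -/
def Before (g : Fin n → ℕ) (v u : Fin n) : Prop := g v < g u ∨ (g v = g u ∧ v < u)

instance (g : Fin n → ℕ) (v u : Fin n) : Decidable (Before g v u) := by
  unfold Before; infer_instance

/-- The left end of the interval of the group `u`. -/
noncomputable def leftEnd (g : Fin n → ℕ) (x : Fin n → ℝ) (u : Fin n) : ℝ :=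
  ∑ v with Before g v u, x v

/-- The probability of the pair `(u, v)`. -/
noncomputable def pairWeight (g : Fin n → ℕ) (x : Fin n → ℝ) (u v : Fin n) : ℝ :=
  max 0 (min (leftEnd g x u + x u) (leftEnd g x v + x v - 1)
    - max (leftEnd g x u) (leftEnd g x v - 1))

/-- The interval of each group starts where that of its predecessor ends, so the increments of `F`
telescope. The induction removes the last group in the order of `Before`, which is the lexicographic
order of `(g v, v)`. -/
theorem sum_telescope (g : Fin n → ℕ) (x : Fin n → ℝ) (F : ℝ → ℝ) :
    ∑ v, (F (leftEnd g x v + x v) - F (leftEnd g x v)) = F (∑ v, x v) - F 0 := by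
  have key : ∀ s : Finset (Fin n),
      ∑ v ∈ s, (F ((∑ w ∈ s with Before g w v, x w) + x v) - F (∑ w ∈ s with Before g w v, x w))
        = F (∑ v ∈ s, x v) - F 0 := by
    intro s
    induction s using Finset.induction_on_max_value (fun v => toLex (g v, v)) with
    | empty => simp
    | insert a s ha hmax ih =>
      have hb : ∀ w ∈ s, Before g w a := by
        intro w hw
        have h := hmax w hw
        rw [Prod.Lex.toLex_le_toLex] at h
        rcases h with h | ⟨h, h'⟩
        · exact Or.inl h
        · exact Or.inr ⟨h, lt_of_le_of_ne h' (ne_of_mem_of_not_mem hw ha)⟩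
      have hna : ∀ w ∈ s, ¬ Before g a w := by
        intro w hw h
        have := hb w hw
        unfold Before at h this
        omega
      have haa : ¬ Before g a a := by unfold Before; omega
      rw [Finset.sum_insert ha, Finset.sum_insert ha]
      rw [Finset.filter_insert, if_neg haa, Finset.filter_true_of_mem hb]
      have hf : ∀ v ∈ s, (insert a s).filter (fun w => Before g w v)
          = s.filter fun w => Before g w v := fun v hv => by
        rw [Finset.filter_insert, if_neg (hna v hv)]
      rw [Finset.sum_congr rfl fun v hv => congrArg (fun r : Finset (Fin n) =>
        F ((∑ w ∈ r, x w) + x v) - F (∑ w ∈ r, x w)) (hf v hv), ih]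
      rw [add_comm (x a)]
      ring
  exact key Finset.univ

variable {g : Fin n → ℕ} {x : Fin n → ℝ}

theorem leftEnd_nonneg (hx : ∀ u, 0 ≤ x u) (u : Fin n) : 0 ≤ leftEnd g x u :=
  Finset.sum_nonneg fun v _ => hx v

theorem rightEnd_le (hx : ∀ u, 0 ≤ x u) (u : Fin n) : leftEnd g x u + x u ≤ ∑ v, x v := by
  have : u ∉ Finset.univ.filter (fun v => Before g v u) := fun h => by
    have := (Finset.mem_filter.1 h).2
    unfold Before at this
    omega
  rw [leftEnd, add_comm, ← Finset.sum_insert this]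
  exact Finset.sum_le_sum_of_subset_of_nonneg (Finset.subset_univ _) fun v _ _ => hx v

/-- The length of an overlap is an increment of the clamping function onto `[a, b]`, the form to
which `sum_telescope` applies. -/
theorem overlap_eq {a b s t : ℝ} (hab : a ≤ b) (hst : s ≤ t) :
    max 0 (min b t - max a s) = max a (min b t) - max a (min b s) := by
  rcases le_total b t with h₁ | h₁ <;> rcases le_total a s with h₂ | h₂ <;>
  rcases le_total b s with h₃ | h₃ <;> rcases le_total a t with h₄ | h₄ <;>
  simp only [min_eq_left, min_eq_right, max_eq_left, max_eq_right, h₁, h₂, h₃, h₄, hab] <;>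
  first
  | (rw [max_eq_left (by linarith)]; linarith)
  | rw [max_eq_right (by linarith)]

/-- Shifted by `-1` the intervals tile `[-1, 1]`; they cover exactly the part of the interval of `u`
below `1`. -/
theorem sum_pairWeight_left (hx : ∀ u, 0 ≤ x u) (h : ∑ v, x v = 2) (u : Fin n) :
    ∑ v, pairWeight g x u v
      = max (leftEnd g x u) (min (leftEnd g x u + x u) 1) - leftEnd g x u := by
  have := sum_telescope g x fun t =>
    max (leftEnd g x u) (min (leftEnd g x u + x u) (t - 1))
  rw [h] at this
  rw [show (2 : ℝ) - 1 = 1 by norm_num] at this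
  have h₀ := leftEnd_nonneg (g := g) hx u
  have h₁ := hx u
  rw [show max (leftEnd g x u) (min (leftEnd g x u + x u) (0 - 1)) = leftEnd g x u from
    max_eq_left ((min_le_right _ _).trans (by linarith))] at this
  rw [← this]
  refine Finset.sum_congr rfl fun v _ => ?_
  exact overlap_eq (by linarith [hx u]) (by linarith [hx v])

/-- Symmetrically, as second member of the pair `u` collects the part of its interval above `1`. -/
theorem sum_pairWeight_right (hx : ∀ u, 0 ≤ x u) (h : ∑ v, x v = 2) (u : Fin n) :
    ∑ v, pairWeight g x v u
      = x u - (max (leftEnd g x u) (min (leftEnd g x u + x u) 1) - leftEnd g x u) := by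
  have := sum_telescope g x fun t =>
    max (leftEnd g x u - 1) (min (leftEnd g x u + x u - 1) t)
  rw [h] at this
  have h₀ := rightEnd_le (g := g) hx u
  have h₁ := hx u
  rw [show max (leftEnd g x u - 1) (min (leftEnd g x u + x u - 1) 2) = leftEnd g x u + x u - 1 by
      rw [min_eq_left (by linarith), max_eq_right (by linarith)],
    show max (leftEnd g x u - 1) (min (leftEnd g x u + x u - 1) 0)
      = max (leftEnd g x u) (min (leftEnd g x u + x u) 1) - 1 by
      rw [← max_sub_sub_right, ← min_sub_sub_right]; norm_num] at this
  rw [show x u - (max (leftEnd g x u) (min (leftEnd g x u + x u) 1) - leftEnd g x u)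
    = leftEnd g x u + x u - 1 - (max (leftEnd g x u) (min (leftEnd g x u + x u) 1) - 1) by ring,
    ← this]
  refine Finset.sum_congr rfl fun v _ => ?_
  rw [pairWeight, min_comm, max_comm (leftEnd g x v)]
  exact overlap_eq (by linarith [hx u]) (by linarith [hx v])

theorem sum_pairWeight_add (hx : ∀ u, 0 ≤ x u) (h : ∑ v, x v = 2) (u : Fin n) :
    ∑ v, pairWeight g x u v + ∑ v, pairWeight g x v u = x u := by
  rw [sum_pairWeight_left hx h, sum_pairWeight_right hx h]
  ring

theorem sum_sum_pairWeight (hx : ∀ u, 0 ≤ x u) (h : ∑ v, x v = 2) :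
    ∑ u, ∑ v, pairWeight g x u v = 1 := by
  have h₁ : ∑ u, (∑ v, pairWeight g x u v + ∑ v, pairWeight g x v u) = 2 := by
    simp only [sum_pairWeight_add hx h, h]
  rw [Finset.sum_add_distrib, Finset.sum_comm (f := fun u v => pairWeight g x v u)] at h₁
  linarith

theorem pairWeight_nonneg (u v : Fin n) : 0 ≤ pairWeight g x u v := le_max_left _ _

/-- The groups of one machine occupy a contiguous interval. An overlap of positive length puts
points at distance `1` into it and leaves room to spare, so it is longer than `1`. -/
theorem one_lt_of_pairWeight_pos (hx : ∀ u, 0 ≤ x u) {u v : Fin n} (huv : g u = g v)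
    (h : 0 < pairWeight g x u v) : 1 < ∑ w with g w = g u, x w := by
  have h₁ : 1 < leftEnd g x v + x v - leftEnd g x u := by
    rw [pairWeight, lt_max_iff] at h
    rcases h with h | h
    · exact absurd h (lt_irrefl _)
    · linarith [min_le_right (leftEnd g x u + x u) (leftEnd g x v + x v - 1),
        le_max_left (leftEnd g x u) (leftEnd g x v - 1)]
  have hv : v ∉ Finset.univ.filter (fun w => Before g w v) := fun h => by
    have := (Finset.mem_filter.1 h).2
    unfold Before at this
    omega
  have h₂ : leftEnd g x v + x v ≤ leftEnd g x u + ∑ w with g w = g u, x w := by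
    rw [leftEnd, leftEnd, add_comm, ← Finset.sum_insert hv, ← Finset.sum_union_inter]
    refine le_add_of_le_of_nonneg (Finset.sum_le_sum_of_subset_of_nonneg ?_ fun w _ _ => hx w)
      (Finset.sum_nonneg fun w _ => hx w)
    intro w hw
    simp only [Finset.mem_insert, Finset.mem_filter, Finset.mem_univ, true_and,
      Finset.mem_union] at hw ⊢
    unfold Before at hw ⊢
    rcases hw with rfl | hw | hw
    · exact Or.inr huv.symm
    · exact Or.inl (Or.inl (by omega))
    · exact Or.inr (by omega)
  linarith

end PairLaw

/-! ## Analytic estimates -/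

/-- The left side bounds the probability that a job of mass `x` appears in the first class of a
group, the right side is the probability that a Poisson variable of mean `1.03 x` is positive. After
multiplication by the exponential, its Taylor polynomial suffices. -/
theorem sub_sq_le_one_sub_exp {x : ℝ} (h₀ : 0 ≤ x) (h₁ : x ≤ 2) :
    x - 2 / 5 * x ^ 2 ≤ 1 - Real.exp (-(1.03 * x)) := by
  have h₂ : 0 < 1 - x + 2 / 5 * x ^ 2 := by nlinarith [sq_nonneg (x - 5 / 4)]
  have h₃ := Real.sum_le_exp_of_nonneg (x := 1.03 * x) (by positivity) 6
  simp only [Finset.sum_range_succ, Finset.sum_range_zero, Nat.factorial] at h₃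
  have key : 1 ≤ (1 - x + 2 / 5 * x ^ 2) * (1 + (1.03 * x) + (1.03 * x) ^ 2 / 2
      + (1.03 * x) ^ 3 / 6 + (1.03 * x) ^ 4 / 24 + (1.03 * x) ^ 5 / 120) := by
    rw [← sub_nonneg]
    -- On `[0, 1/2]` and on `[1/2, 2]` the difference is `x` times a form of degree six in the
    -- distances to the end points, with positive coefficients.
    rcases le_total x (1 / 2) with h | h
    · obtain ⟨b, hb⟩ : ∃ b, b = 1 / 2 - x := ⟨_, rfl⟩
      have hb₀ : 0 ≤ b := by linarith
      have : (1 - x + 2 / 5 * x ^ 2) * (1 + (1.03 * x) + (1.03 * x) ^ 2 / 2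
          + (1.03 * x) ^ 3 / 6 + (1.03 * x) ^ 4 / 24 + (1.03 * x) ^ 5 / 120) - 1 = x * (
      (48/25) * x ^ 0 * b ^ 6 +
      (5209/625) * x ^ 1 * b ^ 5 +
      (5209027/375000) * x ^ 2 * b ^ 4 +
      (3370378481/300000000) * x ^ 3 * b ^ 3 +
      (1513741303243/300000000000) * x ^ 4 * b ^ 2 +
      (363394854143/200000000000) * x ^ 5 * b ^ 1 +
      (266645221743/500000000000) * x ^ 6 * b ^ 0) := by
        rw [hb]; ring
      rw [this]; positivity
    · obtain ⟨b, hb⟩ : ∃ b, b = 2 - x := ⟨_, rfl⟩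
      obtain ⟨a, ha⟩ : ∃ a, a = x - 1 / 2 := ⟨_, rfl⟩
      have hb₀ : 0 ≤ b := by linarith
      have ha₀ : 0 ≤ a := by linarith
      have : (1 - x + 2 / 5 * x ^ 2) * (1 + (1.03 * x) + (1.03 * x) ^ 2 / 2
          + (1.03 * x) ^ 3 / 6 + (1.03 * x) ^ 4 / 24 + (1.03 * x) ^ 5 / 120) - 1 = x * (
      (88881740581/121500000000000) * a ^ 0 * b ^ 6 +
      (2449349277173/243000000000000) * a ^ 1 * b ^ 5 +
      (2146116309701/24300000000000) * a ^ 2 * b ^ 4 +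
      (973857833273/3037500000000) * a ^ 3 * b ^ 3 +
      (210396213059/379687500000) * a ^ 4 * b ^ 2 +
      (221870385559/474609375000) * a ^ 5 * b ^ 1 +
      (75394770331/474609375000) * a ^ 6 * b ^ 0) := by
        rw [hb, ha]; ring
      rw [this]; positivity
  have h₄ : 1 ≤ (1 - x + 2 / 5 * x ^ 2) * Real.exp (1.03 * x) := by
    refine key.trans (mul_le_mul_of_nonneg_left (le_trans (le_of_eq ?_) h₃) h₂.le)
    norm_num
  have h₅ : Real.exp (-(1.03 * x)) ≤ 1 - x + 2 / 5 * x ^ 2 := by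
    rw [Real.exp_neg, inv_le_iff_one_le_mul₀ (Real.exp_pos _)]
    exact h₄
  linarith

/-- The probability that two given members of a group with `m` other members are linked by the
round robin, set to zero for large groups. -/
noncomputable def linkProb : ℕ → ℝ
  | 0 => 1
  | 1 => 1 / 3
  | 2 => 1 / 3
  | 3 => 1 / 5
  | 4 => 1 / 5
  | 5 => 1 / 7
  | 6 => 1 / 7
  | _ + 7 => 0

theorem linkProb_nonneg (m : ℕ) : 0 ≤ linkProb m := by
  unfold linkProb; split <;> norm_num

theorem linkProb_add_seven (i m : ℕ) : linkProb (i + (m + 7)) = 0 := rfl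

theorem linkProb_succ_le (m : ℕ) : linkProb (m + 1) ≤ linkProb m := by
  match m with
  | 0 | 1 | 2 | 3 | 4 | 5 | 6 => norm_num [linkProb]
  | m + 7 => exact le_rfl

/-- The partial exponential series of `m ↦ linkProb (i + m)`. -/
noncomputable def linkSeries (i : ℕ) (t : ℝ) : ℝ :=
  ∑ m ∈ Finset.range 7, t ^ m / m.factorial * linkProb (i + m)

theorem linkSeries_nonneg (i : ℕ) {t : ℝ} (ht : 0 ≤ t) : 0 ≤ linkSeries i t :=
  Finset.sum_nonneg fun m _ => mul_nonneg (by positivity) (linkProb_nonneg _)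

theorem linkSeries_succ_le (i : ℕ) {t : ℝ} (ht : 0 ≤ t) : linkSeries (i + 1) t ≤ linkSeries i t :=
  Finset.sum_le_sum fun m _ => mul_le_mul_of_nonneg_left
    (by rw [add_right_comm]; exact linkProb_succ_le _) (by positivity)

/-- Expand `(s + t) ^ m` by the binomial theorem. Since `linkProb` decreases, every term with at
least one factor `t` may be treated as if it shifted the index by exactly one. -/
theorem linkSeries_add_le (i : ℕ) {s t : ℝ} (hs : 0 ≤ s) (ht : 0 ≤ t) :
    linkSeries i (s + t) ≤ linkSeries i s + (Real.exp t - 1) * linkSeries (i + 1) s := by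
  have hc : ∀ m, linkProb (i + (m + 1)) ≤ linkProb (i + m) := fun m => linkProb_succ_le _
  have hc' : ∀ k m, linkProb (i + (m + k)) ≤ linkProb (i + m) := by
    intro k m
    induction k with
    | zero => rfl
    | succ k ih => exact (hc (m + k)).trans ih
  have h₇ : ∀ m, linkProb (i + (m + 7)) = 0 := linkProb_add_seven i
  have hexp := Real.sum_le_exp_of_nonneg ht 7
  -- The truncated series obey the binomial expansion exactly because `linkProb` vanishes from `7`
  -- on.
  have e : linkSeries i (s + t) = linkSeries i s + ∑ b ∈ Finset.range 6,
      t ^ (b + 1) / (b + 1).factorial * ∑ a ∈ Finset.range 7,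
        s ^ a / a.factorial * linkProb (i + (a + (b + 1))) := by
    simp only [linkSeries, Finset.sum_range_succ, Finset.sum_range_zero]
    simp only [Nat.reduceAdd, h₇ 0, h₇ 1, h₇ 2, h₇ 3, h₇ 4, h₇ 5, Nat.factorial]
    push_cast
    ring
  have hS : 0 ≤ linkSeries (i + 1) s := linkSeries_nonneg _ hs
  rw [e]
  gcongr
  calc ∑ b ∈ Finset.range 6, t ^ (b + 1) / (b + 1).factorial * ∑ a ∈ Finset.range 7,
        s ^ a / a.factorial * linkProb (i + (a + (b + 1)))
      ≤ ∑ b ∈ Finset.range 6, t ^ (b + 1) / (b + 1).factorial * linkSeries (i + 1) s := by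
        refine Finset.sum_le_sum fun b _ => mul_le_mul_of_nonneg_left
          (Finset.sum_le_sum fun a _ => mul_le_mul_of_nonneg_left ?_ (by positivity)) (by positivity)
        have := hc' b (a + 1)
        rwa [show i + (a + 1 + b) = i + (a + (b + 1)) by ring,
          show i + (a + 1) = i + 1 + a by ring] at this
    _ = (∑ m ∈ Finset.range 7, t ^ m / m.factorial - 1) * linkSeries (i + 1) s := by
        rw [← Finset.sum_mul, Finset.sum_range_succ' _ 6]
        simp
    _ ≤ (Real.exp t - 1) * linkSeries (i + 1) s := by gcongr

/-- The product is the expectation of `linkProb (i + N)` for a Poisson variable `N` of mean `t`, and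
more competitors make a link less likely. -/
theorem exp_neg_mul_linkSeries_antitone {s t : ℝ} (hs : 0 ≤ s) (hst : s ≤ t) (i : ℕ) :
    Real.exp (-t) * linkSeries i t ≤ Real.exp (-s) * linkSeries i s := by
  have h := linkSeries_add_le i hs (sub_nonneg.2 hst)
  rw [add_sub_cancel] at h
  have h₁ := linkSeries_succ_le i hs
  have h₂ : 0 ≤ Real.exp (t - s) - 1 := by linarith [Real.one_le_exp (sub_nonneg.2 hst)]
  have h₃ : linkSeries i t ≤ Real.exp (t - s) * linkSeries i s := by nlinarith
  calc Real.exp (-t) * linkSeries i t ≤ Real.exp (-t) * (Real.exp (t - s) * linkSeries i s) := by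
        gcongr
    _ = Real.exp (-s) * linkSeries i s := by
        rw [← mul_assoc, ← Real.exp_add]; ring_nf

/-! ### Comparison of independent events with a Poisson variable -/

section Poisson

variable {ι : Type*} [Fintype ι] [DecidableEq ι] {A : ι → Type*} [∀ i, Fintype (A i)]
  (D : ∀ i, PMF (A i)) (b : ∀ i, A i → Prop) [∀ i a, Decidable (b i a)]

/-- The number of events among those in `s`. -/
def countOn (s : Finset ι) (ω : ∀ i, A i) : ℕ := (s.filter fun i => b i (ω i)).card

variable {b}

omit [Fintype ι] [∀ i, Fintype (A i)] in
theorem countOn_insert_update {s : Finset ι} {k : ι} (hk : k ∉ s) (ω : ∀ i, A i) (a : A k) :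
    countOn b (insert k s) (Function.update ω k a) = countOn b s ω + if b k a then 1 else 0 := by
  unfold countOn
  have h : s.filter (fun i => b i (Function.update ω k a i)) = s.filter fun i => b i (ω i) :=
    Finset.filter_congr fun i hi => by
      rw [Function.update_of_ne (ne_of_mem_of_not_mem hi hk)]
  rw [Finset.filter_insert, h, Function.update_self]
  split_ifs with hb
  · rw [Finset.card_insert_of_notMem (by simp [hk])]
  · rfl

omit [Fintype ι] [∀ i, Fintype (A i)] in
theorem countOn_update {s : Finset ι} {k : ι} (hk : k ∉ s) (ω : ∀ i, A i) (a : A k) :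
    countOn b s (Function.update ω k a) = countOn b s ω := by
  unfold countOn
  congr 1
  exact Finset.filter_congr fun i hi => by
    rw [Function.update_of_ne (ne_of_mem_of_not_mem hi hk)]

/-- An event of probability at most `1 - exp (-r)` is dominated by a Poisson variable of mean `r`,
and `linkProb` is decreasing. The coordinates are exchanged one at a time; the offset `i` is general
because an event that occurs raises it. -/
theorem linkSeries_le_ev_linkProb (s : Finset ι) (r : ι → ℝ) (hr : ∀ i, 0 ≤ r i)
    (hf : ∀ i ∈ s, ev (D i) (fun a => if b i a then 1 else 0) ≤ 1 - Real.exp (-r i)) (i : ℕ) :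
    Real.exp (-∑ k ∈ s, r k) * linkSeries i (∑ k ∈ s, r k)
      ≤ ev (piPMF D) fun ω => linkProb (i + countOn b s ω) := by
  induction s using Finset.induction_on generalizing i with
  | empty =>
    simp [countOn, linkSeries, Finset.sum_range_succ]
  | insert k s hk ih =>
    have ih' := ih fun i hi => hf i (Finset.mem_insert_of_mem hi)
    rw [ev_piPMF_resample D k]
    simp only [countOn_insert_update hk]
    set f := ev (D k) (fun a => if b k a then 1 else 0) with hfk
    have e : ∀ ω, ev (D k) (fun a => linkProb (i + (countOn b s ω + if b k a then 1 else 0)))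
        = (1 - f) * linkProb (i + countOn b s ω) + f * linkProb (i + 1 + countOn b s ω) := by
      intro ω
      have : ∀ a, linkProb (i + (countOn b s ω + if b k a then 1 else 0))
          = linkProb (i + countOn b s ω) + (if b k a then 1 else 0) *
            (linkProb (i + 1 + countOn b s ω) - linkProb (i + countOn b s ω)) := by
        intro a
        split_ifs
        · rw [show i + (countOn b s ω + 1) = i + 1 + countOn b s ω by ring]; ring
        · simp
      simp only [this]
      rw [ev_add, ev_const, ev_mul_right]
      ring
    simp only [e]
    rw [ev_add, ev_mul_left, ev_mul_left, Finset.sum_insert hk, add_comm (r k)]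
    set t := ∑ k ∈ s, r k
    have ht : 0 ≤ t := Finset.sum_nonneg fun k _ => hr k
    have hf₀ : 0 ≤ f := ev_nonneg fun a => by split_ifs <;> norm_num
    have hf₁ : f ≤ 1 - Real.exp (-r k) := hf k (Finset.mem_insert_self _ _)
    have hp := Real.exp_pos (-r k)
    have h₁ := mul_le_mul_of_nonneg_left (linkSeries_add_le i ht (hr k))
      (Real.exp_pos (-(t + r k))).le
    have h₂ := mul_le_mul_of_nonneg_left (linkSeries_succ_le i ht) (Real.exp_pos (-t)).le
    have h₃ : Real.exp (-(t + r k))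
        * (linkSeries i t + (Real.exp (r k) - 1) * linkSeries (i + 1) t)
        = Real.exp (-r k) * (Real.exp (-t) * linkSeries i t)
          + (1 - Real.exp (-r k)) * (Real.exp (-t) * linkSeries (i + 1) t) := by
      rw [neg_add, Real.exp_add]
      have : Real.exp (-r k) * Real.exp (r k) = 1 := by rw [← Real.exp_add]; simp
      linear_combination (Real.exp (-t) * linkSeries (i + 1) t) * this
    have h₄ := mul_le_mul_of_nonneg_left (ih' i) (by linarith : 0 ≤ 1 - f)
    have h₅ := mul_le_mul_of_nonneg_left (ih' (i + 1)) hf₀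
    -- The new expectation averages the old ones at offsets `i` and `i + 1` with weights `1 - f` and
    -- `f`. The former has the larger lower bound, so its weight may be reduced to `exp (-r k)`.
    nlinarith

/-- Given that no event `b` occurs, the coordinates remain independent, and by `hx` the event `b'`
at `i` has conditional probability at most `x i`. The second estimate is therefore linearity of the
conditional expectation, written without division; its induction uses the first one for the sign of
the probability. -/
theorem exp_neg_le_ev_countOn_eq_zero {b' : ∀ i, A i → Prop} [∀ i a, Decidable (b' i a)]
    (s : Finset ι) (r x : ι → ℝ)
    (hf : ∀ i ∈ s, ev (D i) (fun a => if b i a then 1 else 0) ≤ 1 - Real.exp (-r i))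
    (hx : ∀ i ∈ s, ev (D i) (fun a => if b' i a then 1 else 0)
      ≤ x i * (1 - ev (D i) (fun a => if b i a then 1 else 0)))
    (hdisj : ∀ i a, b i a → ¬ b' i a) :
    Real.exp (-∑ k ∈ s, r k)
        ≤ ev (piPMF D) (fun ω => if countOn b s ω = 0 then 1 else 0) ∧
      ev (piPMF D) (fun ω => if countOn b s ω = 0 then (countOn b' s ω : ℝ) else 0)
        ≤ (∑ k ∈ s, x k) * ev (piPMF D) (fun ω => if countOn b s ω = 0 then 1 else 0) := by
  induction s using Finset.induction_on with
  | empty => simp [countOn]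
  | insert k s hk ih =>
    obtain ⟨h₁, h₂⟩ := ih (fun i hi => hf i (Finset.mem_insert_of_mem hi))
      fun i hi => hx i (Finset.mem_insert_of_mem hi)
    rw [ev_piPMF_resample D k]
    conv in ev (piPMF D) (fun ω => if countOn b (insert k s) ω = 0 then (countOn b' _ ω : ℝ) else 0) =>
      rw [ev_piPMF_resample D k]
    simp only [countOn_insert_update hk]
    set f := ev (D k) (fun a => if b k a then 1 else 0) with hfk
    set q := ev (D k) (fun a => if b' k a then 1 else 0) with hqk
    set P := ev (piPMF D) (fun ω => if countOn b s ω = 0 then 1 else 0) with hP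
    have e₁ : ∀ ω, ev (D k)
        (fun a => if (countOn b s ω + if b k a then 1 else 0) = 0 then (1 : ℝ) else 0)
        = (1 - f) * if countOn b s ω = 0 then 1 else 0 := by
      intro ω
      have : ∀ a, (if (countOn b s ω + if b k a then 1 else 0) = 0 then (1 : ℝ) else 0)
          = (1 - if b k a then 1 else 0) * if countOn b s ω = 0 then 1 else 0 := by
        intro a
        by_cases h : b k a <;> simp [h]
      simp only [this]
      rw [ev_mul_right, ev_sub, ev_const]
    have e₂ : ∀ ω, ev (D k)
        (fun a => if (countOn b s ω + if b k a then 1 else 0) = 0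
          then ((countOn b' s ω + if b' k a then 1 else 0 : ℕ) : ℝ) else 0)
        = (1 - f) * (if countOn b s ω = 0 then (countOn b' s ω : ℝ) else 0)
          + q * if countOn b s ω = 0 then 1 else 0 := by
      intro ω
      have : ∀ a, (if (countOn b s ω + if b k a then 1 else 0) = 0
          then ((countOn b' s ω + if b' k a then 1 else 0 : ℕ) : ℝ) else 0)
          = (1 - if b k a then 1 else 0) * (if countOn b s ω = 0 then (countOn b' s ω : ℝ) else 0)
          + (if b' k a then 1 else 0) * if countOn b s ω = 0 then 1 else 0 := by
        intro a
        by_cases h : b k a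
        · simp [h, hdisj k a h]
        · by_cases h' : b' k a
          · by_cases h0 : countOn b s ω = 0 <;> simp [h, h', h0]
          · simp [h, h']
      simp only [this]
      rw [ev_add, ev_mul_right, ev_mul_right, ev_sub, ev_const]
    simp only [e₁, e₂]
    rw [ev_add, ev_mul_left, ev_mul_left, ev_mul_left, Finset.sum_insert hk, Finset.sum_insert hk,
      neg_add, Real.exp_add, ← hP]
    have hf₁ := hf k (Finset.mem_insert_self _ _)
    have hx₁ := hx k (Finset.mem_insert_self _ _)
    have hp := Real.exp_pos (-r k)
    have hp' := Real.exp_pos (-∑ k ∈ s, r k)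
    have hP₀ : 0 ≤ P := hp'.le.trans h₁
    constructor
    · exact mul_le_mul (by linarith) h₁ hp'.le (by linarith)
    · have h₃ := mul_le_mul_of_nonneg_left h₂ (by linarith : 0 ≤ 1 - f)
      have h₄ := mul_le_mul_of_nonneg_right hx₁ hP₀
      nlinarith

end Poisson

/-- Taylor's formula with remainder is available for arguments up to `1`, so it is applied to `t /
3` and cubed; `5/96` is the coefficient of the remainder after four terms. -/
theorem exp_le_cube {t : ℝ} (h₀ : 0 ≤ t) (h₁ : t ≤ 3) :
    Real.exp t ≤ (1 + t / 3 + (t / 3) ^ 2 / 2 + (t / 3) ^ 3 / 6 + 5 / 96 * (t / 3) ^ 4) ^ 3 := by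
  have h := Real.exp_bound' (x := t / 3) (by positivity) (by linarith) (n := 4) (by norm_num)
  have e : Real.exp t = Real.exp (t / 3) ^ 3 := by
    rw [← Real.exp_nat_mul]; congr 1; push_cast; ring
  rw [e]
  refine pow_le_pow_left₀ (Real.exp_pos _).le (h.trans (le_of_eq ?_)) 3
  simp only [Finset.sum_range_succ, Finset.sum_range_zero, Nat.factorial]
  push_cast
  ring

theorem linkSeries_zero_eq (t : ℝ) : linkSeries 0 t = 1 + t / 3 + t ^ 2 / 6 + t ^ 3 / 30
    + t ^ 4 / 120 + t ^ 5 / 840 + t ^ 6 / 5040 := by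
  simp only [linkSeries, Finset.sum_range_succ, Finset.sum_range_zero, Nat.factorial, zero_add,
    linkProb]
  push_cast
  ring

/-- The probability of a link is at least `0.3647`. -/
theorem link_numeric {x x' : ℝ} (hx : 0 ≤ x) (hx' : 0 ≤ x') (h : x + x' ≤ 2) :
    0.3647 ≤ (1 - 2 / 5 * x) * (1 - 2 / 5 * x')
        * (Real.exp (-(1.03 * (2 - x - x'))) * linkSeries 0 (1.03 * (2 - x - x')))
      + ((1 - 2 / 5 * x) * (2 / 5 * x') + (2 / 5 * x) * (1 - 2 / 5 * x'))
        * (Real.exp (-(1.03 * (2 - x - x'))) * ((3 - (2 - x - x')) / 4)) := by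
  obtain ⟨L, hL⟩ : ∃ L, L = 2 - x - x' := ⟨_, rfl⟩
  have hL₀ : 0 ≤ L := by linarith
  have hL₁ : L ≤ 2 := by linarith
  rw [← hL]
  have hexp := exp_le_cube (t := 1.03 * L) (by positivity) (by linarith)
  set q := linkSeries 0 (1.03 * L) with hq
  rw [linkSeries_zero_eq] at hq
  obtain ⟨b, hb⟩ : ∃ b, b = 2 - L := ⟨_, rfl⟩
  have hb₀ : 0 ≤ b := by linarith
  -- For fixed `L = 2 - x - x'` the claim, multiplied by `exp (1.03 L)`, is affine in `x x'`. It is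
  -- checked at the two extremes `0` (here) and `(2 - L)² / 4` (`hB`), each time by a polynomial
  -- with positive coefficients in `L` and `b = 2 - L`.
  have hA : 0.3647 * Real.exp (1.03 * L) ≤ (1 - 2 / 5 * (2 - L)) * q
      + 1 / 10 * (2 - L) * (3 - L) := by
    refine (mul_le_mul_of_nonneg_left hexp (by norm_num)).trans ?_
    rw [← sub_nonneg]
    have : (1 - 2 / 5 * (2 - L)) * q + 1 / 10 * (2 - L) * (3 - L)
        - 0.3647 * (1 + 1.03 * L / 3 + (1.03 * L / 3) ^ 2 / 2 + (1.03 * L / 3) ^ 3 / 6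
          + 5 / 96 * (1.03 * L / 3) ^ 4) ^ 3 =
      (4353/81920000) * L ^ 0 * b ^ 13 +
      (7267427/12288000000) * L ^ 1 * b ^ 12 +
      (3675447331/1228800000000) * L ^ 2 * b ^ 11 +
      (557659137481/61440000000000) * L ^ 3 * b ^ 10 +
      (24383954033807437/1327104000000000000) * L ^ 4 * b ^ 9 +
      (3029135100721196779/116121600000000000000) * L ^ 5 * b ^ 8 +
      (1190255037886702646713/44789760000000000000000) * L ^ 6 * b ^ 7 +
      (91907178672993427749809/4702924800000000000000000) * L ^ 7 * b ^ 6 +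
      (4658345810227418239919508823/451480780800000000000000000000) * L ^ 8 * b ^ 5 +
      (2360674216145088036881367111539/609499054080000000000000000000000) * L ^ 9 * b ^ 4 +
      (12675895077477451522937371326569/12189981081600000000000000000000000) * L ^ 10 * b ^ 3 +
      (77588742744103231195524449801947/365699432448000000000000000000000000) * L ^ 11 * b ^ 2 +
      (2645744702758470301635088644445153/75229597532160000000000000000000000000) * L ^ 12 * b ^ 1 +
      (1895142993806053363528527281597191/526607182725120000000000000000000000000) * L ^ 13 * b ^ 0 := by
      rw [hq, hb]; ring
    rw [this]; positivity
  have hB : 0.3647 * Real.exp (1.03 * L) ≤ (1 - 2 / 5 * (2 - L)) * q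
      + 1 / 10 * (2 - L) * (3 - L) + (2 - L) ^ 2 / 4 * (4 / 25 * q - 2 / 25 * (3 - L)) := by
    refine (mul_le_mul_of_nonneg_left hexp (by norm_num)).trans ?_
    rw [← sub_nonneg]
    have : (1 - 2 / 5 * (2 - L)) * q
        + 1 / 10 * (2 - L) * (3 - L) + (2 - L) ^ 2 / 4 * (4 / 25 * q - 2 / 25 * (3 - L))
        - 0.3647 * (1 + 1.03 * L / 3 + (1.03 * L / 3) ^ 2 / 2 + (1.03 * L / 3) ^ 3 / 6
          + 5 / 96 * (1.03 * L / 3) ^ 4) ^ 3 =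
      (3553/81920000) * L ^ 0 * b ^ 13 +
      (2117409/4096000000) * L ^ 1 * b ^ 12 +
      (1145740577/409600000000) * L ^ 2 * b ^ 11 +
      (185909096707/20480000000000) * L ^ 3 * b ^ 10 +
      (26077639896446797/1327104000000000000) * L ^ 4 * b ^ 9 +
      (3464282802359024299/116121600000000000000) * L ^ 5 * b ^ 8 +
      (10186655674694297646031/313528320000000000000000) * L ^ 6 * b ^ 7 +
      (17127920220634109039687/671846400000000000000000) * L ^ 7 * b ^ 6 +
      (6438835337744805003695508823/451480780800000000000000000000) * L ^ 8 * b ^ 5 +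
      (3384276938485272064298967111539/609499054080000000000000000000000) * L ^ 9 * b ^ 4 +
      (17783897673644468595833371326569/12189981081600000000000000000000000) * L ^ 10 * b ^ 3 +
      (94693193972122699515780449801947/365699432448000000000000000000000000) * L ^ 11 * b ^ 2 +
      (2645744702758470301635088644445153/75229597532160000000000000000000000000) * L ^ 12 * b ^ 1 +
      (1895142993806053363528527281597191/526607182725120000000000000000000000000) * L ^ 13 * b ^ 0 := by
      rw [hq, hb]; ring
    rw [this]; positivity
  have hC : 0.3647 * Real.exp (1.03 * L) ≤ (1 - 2 / 5 * (2 - L)) * q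
      + 1 / 10 * (2 - L) * (3 - L) + x * x' * (4 / 25 * q - 2 / 25 * (3 - L)) := by
    have hp₀ : 0 ≤ x * x' := mul_nonneg hx hx'
    have hp₁ : x * x' ≤ (2 - L) ^ 2 / 4 := by rw [hL]; nlinarith [sq_nonneg (x - x')]
    rcases le_total 0 (4 / 25 * q - 2 / 25 * (3 - L)) with h | h
    · nlinarith
    · nlinarith
  have hpos := Real.exp_pos (-(1.03 * L))
  have h₁ := mul_le_mul_of_nonneg_left hC hpos.le
  have h₂ : Real.exp (-(1.03 * L)) * Real.exp (1.03 * L) = 1 := by rw [← Real.exp_add]; simp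
  have h₃ : Real.exp (-(1.03 * L)) * (0.3647 * Real.exp (1.03 * L)) = 0.3647 := by
    linear_combination 0.3647 * h₂
  rw [h₃] at h₁
  refine h₁.trans (le_of_eq ?_)
  rw [hL]; ring

/-! ## Partial matchings of half-edges -/

/-- The other half-edge of the same job. -/
def fl {n : ℕ} (h : Fin n × Bool) : Fin n × Bool := (h.1, !h.2)

@[simp] theorem fl_fl {n : ℕ} (h : Fin n × Bool) : fl (fl h) = h := by simp [fl]

@[simp] theorem fl_fst {n : ℕ} (h : Fin n × Bool) : (fl h).1 = h.1 := rfl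

theorem fl_ne {n : ℕ} (h : Fin n × Bool) : fl h ≠ h := by
  intro e
  have := congrArg Prod.snd e
  simp [fl] at this

theorem eq_or_eq_fl {n : ℕ} {h h' : Fin n × Bool} (e : h.1 = h'.1) : h = h' ∨ h = fl h' := by
  obtain ⟨j, b⟩ := h
  obtain ⟨j', b'⟩ := h'
  simp only at e
  subst e
  cases b <;> cases b' <;> simp [fl]

/-- A partial matching `α` of the half-edges of `n` jobs (fixed points are unmatched), which
respects the machines of the half-edges, such that jobs with matched half-edges have their two
half-edges on different machines. -/
structure Links (n : ℕ) where
  α : Fin n × Bool → Fin n × Bool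
  mach : Fin n × Bool → ℕ
  inv : ∀ h, α (α h) = h
  mach_α : ∀ h, mach (α h) = mach h
  cross : ∀ h, α h ≠ h → mach (fl h) ≠ mach h

namespace Links

variable {n : ℕ} (L : Links n)

/-- The job could join the block of the job of `h` through `h`. -/
def Valid (h : Fin n × Bool) : Prop :=
  L.α h ≠ h ∧ L.α (fl h) ≠ fl h ∧ L.mach (fl (L.α h)) ≠ L.mach (fl h) ∧
    L.mach h ≠ L.mach (fl (L.α (fl h)))

/-- The link at `h` is valid from one of its sides. -/
def Joinable (h : Fin n × Bool) : Prop := L.Valid h ∨ L.Valid (L.α h)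

/-- The half-edge of a link with the smaller job. -/
def canon (h : Fin n × Bool) : Fin n × Bool := if h.1 < (L.α h).1 then h else L.α h

open Classical in
/-- The level of a link. -/
noncomputable def el (B : ℕ) (lev : Fin n × Bool → ℕ) (h : Fin n × Bool) : ℕ :=
  if L.Joinable h then B else lev (L.canon h)

/-- The half-edge is the one selected by the phases. -/
def Act (ph : Fin n → Bool) (h : Fin n × Bool) : Prop := ph h.1 = h.2

/-- The phases agree on the two sides of the link. -/
def Sat (ph : Fin n → Bool) (h : Fin n × Bool) : Prop := Act ph h ↔ Act ph (L.α h)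

theorem act_fl (ph : Fin n → Bool) (h : Fin n × Bool) : Act ph (fl h) ↔ ¬ Act ph h := by
  unfold Act fl
  cases ph h.1 <;> cases h.2 <;> simp

theorem sat_α {ph : Fin n → Bool} {h : Fin n × Bool} : L.Sat ph (L.α h) ↔ L.Sat ph h := by
  unfold Sat; rw [L.inv]; exact Iff.comm

/-- Unsatisfied links are bridged by satisfied links of at most the same level. -/
def Bridged (B : ℕ) (lev : Fin n × Bool → ℕ) (ph : Fin n → Bool) : Prop :=
  ∀ h, L.α h ≠ h → ¬ L.Sat ph h → Relation.ReflTransGen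
    (fun x y => ∃ g, L.α g ≠ g ∧ L.Sat ph g ∧ L.el B lev g ≤ L.el B lev h ∧ g.1 = x ∧
      (L.α g).1 = y) h.1 (L.α h).1

variable {L}

theorem α_ne_iff {h : Fin n × Bool} : L.α (L.α h) ≠ L.α h ↔ L.α h ≠ h := by
  rw [L.inv]; exact ne_comm

/-- Partners share a machine, whereas the two half-edges of a linked job do not, so a half-edge is
never matched to the other end of its own job. -/
theorem job_ne {h : Fin n × Bool} (hh : L.α h ≠ h) : (L.α h).1 ≠ h.1 := by
  intro e
  rcases eq_or_eq_fl e with e | e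
  · exact hh e
  · have := L.mach_α h
    rw [e] at this
    exact L.cross h hh this

theorem joinable_α {h : Fin n × Bool} : L.Joinable (L.α h) ↔ L.Joinable h := by
  unfold Joinable; rw [L.inv]; exact Or.comm

theorem canon_α {h : Fin n × Bool} : L.canon (L.α h) = L.canon h := by
  unfold canon
  rw [L.inv]
  by_cases hh : L.α h = h
  · simp [hh]
  · have := job_ne hh
    rcases lt_or_gt_of_ne this with h₁ | h₁
    · rw [if_pos h₁, if_neg h₁.not_gt]
    · rw [if_neg h₁.not_gt, if_pos h₁]

theorem canon_eq (h : Fin n × Bool) : L.canon h = h ∨ L.canon h = L.α h := by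
  unfold canon; split_ifs <;> simp

theorem eq_of_canon_eq {h h' : Fin n × Bool} (e : L.canon h = L.canon h') :
    h = h' ∨ h = L.α h' := by
  rcases canon_eq (L := L) h with h₁ | h₁ <;> rcases canon_eq (L := L) h' with h₂ | h₂ <;>
    rw [h₁, h₂] at e
  · exact Or.inl e
  · exact Or.inr e
  · exact Or.inr (by rw [← e, L.inv])
  · exact Or.inl (by rw [← L.inv h, e, L.inv])

/-! ### Walks along links and odd cycles -/

/-- The walk that leaves the job of `h` on the side opposite to `h`. -/
def walk (L : Links n) (h : Fin n × Bool) (i : ℕ) : Fin n × Bool := (fun x => fl (L.α x))^[i] (fl h)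

@[simp] theorem walk_zero (h : Fin n × Bool) : L.walk h 0 = fl h := rfl

theorem walk_succ (h : Fin n × Bool) (i : ℕ) : L.walk h (i + 1) = fl (L.α (L.walk h i)) := by
  unfold walk; rw [Function.iterate_succ_apply']

theorem α_walk (h : Fin n × Bool) (i : ℕ) : L.α (L.walk h i) = fl (L.walk h (i + 1)) := by
  rw [walk_succ, fl_fl]

/-- A job has at most two links and `h` itself is not satisfied. So a path of satisfied links from
the job of `h` has to leave through `fl h` and can only move to and fro along the walk. -/
theorem exists_walk {B : ℕ} {lev : Fin n × Bool → ℕ} {ph : Fin n → Bool}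
    (hB : L.Bridged B lev ph) {h : Fin n × Bool} (hh : L.α h ≠ h) (hs : ¬ L.Sat ph h) :
    ∃ k, L.walk h k = L.α h ∧ ∀ i < k, L.α (L.walk h i) ≠ L.walk h i ∧ L.Sat ph (L.walk h i) ∧
      L.el B lev (L.walk h i) ≤ L.el B lev h := by
  have key : ∀ y, Relation.ReflTransGen
    (fun x y => ∃ g, L.α g ≠ g ∧ L.Sat ph g ∧ L.el B lev g ≤ L.el B lev h ∧ g.1 = x ∧
      (L.α g).1 = y) h.1 y → ∃ k, (L.walk h k).1 = y ∧ ∀ i < k, L.α (L.walk h i) ≠ L.walk h i ∧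
      L.Sat ph (L.walk h i) ∧ L.el B lev (L.walk h i) ≤ L.el B lev h := by
    intro y hy
    induction hy with
    | refl => exact ⟨0, rfl, by simp⟩
    | tail _ hg ih =>
      obtain ⟨k, rfl, hk⟩ := ih
      obtain ⟨g, h₁, h₂, h₃, h₄, rfl⟩ := hg
      rcases eq_or_eq_fl h₄ with rfl | rfl
      · refine ⟨k + 1, by rw [walk_succ, fl_fst], fun i hi => ?_⟩
        rcases (Nat.lt_succ_iff_lt_or_eq.1 hi) with hi | rfl
        · exact hk i hi
        · exact ⟨h₁, h₂, h₃⟩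
      -- The path turns back. At the start this would mean traversing `h`, which is not satisfied;
      -- later it undoes the last step of the walk.
      · cases k with
        | zero => exact absurd (by simpa using h₂) hs
        | succ k =>
          refine ⟨k, ?_, fun i hi => hk i (by omega)⟩
          rw [← α_walk, L.inv]
  obtain ⟨k, hk₁, hk₂⟩ := key _ (hB h hh hs)
  refine ⟨k, ?_, hk₂⟩
  rcases eq_or_eq_fl hk₁ with e | e
  · exact e
  -- Arriving at the job of `L.α h` with the wrong half-edge ahead would mean having entered through
  -- the link `h`.
  · exfalso
    cases k with
    | zero =>
      rw [walk_zero] at e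
      exact job_ne hh (congrArg Prod.fst e).symm
    | succ k =>
      have h₁ : L.α (L.walk h k) = L.α h := by rw [α_walk, e, fl_fl]
      have h₂ : L.walk h k = h := by rw [← L.inv (L.walk h k), h₁, L.inv]
      exact hs (h₂ ▸ (hk₂ k k.lt_succ_self).2.1)

/-- A satisfied link preserves being selected and the passage through a job reverses it, so
selection alternates along the walk. The unsatisfied link at `h` then fixes the parity of `k`. -/
theorem even_of_walk {ph : Fin n → Bool} {h : Fin n × Bool} (hs : ¬ L.Sat ph h) {k : ℕ}
    (hk : L.walk h k = L.α h) (hi : ∀ i < k, L.Sat ph (L.walk h i)) : Even k := by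
  have key : ∀ i ≤ k, (Act ph (L.walk h i) ↔ (Act ph h ↔ ¬ Even i)) := by
    intro i hik
    induction i with
    | zero => simp [act_fl]
    | succ i ih =>
      have h₁ := ih (by omega)
      have h₂ : Act ph (L.walk h i) ↔ Act ph (L.α (L.walk h i)) := hi i (by omega)
      rw [walk_succ, act_fl, ← h₂, h₁, Nat.even_add_one]
      tauto
  have h₁ := key k le_rfl
  rw [hk] at h₁
  unfold Sat at hs
  tauto

/-- An unsatisfied link comes from an odd cycle. -/
theorem walk_length {ph : Fin n → Bool} {h : Fin n × Bool} (hh : L.α h ≠ h)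
    (hs : ¬ L.Sat ph h) {k : ℕ}
    (hk : L.walk h k = L.α h) (hi : ∀ i < k, L.Sat ph (L.walk h i)) : 2 ≤ k ∧ Even k := by
  have he := even_of_walk hs hk hi
  refine ⟨?_, he⟩
  have : k ≠ 0 := by
    rintro rfl
    rw [walk_zero] at hk
    exact job_ne hh (congrArg Prod.fst hk).symm
  obtain ⟨l, rfl⟩ := he
  omega

/-- Short odd cycles contain joinable links. -/
theorem six_le_walk_length {h : Fin n × Bool} (hh : L.α h ≠ h) (hj : ¬ L.Joinable h) {k : ℕ}
    (hk : L.walk h k = L.α h) (hk₂ : 2 ≤ k) (he : Even k)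
    (hi : ∀ i < k, L.α (L.walk h i) ≠ L.walk h i ∧ ¬ L.Joinable (L.walk h i)) : 6 ≤ k := by
  by_contra hlt
  -- Together with the link at `h` these are cycles of three and of five links.
  have hk' : k = 2 ∨ k = 4 := by
    obtain ⟨l, rfl⟩ := he
    omega
  have hm : ∀ i, L.mach (fl (L.walk h (i + 1))) = L.mach (L.walk h i) := fun i => by
    rw [← α_walk, L.mach_α]
  have hmα : ∀ i, L.mach (fl (L.α (L.walk h i))) = L.mach (L.walk h (i + 1)) := fun i => by
    rw [walk_succ]
  have hc : ∀ i < k, L.mach (fl (L.walk h i)) ≠ L.mach (L.walk h i) := fun i hik =>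
    L.cross _ (hi i hik).1
  have hαh : L.α (L.α h) ≠ L.α h := α_ne_iff.2 hh
  rcases hk' with rfl | rfl
  · -- a triangle
    refine hj (Or.inl ⟨hh, (hi 0 (by omega)).1, ?_, ?_⟩)
    · rw [← hk, hm 1, ← walk_zero (L := L) h]
      have := hc 1 (by omega)
      rwa [hm 0, ne_comm] at this
    · rw [← L.mach_α h, ← hk, ← walk_zero (L := L) h, ← walk_succ, ← hm 1]
      rw [hk]
      exact (L.cross _ hαh).symm
  · have a₀ : L.mach (fl (L.α h)) = L.mach (L.walk h 3) := by rw [← hk, hm 3]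
    have a₄ : L.mach (L.walk h 4) = L.mach h := by rw [hk, L.mach_α]
    have c₁ := hc 1 (by omega)
    have c₂ := hc 2 (by omega)
    have c₃ := hc 3 (by omega)
    have c₄ := L.cross _ hαh
    rw [hm 0] at c₁
    rw [hm 1] at c₂
    rw [hm 2] at c₃
    rw [a₀, L.mach_α, ← a₄] at c₄
    have c₀ := L.cross h hh
    rw [← walk_zero (L := L) h, ← a₄] at c₀
    -- the link at `h` is not valid from either side, and so are the first two links of the walk
    have v₁ : ¬ L.Valid h := fun hv => hj (Or.inl hv)
    have v₂ : ¬ L.Valid (L.walk h 0) := fun hv => (hi 0 (by omega)).2 (Or.inl hv)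
    have v₃ : ¬ L.Valid (L.walk h 1) := fun hv => (hi 1 (by omega)).2 (Or.inl hv)
    have v₄ : ¬ L.Valid (L.walk h 2) := fun hv => (hi 2 (by omega)).2 (Or.inl hv)
    have v₅ : ¬ L.Valid (L.walk h 3) := fun hv => (hi 3 (by omega)).2 (Or.inl hv)
    have w₁ : L.mach (L.walk h 3) = L.mach (L.walk h 0) ∨
        L.mach (L.walk h 4) = L.mach (L.walk h 1) := by
      by_contra hcon
      push Not at hcon
      refine v₁ ⟨hh, (hi 0 (by omega)).1, ?_, ?_⟩
      · rw [a₀, ← walk_zero (L := L) h]; exact hcon.1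
      · rw [← walk_zero (L := L) h, ← walk_succ, ← a₄]; exact hcon.2
    have w₂ : L.mach (L.walk h 1) = L.mach (L.walk h 4) ∨
        L.mach (L.walk h 0) = L.mach (L.walk h 3) := by
      by_contra hcon
      push Not at hcon
      refine v₂ ⟨(hi 0 (by omega)).1, by rw [walk_zero, fl_fl]; exact hh, ?_, ?_⟩
      · rw [hmα 0, walk_zero, fl_fl, ← a₄]; exact hcon.1
      · rw [walk_zero, fl_fl, a₀]; exact hcon.2
    have ne : ∀ i < 4, L.α (fl (L.walk h (i + 1))) ≠ fl (L.walk h (i + 1)) := fun i hik => by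
      rw [← α_walk]; exact α_ne_iff.2 (hi i hik).1
    have ma : ∀ i, L.mach (fl (L.α (fl (L.walk h (i + 1))))) = L.mach (fl (L.walk h i)) :=
      fun i => by rw [← α_walk, L.inv]
    have w₃ : L.mach (L.walk h 2) = L.mach (L.walk h 0) ∨
        L.mach (L.walk h 1) = L.mach (L.walk h 4) := by
      by_contra hcon
      push Not at hcon
      refine v₃ ⟨(hi 1 (by omega)).1, ne 0 (by omega), ?_, ?_⟩
      · rw [hmα 1, hm 0]; exact hcon.1
      · rw [ma 0, walk_zero, fl_fl, ← a₄]; exact hcon.2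
    have w₄ : L.mach (L.walk h 3) = L.mach (L.walk h 1) ∨
        L.mach (L.walk h 2) = L.mach (L.walk h 0) := by
      by_contra hcon
      push Not at hcon
      refine v₄ ⟨(hi 2 (by omega)).1, ne 1 (by omega), ?_, ?_⟩
      · rw [hmα 2, hm 1]; exact hcon.1
      · rw [ma 1, hm 0]; exact hcon.2
    have w₅ : L.mach (L.walk h 4) = L.mach (L.walk h 2) ∨
        L.mach (L.walk h 3) = L.mach (L.walk h 1) := by
      by_contra hcon
      push Not at hcon
      refine v₅ ⟨(hi 3 (by omega)).1, ne 2 (by omega), ?_, ?_⟩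
      · rw [hmα 3, hm 2]; exact hcon.1
      · rw [ma 2, hm 1]; exact hcon.2
    -- The five links carry machines of which cyclic neighbours differ. Among the equalities between
    -- machines two places apart, two that share a place would identify neighbours, so at most two
    -- equalities hold. The failures of validity ask for one in each of `{30, 41}`, `{41, 20}`,
    -- `{20, 31}`, `{31, 42}`, where digits are positions on the walk. Only `41` and `31` could
    -- achieve this with two equalities, but they share the place `1`.
    omega

/-- The step of the walk is injective, so a repetition can be moved back to the start; there it
would make the link at `h` one of the satisfied links. -/
theorem walk_ne_walk {ph : Fin n → Bool} {h : Fin n × Bool} (hs : ¬ L.Sat ph h) {k : ℕ}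
    (hi : ∀ i < k, L.α (L.walk h i) ≠ L.walk h i ∧ L.Sat ph (L.walk h i)) {i j : ℕ} (hij : i < j)
    (hjk : j < k) : L.walk h i ≠ L.walk h j := by
  induction i generalizing j with
  | zero =>
    intro e
    obtain ⟨j, rfl⟩ := Nat.exists_eq_succ_of_ne_zero (show j ≠ 0 by omega)
    have h₁ : L.α (L.walk h j) = h := by rw [α_walk, ← e, walk_zero, fl_fl]
    have h₂ := (hi j (by omega)).2
    rw [← L.sat_α, h₁] at h₂
    exact hs h₂
  | succ i ih =>
    intro e
    obtain ⟨j, rfl⟩ := Nat.exists_eq_succ_of_ne_zero (show j ≠ 0 by omega)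
    refine ih (j := j) (by omega) (by omega) ?_
    rw [← L.inv (L.walk h i), α_walk, e, ← α_walk, L.inv]

/-- If a link were met again in the opposite direction, both meeting points could be moved inwards
until they coincide or are adjacent, that is, until a half-edge is unmatched or equals its own
opposite. -/
theorem walk_ne_α_walk {h : Fin n × Bool} {k : ℕ}
    (hi : ∀ i < k, L.α (L.walk h i) ≠ L.walk h i) {i d : ℕ}
    (hjk : i + d < k) : L.walk h i ≠ L.α (L.walk h (i + d)) := by
  induction d using Nat.strong_induction_on generalizing i with
  | _ d ih =>
    match d with
    | 0 => exact (hi i (by omega)).symm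
    | 1 =>
      intro e
      have h₁ : L.α (L.walk h i) = L.walk h (i + 1) := by rw [e, L.inv]
      rw [α_walk] at h₁
      exact fl_ne _ h₁
    | d + 2 =>
      intro e
      refine ih d (by omega) (i := i + 1) (by omega) ?_
      have h₁ : L.α (L.walk h i) = L.walk h (i + (d + 2)) := by rw [e, L.inv]
      rw [α_walk] at h₁
      rw [α_walk, show i + 1 + d + 1 = i + (d + 2) by ring, ← h₁, fl_fl]

/-- The canonical half-edges of the first links of the walk. -/
def walkSet (L : Links n) (h : Fin n × Bool) : Finset (Fin n × Bool) :=
  (Finset.range 6).image fun i => L.canon (L.walk h i)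

/-- The link at `h` has the largest level among seven links. -/
def LevelMax (L : Links n) (lev : Fin n × Bool → ℕ) (h : Fin n × Bool) : Prop :=
  (L.walkSet h).card = 6 ∧ L.canon h ∉ L.walkSet h ∧ ∀ x ∈ L.walkSet h, lev x ≤ lev (L.canon h)

/-- The unsatisfied link closes an odd cycle of links of at most its level. As its own level is
below `B`, none of them is joinable, so the cycle has at least seven links. Only the first six links
of the walk are kept, which makes the event depend on a set determined by the matching alone. -/
theorem levelMax_of_not_sat {B : ℕ} {lev : Fin n × Bool → ℕ} (hlev : ∀ h, lev h < B)
    {ph : Fin n → Bool} (hB : L.Bridged B lev ph) {h : Fin n × Bool} (hh : L.α h ≠ h)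
    (hs : ¬ L.Sat ph h) (hj : ¬ L.Joinable h) : L.LevelMax lev h := by
  obtain ⟨k, hk, hi⟩ := exists_walk hB hh hs
  obtain ⟨hk₂, he⟩ := walk_length hh hs hk fun i hik => (hi i hik).2.1
  have hel : L.el B lev h = lev (L.canon h) := if_neg hj
  have hnj : ∀ i < k, ¬ L.Joinable (L.walk h i) := by
    intro i hik hji
    have h₁ := (hi i hik).2.2
    rw [hel, el, if_pos hji] at h₁
    exact absurd (hlev (L.canon h)) h₁.not_gt
  have hk₆ := six_le_walk_length hh hj hk hk₂ he fun i hik => ⟨(hi i hik).1, hnj i hik⟩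
  have hi' : ∀ i < k, L.α (L.walk h i) ≠ L.walk h i ∧ L.Sat ph (L.walk h i) := fun i hik =>
    ⟨(hi i hik).1, (hi i hik).2.1⟩
  have hne : ∀ i j, i < j → j < 6 → L.canon (L.walk h i) ≠ L.canon (L.walk h j) := by
    intro i j hij hj6 e
    rcases eq_of_canon_eq e with e | e
    · exact walk_ne_walk hs hi' hij (by omega) e
    · obtain ⟨d, rfl⟩ := Nat.exists_eq_add_of_le hij.le
      exact walk_ne_α_walk (fun i hik => (hi i hik).1) (by omega) e
  refine ⟨?_, ?_, ?_⟩
  · rw [walkSet, Finset.card_image_of_injOn, Finset.card_range]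
    intro i hi6 j hj6 e
    simp only [Finset.coe_range, Set.mem_Iio] at hi6 hj6
    rcases lt_trichotomy i j with h₁ | h₁ | h₁
    · exact absurd e (hne i j h₁ hj6)
    · exact h₁
    · exact absurd e.symm (hne j i h₁ hi6)
  · intro hmem
    obtain ⟨i, hi6, e⟩ := Finset.mem_image.1 hmem
    have h₁ := (hi i (by simp at hi6; omega)).2.1
    rcases eq_of_canon_eq e with e | e
    · exact hs (e ▸ h₁)
    · rw [e, L.sat_α] at h₁
      exact hs h₁
  · intro x hx
    obtain ⟨i, hi6, rfl⟩ := Finset.mem_image.1 hx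
    have hik : i < k := by simp at hi6; omega
    have h₁ := (hi i hik).2.2
    rwa [hel, el, if_neg (hnj i hik)] at h₁

/-! ## Blocks -/

/-- The selected half-edge of a job. -/
def sel (ph : Fin n → Bool) (j : Fin n) : Fin n × Bool := (j, ph j)

theorem act_sel (ph : Fin n → Bool) (j : Fin n) : Act ph (sel ph j) := rfl

theorem eq_sel {ph : Fin n → Bool} {h : Fin n × Bool} (hh : Act ph h) : h = sel ph h.1 := by
  unfold Act at hh
  unfold sel
  rw [hh]

/-- A job whose selected half-edge is matched to `h` joins the pair of the job of `h`. -/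
def Joins (L : Links n) (ph : Fin n → Bool) (h : Fin n × Bool) : Prop :=
  L.Valid h ∧ Act ph (L.α (fl h)) ∧ L.Sat ph (fl (L.α (fl h)))

open Classical in
/-- The job whose coin decides for the job `j`, and whether the answer is negated. -/
noncomputable def lead (L : Links n) (ph : Fin n → Bool) (j : Fin n) : Fin n × Bool :=
  let k := L.α (sel ph j)
  if k = sel ph j then (j, false)
  else if Act ph k then (if j < k.1 then (j, false) else (k.1, true))
  else if L.Joins ph k then
    (if k.1 < (L.α (fl k)).1 then (k.1, false) else ((L.α (fl k)).1, true))
  else (j, false)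

/-- The half-edge to whose group the job `j` is assigned. -/
noncomputable def chosen (L : Links n) (ph coins : Fin n → Bool) (j : Fin n) : Fin n × Bool :=
  if xor (coins (L.lead ph j).1) (L.lead ph j).2 = true then sel ph j else fl (sel ph j)

/-- The role of a job in the block of the pair `p`, `L.α p`. -/
inductive Role (L : Links n) (ph : Fin n → Bool) (p : Fin n × Bool) : Fin n → Bool → Prop
  | left : Role L ph p p.1 false
  | right : Role L ph p (L.α p).1 true
  | joinLeft (j : Fin n) (h₁ : L.α (sel ph j) = fl p) (h₂ : L.Joins ph (fl p)) :
      Role L ph p j false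
  | joinRight (j : Fin n) (h₁ : L.α (sel ph j) = fl (L.α p)) (h₂ : L.Joins ph (fl (L.α p))) :
      Role L ph p j true

/-- A job either decides for itself alone or belongs to the block of a pair of linked selected
half-edges; `p` is named so that its job is the leader. -/
theorem lead_cases (L : Links n) (ph : Fin n → Bool) (j : Fin n) :
    (L.lead ph j = (j, false) ∧ (L.α (sel ph j) = sel ph j ∨ ¬ Act ph (L.α (sel ph j)))) ∨
    ∃ p, Act ph p ∧ Act ph (L.α p) ∧ L.α p ≠ p ∧ (L.lead ph j).1 = p.1 ∧
      Role L ph p j (L.lead ph j).2 := by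
  unfold lead
  simp only
  split_ifs with h₁ h₂ h₃ h₄ h₅
  · exact Or.inl ⟨rfl, Or.inl h₁⟩
  · exact Or.inr ⟨sel ph j, rfl, h₂, h₁, rfl, Role.left⟩
  · refine Or.inr ⟨L.α (sel ph j), h₂, by rw [L.inv]; rfl, α_ne_iff.2 h₁, rfl, ?_⟩
    have := Role.right (L := L) (ph := ph) (p := L.α (sel ph j))
    rw [L.inv] at this
    exact this
  · refine Or.inr ⟨fl (L.α (sel ph j)), (act_fl _ _).2 h₂, h₄.2.1, h₄.1.2.1, rfl, ?_⟩
    refine Role.joinLeft j (by rw [fl_fl]) ?_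
    rw [fl_fl]
    exact h₄
  · refine Or.inr ⟨L.α (fl (L.α (sel ph j))), h₄.2.1, by rw [L.inv]; exact (act_fl _ _).2 h₂,
      α_ne_iff.2 h₄.1.2.1, rfl, ?_⟩
    refine Role.joinRight j (by rw [L.inv, fl_fl]) ?_
    rw [L.inv, fl_fl]
    exact h₄
  · exact Or.inl ⟨rfl, Or.inr h₂⟩

/-- The machines visited by the members of a block are different. -/
theorem mach_ne_of_role {ph : Fin n → Bool} {p : Fin n × Bool} (hp : Act ph p)
    (hp' : Act ph (L.α p)) (hne : L.α p ≠ p) {j j' : Fin n} {b b' : Bool}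
    (hj : Role L ph p j b) (hj' : Role L ph p j' b') (hjj : j ≠ j') (c : Bool) :
    L.mach (if xor c b = true then sel ph j else fl (sel ph j))
      ≠ L.mach (if xor c b' = true then sel ph j' else fl (sel ph j')) := by
  have e₁ := eq_sel hp
  have e₂ := eq_sel hp'
  have m₂ := L.mach_α p
  have c₁ := L.cross p hne
  have c₂ := L.cross (L.α p) (α_ne_iff.2 hne)
  -- facts about a job that joins the job of `q`
  have join : ∀ q, Act ph q → ∀ j, L.α (sel ph j) = fl q → L.Joins ph (fl q) →
      L.mach (sel ph j) = L.mach (fl q) ∧ L.mach (fl (sel ph j)) ≠ L.mach q ∧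
      L.mach (fl q) ≠ L.mach (fl (L.α q)) ∧ L.mach (fl (sel ph j)) ≠ L.mach (sel ph j) ∧
      L.α (fl q) = sel ph j ∧ L.Sat ph (fl (L.α q)) := by
    intro q hq j h₁ h₂
    have h₃ : L.α (fl q) = sel ph j := by rw [← h₁, L.inv]
    obtain ⟨⟨h₄, h₅, h₆, h₇⟩, h₈, h₉⟩ := h₂
    rw [fl_fl] at h₆ h₇ h₉
    rw [h₃] at h₆
    refine ⟨by rw [← h₁, L.mach_α], h₆, h₇, L.cross _ ?_, h₃, h₉⟩
    rw [h₁, ← h₃]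
    exact h₄.symm
  -- two jobs cannot join from both sides
  have excl : ∀ j j', L.α (sel ph j) = fl p → L.Joins ph (fl p) →
      L.α (sel ph j') = fl (L.α p) → L.Joins ph (fl (L.α p)) → False := by
    intro j j' h₁ h₂ h₃ h₄
    obtain ⟨-, -, -, -, h₅, h₆⟩ := join _ hp j h₁ h₂
    obtain ⟨-, -, -, -, h₇, h₈⟩ := join _ hp' j' h₃ h₄
    unfold Sat at h₆
    rw [h₇, act_fl] at h₆
    exact (h₆.2 (act_sel _ _)) hp'
  have inj : ∀ j j' q, L.α (sel ph j) = fl q → L.α (sel ph j') = fl q → j = j' := by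
    intro j j' q h₁ h₂
    have : sel ph j = sel ph j' := by rw [← L.inv (sel ph j), h₁, ← h₂, L.inv]
    exact congrArg Prod.fst this
  -- What remains are inequalities between machines. For the pair they come from `cross`; for a
  -- joining job they are the last two clauses of `Valid` and the `cross` property of its own link.
  cases hj with
  | left =>
    cases hj' with
    | left => exact absurd rfl hjj
    | right =>
      rw [← e₁, ← e₂]
      cases c <;> simp <;> omega
    | joinLeft _ h₁ h₂ =>
      obtain ⟨a₁, a₂, a₃, a₄, -, -⟩ := join _ hp _ h₁ h₂
      rw [← e₁]
      cases c <;> simp <;> omega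
    | joinRight _ h₁ h₂ =>
      obtain ⟨a₁, a₂, a₃, a₄, -, -⟩ := join _ hp' _ h₁ h₂
      rw [← e₁]
      rw [L.inv] at a₃
      cases c <;> simp <;> omega
  | right =>
    cases hj' with
    | left =>
      rw [← e₁, ← e₂]
      cases c <;> simp <;> omega
    | right => exact absurd rfl hjj
    | joinLeft _ h₁ h₂ =>
      obtain ⟨a₁, a₂, a₃, a₄, -, -⟩ := join _ hp _ h₁ h₂
      rw [← e₂]
      cases c <;> simp <;> omega
    | joinRight _ h₁ h₂ =>
      obtain ⟨a₁, a₂, a₃, a₄, -, -⟩ := join _ hp' _ h₁ h₂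
      rw [← e₂]
      rw [L.inv] at a₃
      cases c <;> simp <;> omega
  | joinLeft _ k₁ k₂ =>
    obtain ⟨b₁, b₂, b₃, b₄, -, -⟩ := join _ hp _ k₁ k₂
    cases hj' with
    | left =>
      rw [← e₁]
      cases c <;> simp <;> omega
    | right =>
      rw [← e₂]
      cases c <;> simp <;> omega
    | joinLeft _ h₁ h₂ => exact absurd (inj _ _ _ k₁ h₁) hjj
    | joinRight _ h₁ h₂ => exact (excl _ _ k₁ k₂ h₁ h₂).elim
  | joinRight _ k₁ k₂ =>
    obtain ⟨b₁, b₂, b₃, b₄, -, -⟩ := join _ hp' _ k₁ k₂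
    rw [L.inv] at b₃
    cases hj' with
    | left =>
      rw [← e₁]
      cases c <;> simp <;> omega
    | right =>
      rw [← e₂]
      cases c <;> simp <;> omega
    | joinLeft _ h₁ h₂ => exact (excl _ _ h₁ h₂ k₁ k₂).elim
    | joinRight _ h₁ h₂ => exact absurd (inj _ _ _ k₁ h₁) hjj

/-- Jobs with the same leader are never sent to the same machine. -/
theorem mach_chosen_ne {ph : Fin n → Bool} (coins : Fin n → Bool) {j j' : Fin n} (hjj : j ≠ j')
    (h : (L.lead ph j).1 = (L.lead ph j').1) :
    L.mach (L.chosen ph coins j) ≠ L.mach (L.chosen ph coins j') := by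
  -- A job that decides for itself is not an end of a pair, hence leads no other block.
  have single : ∀ i, (L.α (sel ph i) = sel ph i ∨ ¬ Act ph (L.α (sel ph i))) → ∀ p, Act ph p →
      Act ph (L.α p) → L.α p ≠ p → i ≠ p.1 := by
    rintro i hi p hp hp' hne rfl
    rw [← eq_sel hp] at hi
    tauto
  rcases lead_cases L ph j with ⟨h₁, h₂⟩ | ⟨p, hp, hp', hne, hl, hr⟩ <;>
    rcases lead_cases L ph j' with ⟨h₁', h₂'⟩ | ⟨p', hp₁, hp₂, hne', hl', hr'⟩
  · rw [h₁, h₁'] at h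
    exact absurd h hjj
  · rw [h₁, hl'] at h
    exact absurd h (single j h₂ p' hp₁ hp₂ hne')
  · rw [h₁', hl] at h
    exact absurd h.symm (single j' h₂' p hp hp' hne)
  · have : p = p' := by rw [eq_sel hp, eq_sel hp₁, ← hl, ← hl', h]
    subst this
    have := mach_ne_of_role hp hp' hne hr hr' hjj (coins (L.lead ph j).1)
    unfold chosen
    rwa [← h]

theorem lead_eq_of_act {ph : Fin n → Bool} {h : Fin n × Bool} (hh : L.α h ≠ h) (h₁ : Act ph h)
    (h₂ : Act ph (L.α h)) : (L.lead ph h.1).1 = (L.lead ph (L.α h).1).1 := by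
  have e₁ := eq_sel h₁
  have e₂ := eq_sel h₂
  have hne := job_ne hh
  unfold lead
  simp only
  rw [← e₁, ← e₂, L.inv, if_neg hh, if_neg hh.symm, if_pos h₂, if_pos h₁]
  rcases lt_or_gt_of_ne hne with h₃ | h₃
  · rw [if_neg h₃.not_gt, if_pos h₃]
  · rw [if_pos h₃, if_neg h₃.not_gt]

theorem lead_eq_of_joins {ph : Fin n → Bool} {h : Fin n × Bool} (hh : L.α h ≠ h) (h₁ : Act ph h)
    (h₂ : ¬ Act ph (L.α h)) (h₃ : L.Joins ph (L.α h)) :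
    (L.lead ph h.1).1 = (L.lead ph (L.α h).1).1 := by
  have e₁ := eq_sel h₁
  have h₄ : Act ph (fl (L.α h)) := (act_fl _ _).2 h₂
  have e₂ : fl (L.α h) = sel ph (L.α h).1 := eq_sel h₄
  unfold lead
  simp only
  rw [← e₁, ← e₂, if_neg hh, if_neg h₂, if_pos h₃, if_neg h₃.1.2.1, if_pos h₃.2.1]

/-- The phases after the global coin. -/
def shift (β : Bool) (ph : Fin n → Bool) (j : Fin n) : Bool := xor β (ph j)

theorem act_shift {β : Bool} {ph : Fin n → Bool} {h : Fin n × Bool} :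
    Act (shift β ph) h ↔ (Act ph h ↔ β = false) := by
  unfold Act shift
  cases β <;> cases ph h.1 <;> cases h.2 <;> simp

theorem sat_shift {β : Bool} {ph : Fin n → Bool} {h : Fin n × Bool} :
    L.Sat (shift β ph) h ↔ L.Sat ph h := by
  unfold Sat
  rw [act_shift, act_shift]
  tauto

/-- A link that is satisfied or joinable lies inside a block for one value of the global coin. -/
theorem exists_lead_eq {B : ℕ} {lev : Fin n × Bool → ℕ} {ph : Fin n → Bool}
    (hB : L.Bridged B lev ph) {h : Fin n × Bool} (hh : L.α h ≠ h)
    (hs : L.Sat ph h ∨ L.Joinable h) :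
    ∃ β, (L.lead (shift β ph) h.1).1 = (L.lead (shift β ph) (L.α h).1).1 := by
  by_cases hsat : L.Sat ph h
  -- The value of the global coin is chosen so that `h` is selected; satisfaction then makes its
  -- partner selected as well.
  · obtain ⟨β, hβ⟩ : ∃ β, Act (shift β ph) h := by
      by_cases h₁ : Act ph h
      · exact ⟨false, by rw [act_shift]; simp [h₁]⟩
      · exact ⟨true, by rw [act_shift]; simp [h₁]⟩
    exact ⟨β, lead_eq_of_act hh hβ ((sat_shift.2 hsat).1 hβ)⟩
  · have hj := hs.resolve_left hsat
    -- joining from the side of `g`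
    have key : ∀ g, L.α g ≠ g → ¬ L.Sat ph g → L.Valid (L.α g) →
        ∃ β, (L.lead (shift β ph) g.1).1 = (L.lead (shift β ph) (L.α g).1).1 := by
      intro g hg hgs hv
      obtain ⟨β, hβ⟩ : ∃ β, Act (shift β ph) g := by
        by_cases h₁ : Act ph g
        · exact ⟨false, by rw [act_shift]; simp [h₁]⟩
        · exact ⟨true, by rw [act_shift]; simp [h₁]⟩
      have hβ' : ¬ Act (shift β ph) (L.α g) := fun h₁ =>
        hgs (sat_shift.1 ⟨fun _ => h₁, fun _ => hβ⟩)
      refine ⟨β, lead_eq_of_joins hg hβ hβ' ⟨hv, ?_, ?_⟩⟩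
      -- The link closes an odd cycle, so the walk from `L.α g` starts with at least two satisfied
      -- links. The first shows that the job of `L.α g` belongs to a pair, the second that nobody
      -- joins this pair from the other side.
      all_goals
        have hgs' : ¬ L.Sat ph (L.α g) := by rwa [L.sat_α]
        obtain ⟨k, hk, hi⟩ := exists_walk hB (α_ne_iff.2 hg) hgs'
        obtain ⟨hk₂, -⟩ := walk_length (α_ne_iff.2 hg) hgs' hk fun i hik => (hi i hik).2.1
      · have h₁ : L.Sat (shift β ph) (fl (L.α g)) := sat_shift.2 (hi 0 (by omega)).2.1
        exact h₁.1 ((act_fl _ _).2 hβ')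
      · exact sat_shift.2 (hi 1 (by omega)).2.1
    rcases hj with hv | hv
    · obtain ⟨β, hβ⟩ := key (L.α h) (α_ne_iff.2 hh) (by rwa [L.sat_α]) (by rwa [L.inv])
      rw [L.inv] at hβ
      exact ⟨β, hβ.symm⟩
    · exact key h hh hsat hv

end Links

/-! ## Linking the half-edges of a group -/

section Linking

variable {n U : ℕ}

/-- Position of a half-edge in the memory order. -/
def key (h : Fin n × Bool) : ℕ := 2 * h.1 + h.2.toNat

theorem key_injective : Function.Injective (key (n := n)) := by
  rintro ⟨j, b⟩ ⟨j', b'⟩ h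
  simp only [key] at h
  cases b <;> cases b' <;> simp at h ⊢ <;> omega

variable (g : Fin U → ℕ) (E : Fin n × Bool → Fin U) (K : Fin n × Bool → Bool)
  (R : Fin U → (k : Fin n) → Fin (k + 1))

/-- The two groups of the job belong to different machines. -/
def CrossJob (j : Fin n) : Prop := g (E (j, false)) ≠ g (E (j, true))

instance (j : Fin n) : Decidable (CrossJob g E j) := by unfold CrossJob; infer_instance

/-- The half-edges of class `c` at the group `u`. -/
def elig (c : Bool) (u : Fin U) : Finset (Fin n × Bool) :=
  Finset.univ.filter fun h => CrossJob g E h.1 ∧ E h = u ∧ K h = c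

/-- The rank of a half-edge in its class at its group. -/
def rank (h : Fin n × Bool) : ℕ := ((elig g E K (K h) (E h)).filter fun h' => key h' < key h).card

/-- The random number below `m` of the group `u`. -/
def rv (u : Fin U) (m : ℕ) : ℕ := if h : m - 1 < n then R u ⟨m - 1, h⟩ else 0

/-- The largest odd number up to `k`. -/
def oddPart (k : ℕ) : ℕ := k + k % 2 - 1

/-- In round `r` of the round robin with odd parameter `m`, the teams `a` and `b` meet. -/
def Robin (m r a b : ℕ) : Prop :=
  (a < m ∧ b < m ∧ (a + b = r ∨ a + b = r + m)) ∨ (a = m ∧ (b + b = r ∨ b + b = r + m)) ∨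
    (b = m ∧ (a + a = r ∨ a + a = r + m))

/-- The condition for linking `h` and `h'`. -/
def Linked (h h' : Fin n × Bool) : Prop :=
  CrossJob g E h.1 ∧ CrossJob g E h'.1 ∧ h ≠ h' ∧ E h = E h' ∧
    ((K h = true ∧ K h' = true ∧ Robin (oddPart (elig g E K true (E h)).card)
        (rv R (E h) (oddPart (elig g E K true (E h)).card)) (rank g E K h) (rank g E K h')) ∨
      (K h = true ∧ K h' = false ∧ (elig g E K true (E h)).card = 1 ∧
        rank g E K h' = rv R (E h) (elig g E K false (E h)).card) ∨
      (K h = false ∧ K h' = true ∧ (elig g E K true (E h)).card = 1 ∧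
        rank g E K h = rv R (E h) (elig g E K false (E h)).card))

variable {g E K R}

theorem robin_symm {m r a b : ℕ} (h : Robin m r a b) : Robin m r b a := by
  unfold Robin at h ⊢; omega

theorem Linked.symm {h h' : Fin n × Bool} (hh : Linked g E K R h h') : Linked g E K R h' h := by
  obtain ⟨h₁, h₂, h₃, h₄, h₅⟩ := hh
  refine ⟨h₂, h₁, h₃.symm, h₄.symm, ?_⟩
  rw [← h₄]
  rcases h₅ with ⟨a, b, c⟩ | ⟨a, b, c⟩ | ⟨a, b, c⟩
  · exact Or.inl ⟨b, a, robin_symm c⟩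
  · exact Or.inr (Or.inr ⟨b, a, c⟩)
  · exact Or.inr (Or.inl ⟨b, a, c⟩)

theorem mem_elig {c : Bool} {u : Fin U} {h : Fin n × Bool} :
    h ∈ elig g E K c u ↔ CrossJob g E h.1 ∧ E h = u ∧ K h = c := by simp [elig]

theorem rank_lt {h : Fin n × Bool} (hc : CrossJob g E h.1) :
    rank g E K h < (elig g E K (K h) (E h)).card :=
  Finset.card_lt_card (Finset.filter_ssubset.2 ⟨h, mem_elig.2 ⟨hc, rfl, rfl⟩, by simp⟩)

theorem rank_lt_rank {h h' : Fin n × Bool} (hc : CrossJob g E h.1) (hE : E h = E h')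
    (hK : K h = K h') (hk : key h < key h') : rank g E K h < rank g E K h' := by
  unfold rank
  rw [← hE, ← hK]
  refine Finset.card_lt_card ((Finset.ssubset_iff_of_subset ?_).2 ⟨h, ?_, ?_⟩)
  · intro x hx
    rw [Finset.mem_filter] at hx ⊢
    exact ⟨hx.1, hx.2.trans hk⟩
  · exact Finset.mem_filter.2 ⟨mem_elig.2 ⟨hc, rfl, rfl⟩, hk⟩
  · simp

theorem rank_inj {h h' : Fin n × Bool} (hc : CrossJob g E h.1) (hc' : CrossJob g E h'.1)
    (hE : E h = E h') (hK : K h = K h') (hr : rank g E K h = rank g E K h') : h = h' := by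
  rcases lt_trichotomy (key h) (key h') with hk | hk | hk
  · exact absurd hr (rank_lt_rank hc hE hK hk).ne
  · exact key_injective hk
  · exact absurd hr (rank_lt_rank hc' hE.symm hK.symm hk).ne'

/-- The ends of a cross job lie at different groups, so a group sees each job at most once. This
keeps all moduli within the table `R` of random numbers. -/
theorem card_elig_le (c : Bool) (u : Fin U) : (elig g E K c u).card ≤ n := by
  have : Set.InjOn Prod.fst (elig g E K c u : Set (Fin n × Bool)) := by
    intro h hh h' hh' e
    rcases eq_or_eq_fl e with e | e
    · exact e
    · exfalso
      obtain ⟨h₁, h₂, -⟩ := mem_elig.1 (Finset.mem_coe.1 hh)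
      obtain ⟨h₃, h₄, -⟩ := mem_elig.1 (Finset.mem_coe.1 hh')
      obtain ⟨j, b⟩ := h
      obtain ⟨j', b'⟩ := h'
      simp only [fl, Prod.mk.injEq] at e
      obtain ⟨rfl, rfl⟩ := e
      unfold CrossJob at h₁
      cases b' <;> simp_all
  calc (elig g E K c u).card = ((elig g E K c u).image Prod.fst).card :=
        (Finset.card_image_of_injOn this).symm
    _ ≤ Fintype.card (Fin n) := Finset.card_le_univ _
    _ = n := Fintype.card_fin n

theorem rv_lt {u : Fin U} {m : ℕ} (hm : 0 < m) : rv R u m < m := by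
  unfold rv
  split_ifs with h
  · have := (R u ⟨m - 1, h⟩).2
    simp only at this
    omega
  · exact hm

/-- Modulo an odd `m` the opponent of `a` is `r - a`, and the single solution of `2a = r`, which
would meet itself, plays the extra team `m`. -/
theorem robin_unique {m r a b b' : ℕ} (hm : m % 2 = 1) (hr : r < m) (hb : Robin m r a b)
    (hb' : Robin m r a b') (h : a ≠ b) (h' : a ≠ b') : b = b' := by
  unfold Robin at hb hb'
  omega

theorem oddPart_odd {k : ℕ} (hk : 0 < k) : oddPart k % 2 = 1 := by unfold oddPart; omega

/-- A link between the classes requires a single half-edge of the first class, which rules out a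
link inside that class. Within one kind of link the rank of the partner is determined, or the
partner is the only candidate. -/
theorem Linked.unique {h h₁ h₂ : Fin n × Bool} (hh₁ : Linked g E K R h h₁)
    (hh₂ : Linked g E K R h h₂) : h₁ = h₂ := by
  obtain ⟨c, c₁, n₁, e₁, k₁⟩ := hh₁
  obtain ⟨-, c₂, n₂, e₂, k₂⟩ := hh₂
  have pos : K h = true → 0 < (elig g E K true (E h)).card := fun hK =>
    Finset.card_pos.2 ⟨h, mem_elig.2 ⟨c, rfl, hK⟩⟩
  have one : ∀ h', CrossJob g E h'.1 → E h = E h' → K h = true → K h' = true →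
      (elig g E K true (E h)).card = 1 → h ≠ h' → False := by
    intro h' c' e' k k' hcard hne
    obtain ⟨x, hx⟩ := Finset.card_eq_one.1 hcard
    have m₁ : h ∈ elig g E K true (E h) := mem_elig.2 ⟨c, rfl, k⟩
    have m₂ : h' ∈ elig g E K true (E h) := mem_elig.2 ⟨c', e'.symm, k'⟩
    rw [hx, Finset.mem_singleton] at m₁ m₂
    exact hne (m₁.trans m₂.symm)
  rcases k₁ with ⟨a, b, r⟩ | ⟨a, b, d, r⟩ | ⟨a, b, d, r⟩ <;>
    rcases k₂ with ⟨a', b', r'⟩ | ⟨a', b', d', r'⟩ | ⟨a', b', d', r'⟩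
  · refine rank_inj c₁ c₂ (e₁.symm.trans e₂) (b.trans b'.symm) ?_
    refine robin_unique (oddPart_odd (pos a)) (rv_lt ?_) r r' ?_ ?_
    · have := oddPart_odd (pos a); omega
    · exact fun he => n₁ (rank_inj c c₁ e₁ (a.trans b.symm) he)
    · exact fun he => n₂ (rank_inj c c₂ e₂ (a.trans b'.symm) he)
  · exact (one _ c₁ e₁ a b d' n₁).elim
  · simp [a] at a'
  · exact (one _ c₂ e₂ a' b' d n₂).elim
  · exact rank_inj c₁ c₂ (e₁.symm.trans e₂) (b.trans b'.symm) (r.trans r'.symm)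
  · simp [a] at a'
  · simp [a] at a'
  · simp [a] at a'
  · obtain ⟨x, hx⟩ := Finset.card_eq_one.1 d
    have m₁ : h₁ ∈ elig g E K true (E h) := mem_elig.2 ⟨c₁, e₁.symm, b⟩
    have m₂ : h₂ ∈ elig g E K true (E h) := mem_elig.2 ⟨c₂, e₂.symm, b'⟩
    rw [hx, Finset.mem_singleton] at m₁ m₂
    exact m₁.trans m₂.symm

variable (g E K R)

open Classical in
/-- The partner of a half-edge. -/
noncomputable def partner (h : Fin n × Bool) : Fin n × Bool :=
  if hh : ∃ h', Linked g E K R h h' then hh.choose else h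

variable {g E K R}

theorem partner_eq {h h' : Fin n × Bool} (hh : Linked g E K R h h') : partner g E K R h = h' := by
  have : ∃ h', Linked g E K R h h' := ⟨h', hh⟩
  rw [partner, dif_pos this]
  exact this.choose_spec.unique hh

theorem partner_eq_self {h : Fin n × Bool} (hh : ¬ ∃ h', Linked g E K R h h') :
    partner g E K R h = h := by
  rw [partner, dif_neg hh]

theorem linked_partner {h : Fin n × Bool} (hh : partner g E K R h ≠ h) :
    Linked g E K R h (partner g E K R h) := by
  by_cases hex : ∃ h', Linked g E K R h h'
  · obtain ⟨h', hl⟩ := hex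
    rwa [partner_eq hl]
  · exact absurd (partner_eq_self hex) hh

variable (g E K R)

/-- The matching produced by the random choices. -/
noncomputable def links : Links n where
  α := partner g E K R
  mach h := g (E h)
  inv h := by
    by_cases hh : partner g E K R h = h
    · rw [hh, hh]
    · exact partner_eq (linked_partner hh).symm
  mach_α h := by
    by_cases hh : partner g E K R h = h
    · rw [hh]
    · rw [(linked_partner hh).2.2.2.1]
  cross h hh := by
    obtain ⟨j, b⟩ := h
    have := (linked_partner hh).1
    unfold CrossJob at this
    cases b
    · exact this.symm
    · exact this

end Linking

/-! ## Fair coins -/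

section FairCoins

variable {n : ℕ}

/-- A fair coin. -/
noncomputable def fair : PMF Bool := coin (1 / 2)

theorem ev_fair (f : Bool → ℝ) : ev fair f = (f true + f false) / 2 := by
  rw [fair, ev_coin (by norm_num) (by norm_num)]
  ring

/-- Independent fair coins for the jobs. -/
noncomputable def coinsPMF (n : ℕ) : PMF (Fin n → Bool) := piPMF fun _ => fair

theorem chosen_eq_iff {L : Links n} {ph coins : Fin n → Bool} {j : Fin n} {b : Bool} :
    L.chosen ph coins j = (j, b)
      ↔ coins (L.lead ph j).1 = xor (L.lead ph j).2 (xor (ph j) (!b)) := by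
  unfold Links.chosen Links.sel fl
  cases coins (L.lead ph j).1 <;> cases (L.lead ph j).2 <;> cases ph j <;> cases b <;> simp

theorem chosen_fst {L : Links n} {ph coins : Fin n → Bool} {j : Fin n} :
    (L.chosen ph coins j).1 = j := by
  unfold Links.chosen Links.sel
  split_ifs <;> rfl

/-- Whatever the blocks, a job follows one fair coin, possibly negated. -/
theorem ev_chosen (L : Links n) (ph : Fin n → Bool) (j : Fin n) (b : Bool) :
    ev (coinsPMF n) (fun coins => if L.chosen ph coins j = (j, b) then 1 else 0) = 1 / 2 := by
  simp only [chosen_eq_iff]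
  rw [coinsPMF, ev_piPMF_apply (fun _ => fair) (L.lead ph j).1
    fun c => if c = xor (L.lead ph j).2 (xor (ph j) (!b)) then 1 else 0, ev_fair]
  cases xor (L.lead ph j).2 (xor (ph j) (!b)) <;> simp

/-- Jobs with a common leader never share a machine; jobs with different leaders follow independent
coins. -/
theorem ev_chosen_pair (L : Links n) (ph : Fin n → Bool) {j j' : Fin n} (hjj : j ≠ j')
    (b b' : Bool) (hm : L.mach (j, b) = L.mach (j', b')) :
    ev (coinsPMF n) (fun coins => (if L.chosen ph coins j = (j, b) then 1 else 0)
        * if L.chosen ph coins j' = (j', b') then 1 else 0)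
      = if (L.lead ph j).1 = (L.lead ph j').1 then 0 else 1 / 4 := by
  split_ifs with h
  · have : ∀ coins : Fin n → Bool, (if L.chosen ph coins j = (j, b) then (1 : ℝ) else 0)
        * (if L.chosen ph coins j' = (j', b') then 1 else 0) = 0 := by
      intro coins
      split_ifs with h₁ h₂
      · have := Links.mach_chosen_ne coins hjj h
        rw [h₁, h₂] at this
        exact absurd hm this
      all_goals simp
    simp only [this, ev_const]
  · have h₁ := ev_chosen L ph j b
    have h₂ := ev_chosen L ph j' b'
    simp only [chosen_eq_iff] at h₁ h₂ ⊢
    rw [coinsPMF] at h₁ h₂ ⊢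
    rw [ev_piPMF_apply (fun _ => fair) (L.lead ph j).1
      fun c => if c = xor (L.lead ph j).2 (xor (ph j) (!b)) then 1 else 0] at h₁
    rw [ev_piPMF_apply (fun _ => fair) (L.lead ph j').1
      fun c => if c = xor (L.lead ph j').2 (xor (ph j') (!b')) then 1 else 0] at h₂
    rw [ev_piPMF_pair (fun _ => fair) h
      (fun c => if c = xor (L.lead ph j).2 (xor (ph j) (!b)) then 1 else 0)
      (fun c => if c = xor (L.lead ph j').2 (xor (ph j') (!b')) then 1 else 0), h₁, h₂]
    norm_num

end FairCoins

/-! ## Random levels -/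

section Levels

variable {n : ℕ}

/-- The number of levels. -/
def numLevels : ℕ := 1000

/-- The uniform distribution on `{0, …, k}`. -/
noncomputable def unif (k : ℕ) : PMF (Fin (k + 1)) := PMF.uniformOfFintype _

theorem ev_unif (k : ℕ) (f : Fin (k + 1) → ℝ) : ev (unif k) f = (∑ a, f a) / (k + 1) := by
  rw [ev, Finset.sum_div]
  refine Finset.sum_congr rfl fun a _ => ?_
  simp only [unif, PMF.uniformOfFintype_apply, Fintype.card_fin]
  rw [ENNReal.toReal_inv, ENNReal.toReal_natCast]
  push_cast
  ring

theorem ev_unif_le (k : ℕ) (a : Fin (k + 1)) :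
    ev (unif k) (fun b => if b ≤ a then 1 else 0) = (a + 1) / (k + 1) := by
  rw [ev_unif, Finset.sum_boole]
  congr 2
  have : (Finset.univ.filter fun b => b ≤ a) = Finset.Iic a := by ext b; simp
  rw [this, Fin.card_Iic]
  push_cast
  ring

theorem sum_pow_six_le (m : ℕ) :
    7 * ∑ a ∈ Finset.range m, ((a : ℝ) + 1) ^ 6 ≤ ((m : ℝ) + 1) ^ 7 := by
  induction m with
  | zero => simp
  | succ m ih =>
    rw [Finset.sum_range_succ, mul_add]
    push_cast
    have hm : (0 : ℝ) ≤ m := Nat.cast_nonneg m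
    have : 7 * ((m : ℝ) + 1) ^ 6 ≤ ((m : ℝ) + 1 + 1) ^ 7 - ((m : ℝ) + 1) ^ 7 := by
      rw [← sub_nonneg]
      ring_nf
      positivity
    linarith

/-- The probability that one of seven independent levels is at least as large as the others.
Comparison with an integral bounds it by `1.001 ^ 7 / 7`; the excess over `1/7` pays for ties among
`1000` levels. -/
theorem ev_unif_pow_six : ev (unif (numLevels - 1)) (fun a => (ev (unif (numLevels - 1))
    fun b => if b ≤ a then 1 else 0) ^ 6) ≤ 0.143864 := by
  simp only [ev_unif_le]
  rw [ev_unif]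
  simp only [div_pow]
  rw [← Finset.sum_div]
  have := sum_pow_six_le numLevels
  rw [← Fin.sum_univ_eq_sum_range (fun a => ((a : ℝ) + 1) ^ 6)] at this
  have h₁ : ∑ a : Fin (numLevels - 1 + 1), ((a : ℝ) + 1) ^ 6 ≤ ((numLevels : ℝ) + 1) ^ 7 / 7 := by
    rw [le_div_iff₀ (by norm_num)]
    have h₂ : 7 * ∑ a : Fin (numLevels - 1 + 1), ((a : ℝ) + 1) ^ 6 ≤ ((numLevels : ℝ) + 1) ^ 7 :=
      this
    linarith
  have h₂ : ((numLevels - 1 : ℕ) : ℝ) + 1 = 1000 := by norm_num [numLevels]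
  rw [h₂, div_div, div_le_iff₀ (by norm_num)]
  refine h₁.trans ?_
  norm_num [numLevels]

/-- The distribution of the levels. -/
noncomputable def levelPMF (n : ℕ) : PMF (Fin n × Bool → Fin (numLevels - 1 + 1)) :=
  piPMF fun _ => unif (numLevels - 1)

-- The seven links are determined by the matching, so their levels are independent and uniform.
open Classical in
theorem ev_levelMax_le (L : Links n) (h : Fin n × Bool) :
    ev (levelPMF n) (fun lev => if L.LevelMax (fun x => (lev x : ℕ)) h then 1 else 0)
      ≤ 0.143864 := by
  by_cases hc : (L.walkSet h).card = 6 ∧ L.canon h ∉ L.walkSet h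
  · have e : ∀ lev : Fin n × Bool → Fin (numLevels - 1 + 1),
        (if L.LevelMax (fun x => (lev x : ℕ)) h then (1 : ℝ) else 0)
        = if ∀ i ∈ L.walkSet h, lev i ≤ lev (L.canon h) then 1 else 0 := by
      intro lev
      refine if_congr ?_ rfl rfl
      unfold Links.LevelMax
      simp only [hc.1, hc.2, not_false_iff, true_and, Fin.val_fin_le]
    simp only [e]
    rw [levelPMF, ev_piPMF_forall_le (unif (numLevels - 1)) (fun b a => b ≤ a) (L.walkSet h) hc.2,
      hc.1]
    exact ev_unif_pow_six
  · have e : ∀ lev : Fin n × Bool → Fin (numLevels - 1 + 1),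
        (if L.LevelMax (fun x => (lev x : ℕ)) h then (1 : ℝ) else 0) = 0 := fun lev =>
      if_neg fun hl => hc ⟨hl.1, hl.2.1⟩
    simp only [e, ev_const]
    norm_num

end Levels

/-! ## The random choices of the jobs -/

/-- The two groups of a job and the classes of its two half-edges. -/
abbrev Draw (U : ℕ) := (Fin U × Fin U) × Bool × Bool

/-- The group of a half-edge. -/
def drawEnd {U : ℕ} (a : Draw U) (e : Bool) : Fin U := if e = true then a.1.2 else a.1.1

/-- The class of a half-edge. -/
def drawClass {U : ℕ} (a : Draw U) (e : Bool) : Bool := if e = true then a.2.2 else a.2.1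

/-- The groups of the half-edges. -/
def endOf {n U : ℕ} (ω : Fin n → Draw U) (h : Fin n × Bool) : Fin U := drawEnd (ω h.1) h.2

/-- The classes of the half-edges. -/
def classOf {n U : ℕ} (ω : Fin n → Draw U) (h : Fin n × Bool) : Bool := drawClass (ω h.1) h.2

/-- The distribution of the choices of a job: a random pair of groups, and independent classes of
the half-edges with given probabilities of the first class. -/
noncomputable def drawPMF {U : ℕ} (p : PMF (Fin U × Fin U)) (κ : Fin U → ℝ) : PMF (Draw U) :=
  p.bind fun q => (coin (κ q.1)).bind fun a => (coin (κ q.2)).bind fun b => PMF.pure (q, a, b)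

/-- The distribution of the numbers for the round robins. -/
noncomputable def ringPMF (n U : ℕ) : PMF (Fin U → (k : Fin n) → Fin (k + 1)) :=
  piPMF fun _ => piPMF fun k => unif k

section Rings

variable {n U : ℕ} {g : Fin U → ℕ} {E : Fin n × Bool → Fin U} {K : Fin n × Bool → Bool}

/-- A number is drawn beforehand for every modulus, so the law is uniform even though the modulus
used later depends on the draws of the jobs. -/
theorem ev_rv_eq {u : Fin U} {m r : ℕ} (hr : r < m) (hm : m ≤ n) :
    ev (ringPMF n U) (fun R => if rv R u m = r then 1 else 0) = 1 / m := by
  have h : m - 1 < n := by omega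
  simp only [rv, dif_pos h]
  rw [ringPMF, ev_piPMF_apply (fun _ => piPMF fun k : Fin n => unif (k : ℕ)) u
    fun ρ => if (ρ ⟨m - 1, h⟩ : ℕ) = r then 1 else 0,
    ev_piPMF_apply (fun k : Fin n => unif (k : ℕ)) ⟨m - 1, h⟩
      fun a => if (a : ℕ) = r then 1 else 0, ev_unif]
  rw [Finset.sum_eq_single (⟨r, by omega⟩ : Fin (m - 1 + 1))]
  · simp only [if_true]
    rw [Nat.cast_sub (by omega)]
    simp
  · intro b _ hb
    rw [if_neg]
    exact fun hbr => hb (Fin.ext hbr)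
  · simp

/-- The round is `a + b` modulo `m`, or twice the other number if one of the teams is `m`. -/
theorem exists_robin {m a b : ℕ} (hm : m % 2 = 1) (hab : a ≠ b) (ha : a ≤ m) (hb : b ≤ m) :
    ∃ r < m, Robin m r a b := by
  unfold Robin
  rcases lt_or_eq_of_le ha with ha | rfl
  · rcases lt_or_eq_of_le hb with hb | rfl
    · rcases lt_or_ge (a + b) m with h | h
      · exact ⟨a + b, h, by omega⟩
      · exact ⟨a + b - m, by omega, by omega⟩
    · rcases lt_or_ge (a + a) b with h | h
      · exact ⟨a + a, h, by omega⟩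
      · exact ⟨a + a - b, by omega, by omega⟩
  · rcases lt_or_ge (b + b) a with h | h
    · exact ⟨b + b, h, by omega⟩
    · exact ⟨b + b - a, by omega, by omega⟩

theorem linkProb_le (m : ℕ) : linkProb m ≤ 1 / (oddPart (m + 2) : ℕ) := by
  match m with
  | 0 | 1 | 2 | 3 | 4 | 5 | 6 => norm_num [linkProb, oddPart]
  | m + 7 => exact (show linkProb (m + 7) = 0 from rfl).trans_le (by positivity)

theorem linkProb_le_ev_partner {h h' : Fin n × Bool} (hc : CrossJob g E h.1)
    (hc' : CrossJob g E h'.1) (hne : h ≠ h') (hE : E h = E h') (hK : K h = true)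
    (hK' : K h' = true) {m : ℕ} (hm : (elig g E K true (E h)).card = m + 2) :
    linkProb m ≤ ev (ringPMF n U) fun R => if partner g E K R h = h' then 1 else 0 := by
  have h₁ := rank_lt (K := K) hc
  have h₂ := rank_lt (K := K) hc'
  rw [hK, hm] at h₁
  rw [hK', ← hE, hm] at h₂
  obtain ⟨r, hr, hrob⟩ := exists_robin (m := oddPart (m + 2)) (oddPart_odd (by omega))
    (fun hab => hne (rank_inj hc hc' hE (hK.trans hK'.symm) hab))
    (by unfold oddPart; omega) (by unfold oddPart; omega)
  have hn : m + 2 ≤ n := hm ▸ card_elig_le true (E h)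
  have hn' : oddPart (m + 2) ≤ n := by
    have : oddPart (m + 2) ≤ m + 2 := by unfold oddPart; omega
    omega
  refine (linkProb_le m).trans ?_
  rw [← ev_rv_eq (u := E h) hr hn']
  refine ev_mono fun R => ?_
  split_ifs with h₃ h₄ h₄
  · exact le_rfl
  · refine absurd (partner_eq ⟨hc, hc', hne, hE, Or.inl ⟨hK, hK', ?_⟩⟩) h₄
    rwa [hm, h₃]
  all_goals norm_num

theorem inv_card_le_ev_partner {h h' : Fin n × Bool} (hc : CrossJob g E h.1)
    (hc' : CrossJob g E h'.1) (hne : h ≠ h') (hE : E h = E h') (hK : K h = true)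
    (hK' : K h' = false) (h₁ : (elig g E K true (E h)).card = 1) :
    1 / ((elig g E K false (E h)).card : ℝ)
      ≤ ev (ringPMF n U) fun R => if partner g E K R h = h' then 1 else 0 := by
  have h₂ := rank_lt (K := K) hc'
  rw [hK', ← hE] at h₂
  rw [← ev_rv_eq (u := E h) h₂ (card_elig_le false (E h))]
  refine ev_mono fun R => ?_
  split_ifs with h₃ h₄ h₄
  · exact le_rfl
  · exact absurd (partner_eq ⟨hc, hc', hne, hE, Or.inr (Or.inl ⟨hK, hK', h₁, h₃.symm⟩)⟩) h₄
  all_goals norm_num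

theorem partner_comm {R : Fin U → (k : Fin n) → Fin (k + 1)} {h h' : Fin n × Bool} :
    partner g E K R h = h' ↔ partner g E K R h' = h :=
  ⟨fun e => by rw [← e]; exact (links g E K R).inv h,
    fun e => by rw [← e]; exact (links g E K R).inv h'⟩

end Rings

/-! ## The number of half-edges at a group -/

section Counting

variable {n U : ℕ} (g : Fin U → ℕ) (u : Fin U)

/-- The job has a half-edge of class `c` at the group `u`, and its groups belong to different
machines. -/
def Present (c : Bool) (a : Draw U) (e : Bool) : Prop :=
  g a.1.1 ≠ g a.1.2 ∧ drawEnd a e = u ∧ drawClass a e = c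

instance (c : Bool) (a : Draw U) (e : Bool) : Decidable (Present g u c a e) := by
  unfold Present; infer_instance

variable {g u}

theorem Present.unique {c c' : Bool} {a : Draw U} {e e' : Bool} (h : Present g u c a e)
    (h' : Present g u c' a e') : e = e' ∧ c = c' := by
  obtain ⟨h₁, h₂, h₃⟩ := h
  obtain ⟨-, h₄, h₅⟩ := h'
  have : e = e' := by
    by_contra hne
    unfold drawEnd at h₂ h₄
    cases e <;> cases e' <;> simp_all
  subst this
  exact ⟨rfl, h₃.symm.trans h₅⟩

/-- A job contributes at most one half-edge to a group, so the count becomes a count of independent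
events indexed by jobs. -/
theorem card_elig_eq (ω : Fin n → Draw U) (c : Bool) :
    (elig g (endOf ω) (classOf ω) c u).card
      = countOn (fun _ a => ∃ e, Present g u c a e) Finset.univ ω := by
  unfold countOn
  refine Finset.card_bij (fun h _ => h.1) ?_ ?_ ?_
  · intro h hh
    obtain ⟨h₁, h₂, h₃⟩ := mem_elig.1 hh
    exact Finset.mem_filter.2 ⟨Finset.mem_univ _, h.2, h₁, h₂, h₃⟩
  · intro h hh h' hh' e
    obtain ⟨h₁, h₂, h₃⟩ := mem_elig.1 hh
    obtain ⟨h₄, h₅, h₆⟩ := mem_elig.1 hh'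
    obtain ⟨j, b⟩ := h
    obtain ⟨j', b'⟩ := h'
    simp only at e
    subst e
    rw [(show Present g u c (ω j) b from ⟨h₁, h₂, h₃⟩).unique
      (show Present g u c (ω j) b' from ⟨h₄, h₅, h₆⟩) |>.1]
  · intro i hi
    obtain ⟨-, e, h₁, h₂, h₃⟩ := Finset.mem_filter.1 hi
    exact ⟨(i, e), mem_elig.2 ⟨h₁, h₂, h₃⟩, rfl⟩

/-- All jobs except two. -/
def others (j j' : Fin n) : Finset (Fin n) := (Finset.univ.erase j').erase j

theorem card_elig_eq_others (ω : Fin n → Draw U) {j j' : Fin n} (hjj : j ≠ j') (c : Bool) :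
    (elig g (endOf ω) (classOf ω) c u).card
      = countOn (fun _ a => ∃ e, Present g u c a e) (others j j') ω
        + (if ∃ e, Present g u c (ω j) e then 1 else 0)
        + (if ∃ e, Present g u c (ω j') e then 1 else 0) := by
  rw [card_elig_eq]
  have e : (Finset.univ : Finset (Fin n)) = insert j' (insert j (others j j')) := by
    unfold others
    rw [Finset.insert_erase (by simp [hjj]), Finset.insert_erase (Finset.mem_univ _)]
  have h₁ : j ∉ others j j' := by simp [others]
  have h₂ : j' ∉ insert j (others j j') := by simp [others, hjj.symm]
  conv_lhs => rw [e]
  have := countOn_insert_update (b := fun _ a => ∃ e, Present g u c a e) h₁ ω (ω j)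
  have h₃ := countOn_insert_update (b := fun _ a => ∃ e, Present g u c a e) h₂ ω (ω j')
  rw [Function.update_eq_self] at this h₃
  rw [h₃, this]

end Counting

/-! ## The probability of a link -/

section LinkProbability

variable {n U : ℕ} {g : Fin U → ℕ} {x : Fin U → Fin n → ℝ} {P : Fin n → PMF (Fin U × Fin U)}

/-- The distributions of the choices of the jobs, for twice the fractional assignment. -/
noncomputable def jobPMF (x : Fin U → Fin n → ℝ) (P : Fin n → PMF (Fin U × Fin U)) (j : Fin n) :
    PMF (Draw U) := drawPMF (P j) fun u => 1 - 2 / 5 * x u j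

/-- The pairs of the jobs have the systematic distribution of `x`. -/
structure PairLaw (g : Fin U → ℕ) (x : Fin U → Fin n → ℝ) (P : Fin n → PMF (Fin U × Fin U)) :
    Prop where
  nonneg : ∀ u j, 0 ≤ x u j
  le_two : ∀ u j, x u j ≤ 2
  sum_group : ∀ u, ∑ j, x u j ≤ 2
  sum_job : ∀ j, ∑ u, x u j = 2
  law : ∀ j f, ev (P j) f = ∑ u, ∑ v, pairWeight g (fun u => x u j) u v * f (u, v)

/-- The group at an end of a pair. -/
def pairEnd (q : Fin U × Fin U) (e : Bool) : Fin U := if e = true then q.2 else q.1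

theorem ev_jobPMF_fst (x : Fin U → Fin n → ℝ) (P : Fin n → PMF (Fin U × Fin U)) (j : Fin n)
    (f : Fin U × Fin U → ℝ) : ev (jobPMF x P j) (fun a => f a.1) = ev (P j) f := by
  simp only [jobPMF, drawPMF, ev_bind, ev_pure, ev_const]

variable (h : PairLaw g x P)
include h

theorem PairLaw.mem (u : Fin U) (j : Fin n) :
    0 ≤ 1 - 2 / 5 * x u j ∧ 1 - 2 / 5 * x u j ≤ 1 := by
  have := h.nonneg u j
  have := h.le_two u j
  constructor <;> linarith

theorem PairLaw.ev_end_add (u : Fin U) (j : Fin n) :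
    ev (P j) (fun q => if pairEnd q false = u then 1 else 0)
      + ev (P j) (fun q => if pairEnd q true = u then 1 else 0) = x u j := by
  rw [h.law, h.law]
  simp only [pairEnd, if_true, Bool.false_eq_true, if_false, mul_ite, mul_one, mul_zero,
    Finset.sum_ite_eq', Finset.mem_univ]
  have e : ∀ w : Fin U, (∑ v, if w = u then pairWeight g (fun u => x u j) w v else 0)
      = if w = u then ∑ v, pairWeight g (fun u => x u j) w v else 0 := by
    intro w; split_ifs <;> simp
  simp only [e, Finset.sum_ite_eq', Finset.mem_univ, if_true]
  exact sum_pairWeight_add (x := fun u => x u j) (fun u => h.nonneg u j) (h.sum_job j) u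

theorem PairLaw.ev_present (u : Fin U) (j : Fin n) (c e : Bool) :
    ev (jobPMF x P j) (fun a => if Present g u c a e then 1 else 0)
      = (if c = true then 1 - 2 / 5 * x u j else 2 / 5 * x u j)
        * ev (P j) fun q => if g q.1 ≠ g q.2 ∧ pairEnd q e = u then 1 else 0 := by
  have hm := fun v => h.mem v j
  simp only [jobPMF, drawPMF, ev_bind, ev_pure]
  rw [← ev_mul_left]
  refine congrArg _ (funext fun q => ?_)
  obtain ⟨q₁, q₂⟩ := q
  simp only [ev_coin (hm _).1 (hm _).2, Present, drawEnd, drawClass, pairEnd]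
  by_cases hg : g q₁ = g q₂
  · simp [hg]
  · cases e
    · by_cases hu : q₁ = u
      · subst hu
        cases c <;> simp [hg]
      · simp [hu]
    · by_cases hu : q₂ = u
      · subst hu
        cases c <;> simp [hg] <;> ring
      · simp [hu]

/-- This is where non-domination enters: a machine of mass at most `1` never receives both ends of
the job, so a job with an end at `u` is almost surely a cross job. -/
theorem PairLaw.ev_cross_end {u : Fin U} {j : Fin n}
    (hd : ∑ v with g v = g u, x v j ≤ 1) (e : Bool) :
    ev (P j) (fun q => if g q.1 ≠ g q.2 ∧ pairEnd q e = u then 1 else 0)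
      = ev (P j) fun q => if pairEnd q e = u then 1 else 0 := by
  rw [h.law, h.law]
  refine Finset.sum_congr rfl fun v _ => Finset.sum_congr rfl fun w _ => ?_
  by_cases hg : g v = g w
  · by_cases hu : pairEnd (v, w) e = u
    · have h₀ : pairWeight g (fun u => x u j) v w = 0 := by
        by_contra hne
        have hpos := lt_of_le_of_ne (pairWeight_nonneg v w) (Ne.symm hne)
        have h₁ := one_lt_of_pairWeight_pos (fun u => h.nonneg u j) hg hpos
        have h₂ : g v = g u := by
          rw [← hu]
          cases e <;> simp [pairEnd, hg]
        rw [h₂] at h₁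
        linarith
      rw [h₀]
      simp
    · simp [hu]
  · simp [hg]

theorem PairLaw.ev_exists_present (u : Fin U) (j : Fin n) (c : Bool) :
    ev (jobPMF x P j) (fun a => if ∃ e, Present g u c a e then 1 else 0)
      = (if c = true then 1 - 2 / 5 * x u j else 2 / 5 * x u j)
        * ev (P j) fun q => if g q.1 ≠ g q.2 ∧ (q.1 = u ∨ q.2 = u) then 1 else 0 := by
  have e₁ : ∀ a : Draw U, (if ∃ e, Present g u c a e then (1 : ℝ) else 0)
      = (if Present g u c a false then 1 else 0) + if Present g u c a true then 1 else 0 := by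
    intro a
    by_cases h₁ : Present g u c a false
    · have h₂ : ¬ Present g u c a true := fun h₂ => by simpa using (h₁.unique h₂).1
      rw [if_pos ⟨_, h₁⟩, if_pos h₁, if_neg h₂, add_zero]
    · by_cases h₂ : Present g u c a true
      · rw [if_pos ⟨_, h₂⟩, if_pos h₂, if_neg h₁, zero_add]
      · rw [if_neg, if_neg h₁, if_neg h₂, add_zero]
        rintro ⟨e, he⟩
        cases e <;> tauto
  simp only [e₁]
  rw [ev_add, h.ev_present, h.ev_present, ← mul_add, ← ev_add]
  congr 2
  funext q
  obtain ⟨q₁, q₂⟩ := q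
  simp only [pairEnd, if_true, Bool.false_eq_true, if_false]
  by_cases hg : g q₁ = g q₂
  · simp [hg]
  · by_cases h₁ : q₁ = u
    · have h₂ : q₂ ≠ u := fun h₂ => hg (by rw [h₁, h₂])
      simp [h₁, h₂]
    · simp [h₁]

theorem PairLaw.ev_touch_le (u : Fin U) (j : Fin n) :
    ev (P j) (fun q => if g q.1 ≠ g q.2 ∧ (q.1 = u ∨ q.2 = u) then 1 else 0) ≤ x u j ∧
      ev (P j) (fun q => if g q.1 ≠ g q.2 ∧ (q.1 = u ∨ q.2 = u) then (1 : ℝ) else 0) ≤ 1 := by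
  constructor
  · rw [← h.ev_end_add u j, ← ev_add]
    refine ev_mono fun q => ?_
    simp only [pairEnd, if_true, Bool.false_eq_true, if_false]
    split_ifs with h₁ h₂ h₃ h₃ h₂ h₃ h₃ <;> first | tauto | norm_num
  · rw [← ev_const (P j) 1]
    refine ev_mono fun q => ?_
    split_ifs <;> norm_num

theorem PairLaw.sum_others_le (u : Fin U) {j j' : Fin n} (hjj : j ≠ j') :
    ∑ i ∈ others j j', x u i ≤ 2 - x u j - x u j' := by
  have := h.sum_group u
  rw [← Finset.add_sum_erase _ _ (Finset.mem_univ j'),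
    ← Finset.add_sum_erase _ _ (Finset.mem_erase.2 ⟨hjj, Finset.mem_univ j⟩)] at this
  unfold others
  linarith

/-- Two half-edges at the same group are linked with probability at least `0.3647`. -/
theorem PairLaw.link_probability {u : Fin U} {j j' : Fin n} (hjj : j ≠ j')
    (hd : ∑ v with g v = g u, x v j ≤ 1) (hd' : ∑ v with g v = g u, x v j' ≤ 1) (e e' : Bool) :
    0.3647 * (ev (P j) (fun q => if pairEnd q e = u then 1 else 0)
        * ev (P j') (fun q => if pairEnd q e' = u then 1 else 0))
      ≤ ev (piPMF (jobPMF x P)) fun ω => (if endOf ω (j, e) = u then 1 else 0)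
          * (if endOf ω (j', e') = u then 1 else 0)
          * ev (ringPMF n U) fun R =>
            if partner g (endOf ω) (classOf ω) R (j, e) = (j', e') then 1 else 0 := by
  set N : Bool → (Fin n → Draw U) → ℕ :=
    fun c => countOn (fun _ a => ∃ e, Present g u c a e) (others j j') with hN
  set φ : Bool → Bool → Draw U → ℝ := fun c e a => if Present g u c a e then 1 else 0 with hφ
  -- a pointwise lower bound
  have point : ∀ ω : Fin n → Draw U,
      φ true e (ω j) * (φ true e' (ω j') * linkProb (0 + N true ω))
        + (φ true e (ω j) * (φ false e' (ω j')
            * (if N true ω = 0 then (3 - (N false ω : ℝ)) / 4 else 0))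
          + φ false e (ω j) * (φ true e' (ω j')
            * (if N true ω = 0 then (3 - (N false ω : ℝ)) / 4 else 0)))
      ≤ (if endOf ω (j, e) = u then 1 else 0) * (if endOf ω (j', e') = u then 1 else 0)
          * ev (ringPMF n U) fun R =>
            if partner g (endOf ω) (classOf ω) R (j, e) = (j', e') then 1 else 0 := by
    intro ω
    have hev : 0 ≤ ev (ringPMF n U) fun R =>
        if partner g (endOf ω) (classOf ω) R (j, e) = (j', e') then (1 : ℝ) else 0 :=
      ev_nonneg fun R => by split_ifs <;> norm_num
    have hrhs : 0 ≤ (if endOf ω (j, e) = u then (1 : ℝ) else 0)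
        * (if endOf ω (j', e') = u then 1 else 0)
        * ev (ringPMF n U) fun R =>
            if partner g (endOf ω) (classOf ω) R (j, e) = (j', e') then 1 else 0 :=
      mul_nonneg (mul_nonneg (by split_ifs <;> norm_num) (by split_ifs <;> norm_num)) hev
    by_cases hp : ∃ c, Present g u c (ω j) e
    swap
    · have : ∀ c, φ c e (ω j) = 0 := fun c => if_neg fun hc => hp ⟨c, hc⟩
      simp only [this, zero_mul, add_zero]
      exact hrhs
    by_cases hp' : ∃ c, Present g u c (ω j') e'
    swap
    · have : ∀ c, φ c e' (ω j') = 0 := fun c => if_neg fun hc => hp' ⟨c, hc⟩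
      simp only [this, zero_mul, mul_zero, add_zero]
      exact hrhs
    obtain ⟨c, hc⟩ := hp
    obtain ⟨c', hc'⟩ := hp'
    have hE : endOf ω (j, e) = u := hc.2.1
    have hE' : endOf ω (j', e') = u := hc'.2.1
    have hK : classOf ω (j, e) = c := hc.2.2
    have hK' : classOf ω (j', e') = c' := hc'.2.2
    have hne : ((j, e) : Fin n × Bool) ≠ (j', e') := fun h => hjj (congrArg Prod.fst h)
    have cross : CrossJob g (endOf ω) (j, e).1 := hc.1
    have cross' : CrossJob g (endOf ω) (j', e').1 := hc'.1
    have val : ∀ d, φ d e (ω j) = if d = c then 1 else 0 := fun d => by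
      by_cases hdc : d = c
      · rw [hdc, if_pos rfl]; exact if_pos hc
      · rw [if_neg hdc]; exact if_neg fun hd => hdc (hd.unique hc).2
    have val' : ∀ d, φ d e' (ω j') = if d = c' then 1 else 0 := fun d => by
      by_cases hdc : d = c'
      · rw [hdc, if_pos rfl]; exact if_pos hc'
      · rw [if_neg hdc]; exact if_neg fun hd => hdc (hd.unique hc').2
    have ex : ∀ d, (∃ e, Present g u d (ω j) e) ↔ d = c := fun d =>
      ⟨fun ⟨_, hd⟩ => (hd.unique hc).2, fun hd => ⟨e, hd ▸ hc⟩⟩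
    have ex' : ∀ d, (∃ e, Present g u d (ω j') e) ↔ d = c' := fun d =>
      ⟨fun ⟨_, hd⟩ => (hd.unique hc').2, fun hd => ⟨e', hd ▸ hc'⟩⟩
    have card : ∀ d, (elig g (endOf ω) (classOf ω) d u).card
        = N d ω + (if d = c then 1 else 0) + if d = c' then 1 else 0 := fun d => by
      rw [card_elig_eq_others ω hjj]
      simp only [ex, ex', hN]
    rw [if_pos hE, if_pos hE', one_mul, one_mul, val, val, val', val', zero_add]
    -- The tangent of `1 / (m + 1)` at `m = 1`. A linear bound reduces the estimate to the expected
    -- number of half-edges of the second class.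
    have hthree : ∀ m : ℕ, (3 - (m : ℝ)) / 4 ≤ 1 / ((m : ℝ) + 1) := by
      intro m
      have hm : (0 : ℝ) ≤ m := Nat.cast_nonneg m
      rw [div_le_div_iff₀ (by norm_num) (by positivity)]
      nlinarith [sq_nonneg ((m : ℝ) - 1)]
    -- Two half-edges of the second class are never linked and contribute nothing. Two of the first
    -- class meet in the round robin; a mixed pair needs the first class to have no other member.
    cases c <;> cases c'
    · simpa using hev
    · simp only [if_true, Bool.false_eq_true, if_false, Bool.true_eq_false, one_mul, zero_mul,
        zero_add]
      split_ifs with h₀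
      · refine (hthree _).trans ?_
        have h₁ : (elig g (endOf ω) (classOf ω) true (endOf ω (j', e'))).card = 1 := by
          rw [hE', card]; simp [h₀]
        have h₂ := inv_card_le_ev_partner cross' cross hne.symm (hE'.trans hE.symm) hK' hK h₁
        rw [hE', card] at h₂
        simp only [partner_comm (h := (j', e')) (h' := (j, e))] at h₂
        simpa using h₂
      · exact hev
    · simp only [if_true, Bool.false_eq_true, if_false, Bool.true_eq_false, one_mul, zero_mul,
        zero_add, add_zero]
      split_ifs with h₀
      · refine (hthree _).trans ?_
        have h₁ : (elig g (endOf ω) (classOf ω) true (endOf ω (j, e))).card = 1 := by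
          rw [hE, card]; simp [h₀]
        have h₂ := inv_card_le_ev_partner cross cross' hne (hE.trans hE'.symm) hK hK' h₁
        rw [hE, card] at h₂
        simpa using h₂
      · exact hev
    · have h₁ := linkProb_le_ev_partner (m := N true ω) cross cross' hne (hE.trans hE'.symm) hK hK'
        (by rw [hE, card]; simp)
      simpa using h₁
  refine le_trans ?_ (ev_mono point)
  have hj : j ∉ others j j' := by simp [others]
  have hj' : j' ∉ others j j' := by simp [others]
  -- The choices of `j`, of `j'` and of the other jobs are independent.
  have fact : ∀ (c c' : Bool) (F : (Fin n → Draw U) → ℝ),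
      (∀ ω a, F (Function.update ω j a) = F ω) → (∀ ω a, F (Function.update ω j' a) = F ω) →
      ev (piPMF (jobPMF x P)) (fun ω => φ c e (ω j) * (φ c' e' (ω j') * F ω))
        = ev (jobPMF x P j) (φ c e) * (ev (jobPMF x P j') (φ c' e')
          * ev (piPMF (jobPMF x P)) F) := by
    intro c c' F hF hF'
    rw [ev_piPMF_mul _ j (φ c e) fun ω => φ c' e' (ω j') * F ω,
      ev_piPMF_mul _ j' (φ c' e') F hF']
    intro ω a
    rw [hF, Function.update_of_ne hjj.symm]
  have hN₁ : ∀ c ω a, N c (Function.update ω j a) = N c ω := fun c ω a => countOn_update hj ω a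
  have hN₂ : ∀ c ω a, N c (Function.update ω j' a) = N c ω := fun c ω a => countOn_update hj' ω a
  rw [ev_add, ev_add, fact, fact, fact]
  rotate_left
  · intro ω a; simp only [hN₁]
  · intro ω a; simp only [hN₂]
  · intro ω a; simp only [hN₁]
  · intro ω a; simp only [hN₂]
  · intro ω a; simp only [hN₁]
  · intro ω a; simp only [hN₂]
  simp only [hφ]
  rw [h.ev_present, h.ev_present, h.ev_present, h.ev_present, h.ev_cross_end hd,
    h.ev_cross_end hd']
  simp only [if_true, Bool.false_eq_true, if_false]
  set p := ev (P j) fun q => if pairEnd q e = u then 1 else 0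
  set p' := ev (P j') fun q => if pairEnd q e' = u then 1 else 0
  have hp₀ : 0 ≤ p := ev_nonneg fun q => by split_ifs <;> norm_num
  have hp₀' : 0 ≤ p' := ev_nonneg fun q => by split_ifs <;> norm_num
  -- Poisson comparison
  have hL := h.sum_others_le u hjj
  set L := 2 - x u j - x u j' with hLdef
  have hs₀ : 0 ≤ ∑ i ∈ others j j', x u i := Finset.sum_nonneg fun i _ => h.nonneg u i
  have hr : ∀ i, 0 ≤ 1.03 * x u i := fun i => mul_nonneg (by norm_num) (h.nonneg u i)
  have hf : ∀ i ∈ others j j', ev (jobPMF x P i)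
      (fun a => if ∃ e, Present g u true a e then 1 else 0) ≤ 1 - Real.exp (-(1.03 * x u i)) := by
    intro i _
    rw [h.ev_exists_present, if_pos rfl]
    refine le_trans ?_ (sub_sq_le_one_sub_exp (h.nonneg u i) (h.le_two u i))
    nlinarith [(h.ev_touch_le u i).1, (h.mem u i).1]
  have hx : ∀ i ∈ others j j', ev (jobPMF x P i)
      (fun a => if ∃ e, Present g u false a e then 1 else 0)
      ≤ x u i * (1 - ev (jobPMF x P i) fun a => if ∃ e, Present g u true a e then 1 else 0) := by
    intro i _
    rw [h.ev_exists_present, h.ev_exists_present]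
    simp only [if_true, Bool.false_eq_true, if_false]
    obtain ⟨h₁, h₂⟩ := h.ev_touch_le u i
    set z := ev (P i) fun q => if g q.1 ≠ g q.2 ∧ (q.1 = u ∨ q.2 = u) then (1 : ℝ) else 0
    have h₃ := h.nonneg u i
    have h₄ := h.le_two u i
    -- This is `(7 - 2x) z ≤ 5`: use `z ≤ x` for `x ≤ 1`, where `(5 - 2x)(1 - x) ≥ 0`, and `z ≤ 1`
    -- for `x ≥ 1`.
    have h₅ : 2 / 5 * z ≤ 1 - (1 - 2 / 5 * x u i) * z := by
      rcases le_total (x u i) 1 with h₆ | h₆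
      · nlinarith
      · nlinarith
    nlinarith
  have est₁ := linkSeries_le_ev_linkProb (jobPMF x P)
    (b := fun _ a => ∃ e, Present g u true a e) (others j j') (fun i => 1.03 * x u i) hr hf 0
  obtain ⟨est₂, est₃⟩ := exp_neg_le_ev_countOn_eq_zero (jobPMF x P)
    (b := fun _ a => ∃ e, Present g u true a e) (b' := fun _ a => ∃ e, Present g u false a e)
    (others j j') (fun i => 1.03 * x u i) (fun i => x u i) hf hx
    (fun i a ⟨_, h₁⟩ ⟨_, h₂⟩ => by simpa using (h₁.unique h₂).2)
  rw [← Finset.mul_sum] at est₁ est₂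
  -- The total mass of the other jobs may be less than `L`; by monotonicity `L` is the worst case.
  have est₁' := (exp_neg_mul_linkSeries_antitone (t := 1.03 * L) (by positivity)
    (mul_le_mul_of_nonneg_left hL (by norm_num)) 0).trans est₁
  -- The probability of no competitor in the first class is at least `exp (-1.03 L)`, and given this
  -- event the expected number in the second class is at most `L`.
  have est₄ : Real.exp (-(1.03 * L)) * ((3 - L) / 4) ≤ ev (piPMF (jobPMF x P))
      fun ω => if N true ω = 0 then (3 - (N false ω : ℝ)) / 4 else 0 := by
    have e₁ : ∀ ω, (if N true ω = 0 then (3 - (N false ω : ℝ)) / 4 else 0)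
        = 3 / 4 * (if N true ω = 0 then 1 else 0)
          - 1 / 4 * if N true ω = 0 then (N false ω : ℝ) else 0 := by
      intro ω
      split_ifs <;> ring
    simp only [e₁]
    rw [ev_sub, ev_mul_left, ev_mul_left]
    set P₀ := ev (piPMF (jobPMF x P)) fun ω => if N true ω = 0 then (1 : ℝ) else 0
    have hP₀ : Real.exp (-(1.03 * L)) ≤ P₀ := le_trans
      (Real.exp_le_exp.2 (by nlinarith)) est₂
    have hP₁ : 0 ≤ P₀ := (Real.exp_pos _).le.trans hP₀
    have hL₃ : 0 ≤ 3 - L := by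
      have := h.nonneg u j
      have := h.nonneg u j'
      rw [hLdef]; linarith
    have h₁ := mul_le_mul_of_nonneg_right hP₀ hL₃
    have h₂ := mul_le_mul_of_nonneg_right hL hP₁
    linarith
  have num := link_numeric (h.nonneg u j) (h.nonneg u j') (by linarith)
  rw [← hLdef] at num
  have m := h.mem u j
  have m' := h.mem u j'
  have n₁ := h.nonneg u j
  have n₂ := h.nonneg u j'
  have a₁ := mul_le_mul_of_nonneg_left est₁' (mul_nonneg m.1 m'.1)
  have a₂ := mul_le_mul_of_nonneg_left est₄ (show 0 ≤ (1 - 2 / 5 * x u j) * (2 / 5 * x u j')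
    + (2 / 5 * x u j) * (1 - 2 / 5 * x u j') from add_nonneg
      (mul_nonneg m.1 (by positivity)) (mul_nonneg (by positivity) m'.1))
  have a₃ := mul_le_mul_of_nonneg_right (num.trans (add_le_add a₁ a₂)) (mul_nonneg hp₀ hp₀')
  refine a₃.trans (le_of_eq ?_)
  simp only [hN]
  ring

end LinkProbability

/-! ## The marginals and the correlations of the assignment -/

section Correlations

variable {n U : ℕ}

/-- The probability, over the global coin and the coins of the jobs, that `j` goes to `u` and
`j'` to `u'`. -/
noncomputable def pairProb (L : Links n) (E : Fin n × Bool → Fin U) (ph : Fin n → Bool)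
    (j j' : Fin n) (u u' : Fin U) : ℝ :=
  ev fair fun β => ev (coinsPMF n) fun coins =>
    if E (L.chosen (Links.shift β ph) coins j) = u ∧ E (L.chosen (Links.shift β ph) coins j') = u'
      then 1 else 0

theorem indicator_chosen (L : Links n) (E : Fin n × Bool → Fin U) (ph coins : Fin n → Bool)
    (j : Fin n) (u : Fin U) : (if E (L.chosen ph coins j) = u then (1 : ℝ) else 0)
      = ∑ e, (if E (j, e) = u then 1 else 0) * if L.chosen ph coins j = (j, e) then 1 else 0 := by
  obtain ⟨b, hb⟩ : ∃ b, L.chosen ph coins j = (j, b) :=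
    ⟨_, Prod.ext chosen_fst rfl⟩
  rw [hb, Finset.sum_eq_single b]
  · simp
  · intro c _ hc
    simp [hc.symm]
  · simp

theorem ev_single (L : Links n) (E : Fin n × Bool → Fin U) (ph : Fin n → Bool) (j : Fin n)
    (u : Fin U) :
    ev fair (fun β => ev (coinsPMF n) fun coins =>
      if E (L.chosen (Links.shift β ph) coins j) = u then 1 else 0)
      = ∑ e, (if E (j, e) = u then 1 else 0) * (1 / 2) := by
  simp only [indicator_chosen, ev_sum, ev_mul_left, ev_chosen, ev_const]

/-- Values of the global coin that put both jobs under one leader contribute nothing, all others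
contribute `1/4`. -/
theorem pairProb_le (L : Links n) (E : Fin n × Bool → Fin U) (ph : Fin n → Bool) {j j' : Fin n}
    (hjj : j ≠ j') {u u' : Fin U}
    (hm : ∀ e e', E (j, e) = u → E (j', e') = u' → L.mach (j, e) = L.mach (j', e')) :
    pairProb L E ph j j' u u' ≤ ∑ e, ∑ e', (if E (j, e) = u then 1 else 0)
      * (if E (j', e') = u' then 1 else 0) * (1 / 4) * (1 - ev fair fun β =>
        if (L.lead (Links.shift β ph) j).1 = (L.lead (Links.shift β ph) j').1 then 1 else 0) := by
  unfold pairProb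
  have e₁ : ∀ (β : Bool) (coins : Fin n → Bool),
      (if E (L.chosen (Links.shift β ph) coins j) = u ∧
        E (L.chosen (Links.shift β ph) coins j') = u' then (1 : ℝ) else 0)
      = ∑ e, ∑ e', (if E (j, e) = u then 1 else 0) * (if E (j', e') = u' then 1 else 0)
        * ((if L.chosen (Links.shift β ph) coins j = (j, e) then 1 else 0)
          * if L.chosen (Links.shift β ph) coins j' = (j', e') then 1 else 0) := by
    intro β coins
    have : ∀ (p q : Prop) [Decidable p] [Decidable q],
        (if p ∧ q then (1 : ℝ) else 0) = (if p then 1 else 0) * if q then 1 else 0 := by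
      intro p q _ _
      by_cases hp : p <;> simp [hp]
    rw [this, indicator_chosen, indicator_chosen, Finset.sum_mul_sum]
    exact Finset.sum_congr rfl fun e _ => Finset.sum_congr rfl fun e' _ => by ring
  simp only [e₁, ev_sum, ev_mul_left]
  refine Finset.sum_le_sum fun e _ => Finset.sum_le_sum fun e' _ => ?_
  rw [mul_assoc _ (1 / 4 : ℝ)]
  by_cases h₁ : E (j, e) = u
  · by_cases h₂ : E (j', e') = u'
    · refine mul_le_mul_of_nonneg_left (le_of_eq ?_) (by rw [if_pos h₁, if_pos h₂]; norm_num)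
      simp only [ev_chosen_pair L _ hjj e e' (hm e e' h₁ h₂)]
      rw [← ev_const fair (1 : ℝ), ← ev_sub, ← ev_mul_left]
      refine congrArg _ (funext fun β => ?_)
      rw [ev_const]
      split_ifs <;> norm_num
    · simp [h₂]
  · simp [h₁]

open Classical in
/-- The bound for the probability that two jobs meet at `u`. -/
noncomputable def meetBound (g : Fin U → ℕ) (u : Fin U) (j j' : Fin n) (ω : Fin n → Draw U)
    (R : Fin U → (k : Fin n) → Fin (k + 1)) (lev : Fin n × Bool → Fin (numLevels - 1 + 1)) : ℝ :=
  ∑ e, ∑ e', (if endOf ω (j, e) = u then 1 else 0) * (if endOf ω (j', e') = u then 1 else 0)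
    * (1 / 4) * (1 - 1 / 2 *
      ((if partner g (endOf ω) (classOf ω) R (j, e) = (j', e') then 1 else 0)
        * (1 - if (links g (endOf ω) (classOf ω) R).LevelMax (fun h => (lev h : ℕ)) (j, e)
            then 1 else 0)))

theorem meetBound_nonneg (g : Fin U → ℕ) (u : Fin U) (j j' : Fin n) (ω : Fin n → Draw U)
    (R : Fin U → (k : Fin n) → Fin (k + 1)) (lev : Fin n × Bool → Fin (numLevels - 1 + 1)) :
    0 ≤ meetBound g u j j' ω R lev := by
  refine Finset.sum_nonneg fun e _ => Finset.sum_nonneg fun e' _ => ?_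
  refine mul_nonneg (mul_nonneg (mul_nonneg ?_ ?_) (by norm_num)) ?_
  all_goals split_ifs <;> norm_num

/-- A link that is not of maximal level is satisfied or joinable, so one of the two values of the
global coin gives a common leader. The bound no longer mentions the phases, which are known only
through `Bridged`. -/
theorem pairProb_le_meetBound {g : Fin U → ℕ} {u : Fin U} {j j' : Fin n} (hjj : j ≠ j')
    (ω : Fin n → Draw U) (R : Fin U → (k : Fin n) → Fin (k + 1))
    (lev : Fin n × Bool → Fin (numLevels - 1 + 1)) {ph : Fin n → Bool}
    (hB : (links g (endOf ω) (classOf ω) R).Bridged numLevels (fun h => (lev h : ℕ)) ph) :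
    pairProb (links g (endOf ω) (classOf ω) R) (endOf ω) ph j j' u u
      ≤ meetBound g u j j' ω R lev := by
  refine (pairProb_le _ _ ph hjj fun e e' h₁ h₂ => ?_).trans ?_
  · show g _ = g _
    rw [h₁, h₂]
  · refine Finset.sum_le_sum fun e _ => Finset.sum_le_sum fun e' _ =>
      mul_le_mul_of_nonneg_left ?_ ?_
    · refine sub_le_sub_left ?_ _
      have hnn : 0 ≤ ev fair fun β =>
          if ((links g (endOf ω) (classOf ω) R).lead (Links.shift β ph) j).1
            = ((links g (endOf ω) (classOf ω) R).lead (Links.shift β ph) j').1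
            then (1 : ℝ) else 0 :=
        ev_nonneg fun β => by split_ifs <;> norm_num
      split_ifs with h₁ h₂ h₂
      · simpa using hnn
      · have hh : (links g (endOf ω) (classOf ω) R).α (j, e) ≠ (j, e) := by
          intro h₃
          rw [show (links g (endOf ω) (classOf ω) R).α (j, e) = (j', e') from h₁] at h₃
          exact hjj (congrArg Prod.fst h₃).symm
        have hs : (links g (endOf ω) (classOf ω) R).Sat ph (j, e) ∨
            (links g (endOf ω) (classOf ω) R).Joinable (j, e) := by
          by_contra hcon
          push Not at hcon
          exact h₂ (Links.levelMax_of_not_sat (fun h => (lev h).2) hB hh hcon.1 hcon.2)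
        obtain ⟨β, hβ⟩ := Links.exists_lead_eq hB hh hs
        rw [show (links g (endOf ω) (classOf ω) R).α (j, e) = (j', e') from h₁] at hβ
        simp only at hβ
        rw [ev_fair]
        have h₀ : ∀ (p : Prop) [Decidable p], (0 : ℝ) ≤ if p then 1 else 0 := by
          intro p _; split_ifs <;> norm_num
        cases β
        · rw [if_pos hβ]
          linarith [h₀ (((links g (endOf ω) (classOf ω) R).lead (Links.shift true ph) j).1
            = ((links g (endOf ω) (classOf ω) R).lead (Links.shift true ph) j').1)]
        · rw [if_pos hβ]
          linarith [h₀ (((links g (endOf ω) (classOf ω) R).lead (Links.shift false ph) j).1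
            = ((links g (endOf ω) (classOf ω) R).lead (Links.shift false ph) j').1)]
      · simpa using hnn
      · simpa using hnn
    · split_ifs <;> norm_num

theorem pairProb_le_quarter {g : Fin U → ℕ} {u u' : Fin U} (hu : g u = g u') {j j' : Fin n}
    (hjj : j ≠ j')
    (ω : Fin n → Draw U) (R : Fin U → (k : Fin n) → Fin (k + 1)) (ph : Fin n → Bool) :
    pairProb (links g (endOf ω) (classOf ω) R) (endOf ω) ph j j' u u'
      ≤ ∑ e, ∑ e', (if endOf ω (j, e) = u then 1 else 0)
        * (if endOf ω (j', e') = u' then 1 else 0) * (1 / 4) := by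
  refine (pairProb_le _ _ ph hjj fun e e' h₁ h₂ => ?_).trans ?_
  · show g _ = g _
    rw [h₁, h₂, hu]
  · refine Finset.sum_le_sum fun e _ => Finset.sum_le_sum fun e' _ =>
      mul_le_of_le_one_right (by split_ifs <;> norm_num) ?_
    rw [sub_le_self_iff]
    exact ev_nonneg fun β => by split_ifs <;> norm_num

variable {g : Fin U → ℕ} {x : Fin U → Fin n → ℝ} {P : Fin n → PMF (Fin U × Fin U)}
  (h : PairLaw g x P)
include h

theorem PairLaw.sum_ev_end (u : Fin U) (j : Fin n) :
    ∑ e, ev (P j) (fun q => if pairEnd q e = u then 1 else 0) = x u j := by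
  rw [Fintype.sum_bool, add_comm]
  exact h.ev_end_add u j

omit h in
theorem ev_endOf (x : Fin U → Fin n → ℝ) (P : Fin n → PMF (Fin U × Fin U)) (u : Fin U) (j : Fin n)
    (e : Bool) : ev (jobPMF x P j) (fun a => if drawEnd a e = u then 1 else 0)
      = ev (P j) fun q => if pairEnd q e = u then 1 else 0 :=
  ev_jobPMF_fst x P j fun q => if pairEnd q e = u then 1 else 0

theorem PairLaw.ev_marginal (u : Fin U) (j : Fin n) :
    ev (piPMF (jobPMF x P)) (fun ω => ∑ e, (if endOf ω (j, e) = u then 1 else 0) * (1 / 2))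
      = x u j / 2 := by
  rw [ev_sum]
  simp only [ev_mul_right]
  rw [← Finset.sum_mul, ← h.sum_ev_end u j]
  have : ∀ e, ev (piPMF (jobPMF x P)) (fun ω => if endOf ω (j, e) = u then 1 else 0)
      = ev (P j) fun q => if pairEnd q e = u then 1 else 0 := fun e => by
    rw [← ev_endOf x P]
    exact ev_piPMF_apply (jobPMF x P) j fun a => if drawEnd a e = u then 1 else 0
  simp only [this]
  ring

omit h in
theorem ev_two_ends (x : Fin U → Fin n → ℝ) (P : Fin n → PMF (Fin U × Fin U)) (u u' : Fin U)
    {j j' : Fin n} (hjj : j ≠ j') (e e' : Bool) :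
    ev (piPMF (jobPMF x P)) (fun ω => (if endOf ω (j, e) = u then 1 else 0)
        * if endOf ω (j', e') = u' then 1 else 0)
      = ev (P j) (fun q => if pairEnd q e = u then 1 else 0)
        * ev (P j') (fun q => if pairEnd q e' = u' then 1 else 0) := by
  rw [← ev_endOf x P, ← ev_endOf x P]
  exact ev_piPMF_pair (jobPMF x P) hjj (fun a => if drawEnd a e = u then 1 else 0)
    (fun a => if drawEnd a e' = u' then 1 else 0)

/-- The pairs of groups of different jobs are independent, and `x / 2` is the original mass. -/
theorem PairLaw.ev_quarter (u u' : Fin U) {j j' : Fin n} (hjj : j ≠ j') :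
    ev (piPMF (jobPMF x P)) (fun ω => ∑ e, ∑ e', (if endOf ω (j, e) = u then 1 else 0)
        * (if endOf ω (j', e') = u' then 1 else 0) * (1 / 4)) = x u j / 2 * (x u' j' / 2) := by
  simp only [ev_sum, ev_mul_right, ev_two_ends x P u u' hjj]
  rw [← h.sum_ev_end u j, ← h.sum_ev_end u' j']
  simp only [Fintype.sum_bool]
  ring

/-- Averaging in the order levels, round robins, draws: the level estimate is uniform in the
matching, so it multiplies the probability of a link. -/
theorem PairLaw.ev_meetBound {u : Fin U} {j j' : Fin n} (hjj : j ≠ j')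
    (hd : ∑ v with g v = g u, x v j ≤ 1) (hd' : ∑ v with g v = g u, x v j' ≤ 1) :
    ev (piPMF (jobPMF x P)) (fun ω => ev (ringPMF n U) fun R => ev (levelPMF n) fun lev =>
        meetBound g u j j' ω R lev) ≤ (1 - 0.1561) * (x u j / 2 * (x u j' / 2)) := by
  classical
  have h₁ : ∀ ω, (ev (ringPMF n U) fun R => ev (levelPMF n) fun lev => meetBound g u j j' ω R lev)
      ≤ ∑ e, ∑ e', ((if endOf ω (j, e) = u then 1 else 0)
        * (if endOf ω (j', e') = u then 1 else 0) * (1 / 4)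
        - 1 / 8 * (1 - 0.143864) * ((if endOf ω (j, e) = u then 1 else 0)
          * (if endOf ω (j', e') = u then 1 else 0)
          * ev (ringPMF n U) fun R =>
            if partner g (endOf ω) (classOf ω) R (j, e) = (j', e') then 1 else 0)) := by
    intro ω
    unfold meetBound
    simp only [ev_sum]
    refine Finset.sum_le_sum fun e _ => Finset.sum_le_sum fun e' _ => ?_
    simp only [ev_mul_left, ev_sub, ev_const]
    set a : ℝ := (if endOf ω (j, e) = u then 1 else 0) * if endOf ω (j', e') = u then 1 else 0
      with ha
    have ha₀ : 0 ≤ a := by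
      rw [ha]
      refine mul_nonneg ?_ ?_ <;> split_ifs <;> norm_num
    have h₂ : (1 - 0.143864) * (ev (ringPMF n U) fun R =>
        if partner g (endOf ω) (classOf ω) R (j, e) = (j', e') then 1 else 0)
        ≤ ev (ringPMF n U) fun R =>
          (if partner g (endOf ω) (classOf ω) R (j, e) = (j', e') then 1 else 0)
          * (1 - ev (levelPMF n) fun lev =>
            if (links g (endOf ω) (classOf ω) R).LevelMax (fun h => (lev h : ℕ)) (j, e)
              then 1 else 0) := by
      rw [mul_comm, ← ev_mul_right]
      refine ev_mono fun R => mul_le_mul_of_nonneg_left ?_ (by split_ifs <;> norm_num)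
      linarith [ev_levelMax_le (links g (endOf ω) (classOf ω) R) (j, e)]
    nlinarith
  refine (ev_mono h₁).trans ?_
  simp only [ev_sum, ev_sub, ev_mul_right, ev_mul_left, ev_two_ends x P u u hjj]
  -- The numerical margin is `0.856136 * 0.3647 / 2 ≥ 0.1561`.
  have h₃ : ∀ e e', ev (P j) (fun q => if pairEnd q e = u then 1 else 0)
        * ev (P j') (fun q => if pairEnd q e' = u then 1 else 0) * (1 / 4)
      - 1 / 8 * (1 - 0.143864) * ev (piPMF (jobPMF x P)) (fun ω =>
          (if endOf ω (j, e) = u then 1 else 0) * (if endOf ω (j', e') = u then 1 else 0)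
          * ev (ringPMF n U) fun R =>
            if partner g (endOf ω) (classOf ω) R (j, e) = (j', e') then 1 else 0)
      ≤ ev (P j) (fun q => if pairEnd q e = u then 1 else 0)
        * ev (P j') (fun q => if pairEnd q e' = u then 1 else 0) * ((1 - 0.1561) / 4) := by
    intro e e'
    have h₄ := h.link_probability hjj hd hd' e e'
    have h₅ : 0 ≤ ev (P j) (fun q => if pairEnd q e = u then 1 else 0)
        * ev (P j') (fun q => if pairEnd q e' = u then 1 else 0) :=
      mul_nonneg (ev_nonneg fun q => by split_ifs <;> norm_num)
        (ev_nonneg fun q => by split_ifs <;> norm_num)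
    linarith
  refine (Finset.sum_le_sum fun e _ => Finset.sum_le_sum fun e' _ => h₃ e e').trans (le_of_eq ?_)
  rw [← h.sum_ev_end u j, ← h.sum_ev_end u j']
  simp only [Fintype.sum_bool]
  ring

end Correlations

/-! ## Writing programs -/

/-- The entry `(0, 0)` of an array, used as a variable. -/
def NatExpr.var (x : ℕ) : NatExpr := .read x (.lit 0) (.lit 0)

/-- Negation of a bit. -/
def NatExpr.neg (e : NatExpr) : NatExpr := .sub (.lit 1) e

/-- The number of groups. -/
def NatExpr.groups : NatExpr := .read 0 (.lit 1) (.lit 0)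

/-- The number of jobs. -/
def NatExpr.jobs : NatExpr := .read 0 (.lit 2) (.lit 0)

/-- Equality test. -/
def Test.natEq (e e' : NatExpr) : Test := .and (.not (.natLt e e')) (.not (.natLt e' e))

/-- Inequality test. -/
def Test.natNe (e e' : NatExpr) : Test := .not (.natEq e e')

/-- Disjunction. -/
def Test.or (b b' : Test) : Test := .not (.and (.not b) (.not b'))

/-- Equivalence. -/
def Test.iff (b b' : Test) : Test := .or (.and b b') (.and (.not b) (.not b'))

section Eval

variable (s : State)

@[simp] theorem NatExpr.eval_lit (k : ℕ) : (NatExpr.lit k).eval s = k := rfl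

@[simp] theorem NatExpr.eval_read (a : ℕ) (i j : NatExpr) :
    (NatExpr.read a i j).eval s = s.nat a (i.eval s) (j.eval s) := rfl

@[simp] theorem NatExpr.eval_add (e e' : NatExpr) :
    (NatExpr.add e e').eval s = e.eval s + e'.eval s := rfl

@[simp] theorem NatExpr.eval_sub (e e' : NatExpr) :
    (NatExpr.sub e e').eval s = e.eval s - e'.eval s := rfl

@[simp] theorem NatExpr.eval_var (x : ℕ) : (NatExpr.var x).eval s = s.nat x 0 0 := rfl

@[simp] theorem NatExpr.eval_neg (e : NatExpr) : (NatExpr.neg e).eval s = 1 - e.eval s := rfl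

@[simp] theorem NatExpr.eval_groups : NatExpr.groups.eval s = s.nat 0 1 0 := rfl

@[simp] theorem NatExpr.eval_jobs : NatExpr.jobs.eval s = s.nat 0 2 0 := rfl

@[simp] theorem RealExpr.eval_ofNat (e : NatExpr) :
    (RealExpr.ofNat e).eval s = (e.eval s : ℝ) := rfl

@[simp] theorem RealExpr.eval_read (a : ℕ) (i j : NatExpr) :
    (RealExpr.read a i j).eval s = s.real a (i.eval s) (j.eval s) := rfl

@[simp] theorem RealExpr.eval_add (e e' : RealExpr) :
    (RealExpr.add e e').eval s = e.eval s + e'.eval s := rfl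

@[simp] theorem RealExpr.eval_sub (e e' : RealExpr) :
    (RealExpr.sub e e').eval s = e.eval s - e'.eval s := rfl

@[simp] theorem Test.holds_natLt (e e' : NatExpr) :
    (Test.natLt e e').Holds s ↔ e.eval s < e'.eval s := Iff.rfl

@[simp] theorem Test.holds_realLt (e e' : RealExpr) :
    (Test.realLt e e').Holds s ↔ e.eval s < e'.eval s := Iff.rfl

@[simp] theorem Test.holds_not (b : Test) : (Test.not b).Holds s ↔ ¬ b.Holds s := Iff.rfl

@[simp] theorem Test.holds_and (b b' : Test) :
    (Test.and b b').Holds s ↔ b.Holds s ∧ b'.Holds s := Iff.rfl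

@[simp] theorem Test.holds_natEq (e e' : NatExpr) :
    (Test.natEq e e').Holds s ↔ e.eval s = e'.eval s := by
  simp only [natEq, holds_and, holds_not, holds_natLt]; omega

@[simp] theorem Test.holds_natNe (e e' : NatExpr) :
    (Test.natNe e e').Holds s ↔ e.eval s ≠ e'.eval s := by
  simp only [natNe, holds_not, holds_natEq, ne_eq]

@[simp] theorem Test.holds_or (b b' : Test) :
    (Test.or b b').Holds s ↔ b.Holds s ∨ b'.Holds s := by
  simp only [or, holds_and, holds_not]; tauto

@[simp] theorem Test.holds_iff (b b' : Test) :
    (Test.iff b b').Holds s ↔ (b.Holds s ↔ b'.Holds s) := by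
  simp only [Test.iff, holds_or, holds_and, holds_not]; tauto

@[simp] theorem State.nat_setNat (a i j v b i' j' : ℕ) :
    (s.setNat a i j v).nat b i' j' = if b = a ∧ i' = i ∧ j' = j then v else s.nat b i' j' := rfl

@[simp] theorem State.real_setNat (a i j v : ℕ) : (s.setNat a i j v).real = s.real := rfl

@[simp] theorem State.nat_setReal (a i j : ℕ) (v : ℝ) : (s.setReal a i j v).nat = s.nat := rfl

open Classical in
@[simp] theorem State.real_setReal (a i j : ℕ) (v : ℝ) (b i' j' : ℕ) :
    (s.setReal a i j v).real b i' j' = if b = a ∧ i' = i ∧ j' = j then v else s.real b i' j' := rfl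

end Eval

attribute [simp] State.setNat_nat_ne

/-! ## Rules for counting loops -/

/-- A loop over an initial segment, with the counter in an array that the body respects. -/
theorem hoare_for {a : ℕ} {e : NatExpr} {c : Program} {s : State} {n : ℕ} (hn : e.eval s = n)
    (P : ℕ → State → Prop) (hP : ∀ k t v, P k t → P k (t.setNat a 0 0 v)) (h₀ : P 0 s)
    (h : ∀ k : Fin n, ∀ t, (Program.loop a e c).Frame s t → t.nat a 0 0 = k → P k t →
      Hoare c t (P (k + 1))) :
    Hoare (.loop a e c) s (P n) := by
  subst hn
  refine hoare_loop P h₀ fun k hk t hF ht => h ⟨k, hk⟩ _ ?_ (by simp) (hP _ _ _ ht)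
  obtain ⟨h₁, h₂⟩ := hF
  refine ⟨fun b hb => ?_, h₂⟩
  have hb' := hb
  simp only [Program.keepsNat, Bool.and_eq_true, bne_iff_ne] at hb'
  rw [State.setNat_nat_ne hb'.1, h₁ b hb]

/-- A loop over all half-edges. -/
theorem hoare_for_half {a b : ℕ} {e : NatExpr} {c : Program} {s : State} {n : ℕ} (hab : a ≠ b)
    (ha : c.keepsNat a = true) (hn : e.eval s = n) (P : ℕ → State → Prop)
    (hP : ∀ k t x v, x = a ∨ x = b → P k t → P k (t.setNat x 0 0 v)) (h₀ : P 0 s)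
    (h : ∀ (x : Fin n × Bool) (t : State), (Program.loop a e (.loop b (.lit 2) c)).Frame s t →
      t.nat a 0 0 = x.1 → t.nat b 0 0 = x.2.toNat → P (key x) t → Hoare c t (P (key x + 1))) :
    Hoare (.loop a e (.loop b (.lit 2) c)) s (P (2 * n)) := by
  refine hoare_for hn (fun k => P (2 * k)) (fun k t v => hP _ _ _ _ (Or.inl rfl)) h₀ ?_
  intro k t hF hk ht
  refine hoare_for (n := 2) rfl (fun q => P (2 * k + q)) (fun q t v => hP _ _ _ _ (Or.inr rfl)) ht ?_
  intro q t' hF' hq ht'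
  have key_eq : ∀ β : Bool, β.toNat = q → key ((k, β) : Fin n × Bool) = 2 * k + q := by
    intro β hβ
    simp [key, hβ]
  obtain ⟨β, hβ⟩ : ∃ β : Bool, β.toNat = q := by
    match q with
    | 0 => exact ⟨false, rfl⟩
    | 1 => exact ⟨true, rfl⟩
  have := h (k, β) t' ?_ ?_ (hq.trans hβ.symm) ?_
  · rwa [key_eq β hβ, add_assoc] at this
  · obtain ⟨h₁, h₂⟩ := hF
    obtain ⟨h₃, h₄⟩ := hF'
    refine ⟨fun x hx => ?_, fun x hx => ?_⟩
    · rw [h₃ x, h₁ x hx]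
      simp only [Program.keepsNat, Bool.and_eq_true] at hx ⊢
      exact hx.2
    · rw [h₄ x, h₂ x hx]
      exact hx
  · rw [hF'.1 a ?_, hk]
    simp only [Program.keepsNat, Bool.and_eq_true, bne_iff_ne]
    exact ⟨hab.symm, ha⟩
  · rwa [key_eq β hβ]

theorem Hoare.ite {b : Test} {c d : Program} {s : State} {Q : State → Prop}
    (hc : b.Holds s → Hoare c s Q) (hd : ¬ b.Holds s → Hoare d s Q) : Hoare (.ite b c d) s Q :=
  hoare_ite.2 ⟨hc, hd⟩

theorem toNat_eq_one_iff (b : Bool) : b.toNat = 1 ↔ b = true := by cases b <;> simp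

theorem toNat_eq_zero_iff (b : Bool) : b.toNat = 0 ↔ b = false := by cases b <;> simp

theorem toNat_inj {b b' : Bool} : b.toNat = b'.toNat ↔ b = b' := by cases b <;> cases b' <;> simp

theorem one_sub_toNat (b : Bool) : 1 - b.toNat = (!b).toNat := by cases b <;> rfl

theorem key_lt {n : ℕ} (h : Fin n × Bool) : key h < 2 * n := by
  obtain ⟨j, b⟩ := h
  have := j.2
  cases b <;> simp [key] <;> omega

/-- Two half-edges with the same entries are equal. -/
theorem half_eq_iff {n : ℕ} {h h' : Fin n × Bool} :
    ((h.1 : ℕ) = h'.1 ∧ h.2.toNat = h'.2.toNat) ↔ h = h' := by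
  rw [toNat_inj, Prod.ext_iff, Fin.ext_iff]

/-! ## The matching phase -/

section Matching

variable {n U : ℕ}

/-- The random choices are stored in the memory. -/
structure Drawn (s : State) (g : Fin U → ℕ) (E : Fin n × Bool → Fin U) (K : Fin n × Bool → Bool)
    (R : Fin U → (k : Fin n) → Fin (k + 1)) : Prop where
  jobs : s.nat 0 2 0 = n
  machine : ∀ u : Fin U, s.nat 1 u 0 = g u
  group : ∀ h : Fin n × Bool, s.nat 3 h.1 h.2.toNat = E h
  cls : ∀ h : Fin n × Bool, s.nat 4 h.1 h.2.toNat = (K h).toNat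
  ring : ∀ (u : Fin U) (k : Fin n), s.nat 5 u k = R u k

theorem Drawn.of_eq {s t : State} {g : Fin U → ℕ} {E : Fin n × Bool → Fin U}
    {K : Fin n × Bool → Bool} {R : Fin U → (k : Fin n) → Fin (k + 1)} (h : Drawn s g E K R)
    (h₀ : t.nat 0 = s.nat 0) (h₁ : t.nat 1 = s.nat 1) (h₃ : t.nat 3 = s.nat 3)
    (h₄ : t.nat 4 = s.nat 4) (h₅ : t.nat 5 = s.nat 5) : Drawn t g E K R := by
  obtain ⟨a, b, c, d, e⟩ := h
  refine ⟨?_, ?_, ?_, ?_, ?_⟩ <;> simpa only [h₀, h₁, h₃, h₄, h₅]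

/-- Tabulate the parities. -/
def parityProg : Program :=
  .loop 20 .jobs (.setNat 7 (.add (.var 20) (.lit 1)) (.lit 0) (.neg (.read 7 (.var 20) (.lit 0))))

/-- The machine has no division, so the parities needed for `oddPart` are tabulated by alternation.
-/
theorem hoare_parityProg {s : State} (hn : s.nat 0 2 0 = n) (h₀ : s.nat 7 0 0 = 0) :
    Hoare parityProg s fun t => ∀ k ≤ n, t.nat 7 k 0 = k % 2 := by
  refine hoare_for (e := .jobs) hn (fun m t => ∀ k ≤ m, t.nat 7 k 0 = k % 2) ?_ ?_ ?_
  · intro m t v h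
    simpa using h
  · intro k hk
    obtain rfl : k = 0 := by omega
    simpa using h₀
  · intro k t hF hk ht
    rw [hoare_setNat]
    intro i hi
    have h₁ := ht k le_rfl
    simp only [NatExpr.eval_add, NatExpr.eval_var, NatExpr.eval_lit, NatExpr.eval_neg,
      NatExpr.eval_read, State.nat_setNat, hk, h₁]
    split_ifs with h₂
    · omega
    · refine ht i ?_
      simp only [true_and, and_true] at h₂
      omega

/-- The group of a half-edge. -/
def NatExpr.groupOf (j e : NatExpr) : NatExpr := .read 3 j e

/-- The machine of a half-edge. -/
def NatExpr.machineOf (j e : NatExpr) : NatExpr := .read 1 (.groupOf j e) (.lit 0)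

/-- The groups of a job belong to different machines. -/
def Test.cross (j : NatExpr) : Test := .natNe (.machineOf j (.lit 0)) (.machineOf j (.lit 1))

/-- Count the half-edges at the groups and compute the ranks. -/
def rankProg : Program :=
  .loop 20 .jobs (.loop 21 (.lit 2) (.ite (.cross (.var 20))
    (.seq (.setNat 9 (.var 20) (.var 21)
        (.read 8 (.read 4 (.var 20) (.var 21)) (.groupOf (.var 20) (.var 21))))
      (.setNat 8 (.read 4 (.var 20) (.var 21)) (.groupOf (.var 20) (.var 21))
        (.add (.read 8 (.read 4 (.var 20) (.var 21)) (.groupOf (.var 20) (.var 21))) (.lit 1))))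
    .skip))

variable {g : Fin U → ℕ} {E : Fin n × Bool → Fin U} {K : Fin n × Bool → Bool}
  {R : Fin U → (k : Fin n) → Fin (k + 1)}

theorem Drawn.cross_iff {s : State} (hs : Drawn s g E K R) {j : NatExpr} {x : Fin n}
    (hj : j.eval s = x) : (Test.cross j).Holds s ↔ CrossJob g E x := by
  have h₀ := hs.group (x, false)
  have h₁ := hs.group (x, true)
  simp only [Bool.toNat_false, Bool.toNat_true] at h₀ h₁
  simp only [Test.cross, Test.holds_natNe, NatExpr.machineOf, NatExpr.groupOf, NatExpr.eval_read,
    NatExpr.eval_lit, hj, h₀, h₁, hs.machine, CrossJob, ne_eq]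

theorem card_filter_key_succ (S : Finset (Fin n × Bool)) (h : Fin n × Bool) :
    (S.filter fun x => key x < key h + 1).card
      = (S.filter fun x => key x < key h).card + if h ∈ S then 1 else 0 := by
  have hk : ∀ x : Fin n × Bool, key x < key h + 1 ↔ x = h ∨ key x < key h := fun x => by
    rw [Nat.lt_succ_iff_lt_or_eq, or_comm, key_injective.eq_iff]
  split_ifs with hS
  · rw [← Finset.card_insert_of_notMem (s := S.filter fun x => key x < key h) (a := h) (by simp)]
    congr 1
    ext x
    simp only [Finset.mem_filter, Finset.mem_insert, hk]
    constructor
    · rintro ⟨h₁, h₂ | h₂⟩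
      · exact Or.inl h₂
      · exact Or.inr ⟨h₁, h₂⟩
    · rintro (rfl | ⟨h₁, h₂⟩)
      · exact ⟨hS, Or.inl rfl⟩
      · exact ⟨h₁, Or.inr h₂⟩
  · rw [add_zero]
    congr 1
    refine Finset.filter_congr fun x hx => ?_
    rw [hk]
    exact ⟨fun h₁ => h₁.resolve_left (ne_of_mem_of_not_mem hx hS), Or.inr⟩

/-- The half-edges are scanned in the order of `key`, so the counter of a class at a group shows the
rank of a half-edge at the moment it is scanned. -/
theorem hoare_rankProg {s : State} (hs : Drawn s g E K R)
    (h₀ : ∀ (c : Bool) (u : Fin U), s.nat 8 c.toNat u = 0) :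
    Hoare rankProg s fun t =>
      (∀ (c : Bool) (u : Fin U), t.nat 8 c.toNat u = (elig g E K c u).card) ∧
      ∀ h : Fin n × Bool, CrossJob g E h.1 → t.nat 9 h.1 h.2.toNat = rank g E K h := by
  have := hoare_for_half (a := 20) (b := 21) (s := s) (e := .jobs) (by decide) rfl hs.jobs (fun p t =>
      (∀ (c : Bool) (u : Fin U), t.nat 8 c.toNat u
        = ((elig g E K c u).filter fun x => key x < p).card) ∧
      ∀ h : Fin n × Bool, key h < p → CrossJob g E h.1 →
        t.nat 9 h.1 h.2.toNat = rank g E K h) ?_ ?_ (c := .ite (.cross (.var 20))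
    (.seq (.setNat 9 (.var 20) (.var 21)
        (.read 8 (.read 4 (.var 20) (.var 21)) (.groupOf (.var 20) (.var 21))))
      (.setNat 8 (.read 4 (.var 20) (.var 21)) (.groupOf (.var 20) (.var 21))
        (.add (.read 8 (.read 4 (.var 20) (.var 21)) (.groupOf (.var 20) (.var 21))) (.lit 1))))
    .skip) ?_
  · refine Hoare.mono this fun t ht => ⟨fun c u => ?_, fun h => ht.2 h (key_lt h)⟩
    rw [ht.1, Finset.filter_true_of_mem fun x _ => key_lt x]
  · rintro k t x v (rfl | rfl) h <;> simpa using h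
  · exact ⟨fun c u => by simp [h₀], fun h hh => by omega⟩
  · rintro h t hF h₁ h₂ ⟨h₃, h₄⟩
    have ht : Drawn t g E K R := hs.of_eq (hF.1 0 rfl) (hF.1 1 rfl) (hF.1 3 rfl) (hF.1 4 rfl)
      (hF.1 5 rfl)
    refine Hoare.ite (fun hc => ?_) fun hc => ?_
    · rw [ht.cross_iff (j := .var 20) (x := h.1) h₁] at hc
      simp only [hoare_seq, hoare_setNat, NatExpr.eval_var, NatExpr.eval_read, NatExpr.groupOf,
        NatExpr.eval_add, NatExpr.eval_lit, h₁, h₂, State.nat_setNat]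
      simp only [Nat.reduceEqDiff, false_and, if_false, true_and, ht.cls, ht.group, h₃]
      refine ⟨fun c u => ?_, fun x hx hcx => ?_⟩
      · rw [card_filter_key_succ]
        have : h ∈ elig g E K c u ↔ c.toNat = (K h).toNat ∧ (u : ℕ) = E h := by
          rw [mem_elig, toNat_inj, ← Fin.ext_iff]
          tauto
        simp only [this]
        split_ifs with h₅
        · obtain ⟨h₅, h₆⟩ := h₅
          rw [toNat_inj] at h₅
          rw [← Fin.ext_iff] at h₆
          rw [h₅, h₆]
        · rfl
      · by_cases hxh : x = h
        · subst hxh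
          simp [rank]
        · have h₅ : ¬ ((x.1 : ℕ) = h.1 ∧ x.2.toNat = h.2.toNat) := fun h₅ =>
            hxh (half_eq_iff.1 h₅)
          rw [if_neg h₅]
          refine h₄ x ?_ hcx
          have : key x ≠ key h := fun e => hxh (key_injective e)
          omega
    · rw [ht.cross_iff (j := .var 20) (x := h.1) h₁] at hc
      rw [hoare_skip]
      refine ⟨fun c u => ?_, fun x hx hcx => h₄ x ?_ hcx⟩
      · rw [card_filter_key_succ, if_neg fun hm => hc (mem_elig.1 hm).1, add_zero, h₃]
      · have : key x ≠ key h := fun e => hc (key_injective e ▸ hcx)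
        omega

/-- The number of half-edges of class `c` at the group of a half-edge. -/
def NatExpr.count (c : ℕ) (j e : NatExpr) : NatExpr := .read 8 (.lit c) (.groupOf j e)

/-- The odd part of the number of half-edges of the first class. -/
def NatExpr.oddCount (j e : NatExpr) : NatExpr :=
  .sub (.add (.count 1 j e) (.read 7 (.count 1 j e) (.lit 0))) (.lit 1)

/-- The random number below `m` of the group of a half-edge. -/
def NatExpr.ringOf (j e m : NatExpr) : NatExpr := .read 5 (.groupOf j e) (.sub m (.lit 1))

/-- Test for a meeting in a round robin. -/
def Test.robin (m r a b : NatExpr) : Test :=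
  .or (.and (.natLt a m) (.and (.natLt b m) (.or (.natEq (.add a b) r) (.natEq (.add a b) (.add r m)))))
    (.or (.and (.natEq a m) (.or (.natEq (.add b b) r) (.natEq (.add b b) (.add r m))))
      (.and (.natEq b m) (.or (.natEq (.add a a) r) (.natEq (.add a a) (.add r m)))))

theorem Test.holds_robin (s : State) (m r a b : NatExpr) :
    (Test.robin m r a b).Holds s ↔ Robin (m.eval s) (r.eval s) (a.eval s) (b.eval s) := by
  simp only [robin, holds_or, holds_and, holds_natLt, holds_natEq, NatExpr.eval_add, Robin]

/-- Test for a link between two half-edges. -/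
def Test.linked (j e j' e' : NatExpr) : Test :=
  .and (.cross j) (.and (.cross j') (.and (.natNe j j')
    (.and (.natEq (.groupOf j e) (.groupOf j' e'))
    (.or (.and (.natEq (.read 4 j e) (.lit 1)) (.and (.natEq (.read 4 j' e') (.lit 1))
        (.robin (.oddCount j e) (.ringOf j e (.oddCount j e)) (.read 9 j e) (.read 9 j' e'))))
      (.or (.and (.natEq (.read 4 j e) (.lit 1)) (.and (.natEq (.read 4 j' e') (.lit 0))
          (.and (.natEq (.count 1 j e) (.lit 1))
            (.natEq (.read 9 j' e') (.ringOf j e (.count 0 j e))))))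
        (.and (.natEq (.read 4 j e) (.lit 0)) (.and (.natEq (.read 4 j' e') (.lit 1))
          (.and (.natEq (.count 1 j e) (.lit 1))
            (.natEq (.read 9 j e) (.ringOf j e (.count 0 j e)))))))))))

/-- The tables for the matching are stored in the memory. -/
structure Ranked (s : State) (g : Fin U → ℕ) (E : Fin n × Bool → Fin U) (K : Fin n × Bool → Bool) :
    Prop where
  parity : ∀ k ≤ n, s.nat 7 k 0 = k % 2
  count : ∀ (c : Bool) (u : Fin U), s.nat 8 c.toNat u = (elig g E K c u).card
  rank : ∀ h : Fin n × Bool, CrossJob g E h.1 → s.nat 9 h.1 h.2.toNat = rank g E K h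

theorem Drawn.linked_iff {s : State} (hs : Drawn s g E K R) (hr : Ranked s g E K)
    {j e j' e' : NatExpr} {h h' : Fin n × Bool} (h₁ : j.eval s = h.1)
    (h₂ : e.eval s = h.2.toNat) (h₃ : j'.eval s = h'.1) (h₄ : e'.eval s = h'.2.toNat) :
    (Test.linked j e j' e').Holds s ↔ Linked g E K R h h' := by
  have c₁ := hr.count true (E h)
  have c₀ := hr.count false (E h)
  simp only [Bool.toNat_true, Bool.toNat_false] at c₁ c₀
  have le₁ : (elig g E K true (E h)).card ≤ n := card_elig_le true (E h)
  have le₀ : (elig g E K false (E h)).card ≤ n := card_elig_le false (E h)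
  have hn : 0 < n := h.1.pos
  -- All moduli are at most `n`, so the array agrees with `rv`; for `m = 0` both sides use the entry
  -- of index `0`.
  have rv_eq : ∀ m ≤ n, s.nat 5 (E h) (m - 1) = rv R (E h) m := fun m hm => by
    have : m - 1 < n := by omega
    rw [rv, dif_pos this]
    exact hs.ring (E h) ⟨m - 1, this⟩
  have odd_le : oddPart (elig g E K true (E h)).card ≤ n := by unfold oddPart; omega
  simp only [Test.linked, Test.holds_and, Test.holds_or, Test.holds_natEq, Test.holds_natNe,
    hs.cross_iff h₁, hs.cross_iff h₃, Test.holds_robin, NatExpr.groupOf, NatExpr.oddCount,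
    NatExpr.ringOf, NatExpr.count, NatExpr.eval_read, NatExpr.eval_sub, NatExpr.eval_add,
    NatExpr.eval_lit, h₁, h₂, h₃, h₄, hs.group, hs.cls, c₁, c₀, hr.parity _ le₁,
    toNat_eq_one_iff, toNat_eq_zero_iff, ← Fin.ext_iff, ne_eq]
  rw [rv_eq _ le₀, show (elig g E K true (E h)).card + (elig g E K true (E h)).card % 2 - 1
    = oddPart (elig g E K true (E h)).card from rfl, rv_eq _ odd_le]
  unfold Linked
  constructor
  · rintro ⟨hc, hc', hne, hE, hk⟩
    rw [hr.rank h hc, hr.rank h' hc'] at hk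
    exact ⟨hc, hc', fun e => hne (congrArg Prod.fst e), hE, hk⟩
  · rintro ⟨hc, hc', hne, hE, hk⟩
    rw [hr.rank h hc, hr.rank h' hc']
    -- The test compares jobs instead of half-edges. This is equivalent, since the two ends of a
    -- cross job lie at different groups.
    refine ⟨hc, hc', fun e => ?_, hE, hk⟩
    rcases eq_or_eq_fl e with e | e
    · exact hne e
    · obtain ⟨x, b⟩ := h'
      rw [e] at hE
      unfold CrossJob at hc'
      cases b
      · exact hc' (by rw [← show E (fl (x, false)) = E (x, true) from rfl, hE])
      · exact hc' (by rw [← show E (fl (x, true)) = E (x, false) from rfl, hE])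

/-- Search for the partner of a half-edge. -/
def searchProg : Program :=
  .loop 22 .jobs (.loop 23 (.lit 2) (.ite (.linked (.var 20) (.var 21) (.var 22) (.var 23))
    (.seq (.setNat 10 (.var 20) (.var 21) (.var 22)) (.setNat 11 (.var 20) (.var 21) (.var 23)))
    .skip))

/-- Compute the matching. -/
def partnerProg : Program :=
  .loop 20 .jobs (.loop 21 (.lit 2) (.seq (.setNat 10 (.var 20) (.var 21) (.var 20))
    (.seq (.setNat 11 (.var 20) (.var 21) (.var 21)) searchProg)))

theorem Ranked.of_eq {s t : State} (h : Ranked s g E K)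
    (h₇ : t.nat 7 = s.nat 7) (h₈ : t.nat 8 = s.nat 8) (h₉ : t.nat 9 = s.nat 9) :
    Ranked t g E K := by
  obtain ⟨a, b, c⟩ := h
  refine ⟨?_, ?_, ?_⟩ <;> simpa only [h₇, h₈, h₉]

/-- By uniqueness of the partner the initial entry, the half-edge itself, is overwritten at most
once. -/
theorem hoare_searchProg {s : State} (hs : Drawn s g E K R) (hr : Ranked s g E K)
    {h : Fin n × Bool} (h₁ : s.nat 20 0 0 = h.1) (h₂ : s.nat 21 0 0 = h.2.toNat)
    (h₃ : s.nat 10 h.1 h.2.toNat = h.1) (h₄ : s.nat 11 h.1 h.2.toNat = h.2.toNat) :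
    Hoare searchProg s fun t => t.nat 10 h.1 h.2.toNat = (partner g E K R h).1 ∧
      t.nat 11 h.1 h.2.toNat = (partner g E K R h).2.toNat ∧
      ∀ i j : ℕ, ¬ (i = (h.1 : ℕ) ∧ j = h.2.toNat) → t.nat 10 i j = s.nat 10 i j ∧
        t.nat 11 i j = s.nat 11 i j := by
  classical
  have := hoare_for_half (a := 22) (b := 23) (s := s) (e := .jobs) (by decide) rfl hs.jobs (fun p t =>
      (∃ x : Fin n × Bool, (x = if key (partner g E K R h) < p then partner g E K R h else h) ∧
        t.nat 10 h.1 h.2.toNat = x.1 ∧ t.nat 11 h.1 h.2.toNat = x.2.toNat) ∧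
      ∀ i j : ℕ, ¬ (i = (h.1 : ℕ) ∧ j = h.2.toNat) → t.nat 10 i j = s.nat 10 i j ∧
        t.nat 11 i j = s.nat 11 i j) ?_ ?_ (c := .ite
        (.linked (.var 20) (.var 21) (.var 22) (.var 23))
    (.seq (.setNat 10 (.var 20) (.var 21) (.var 22)) (.setNat 11 (.var 20) (.var 21) (.var 23)))
    .skip) ?_
  · refine Hoare.mono this fun t ht => ?_
    obtain ⟨⟨x, rfl, h₅, h₆⟩, h₇⟩ := ht
    rw [if_pos (key_lt _)] at h₅ h₆
    exact ⟨h₅, h₆, h₇⟩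
  · rintro k t x v (rfl | rfl) h <;> simpa using h
  · exact ⟨⟨h, by simp, h₃, h₄⟩, fun i j _ => ⟨rfl, rfl⟩⟩
  · rintro h' t hF h₅ h₆ ⟨⟨x, hx, h₇, h₈⟩, h₉⟩
    have ht : Drawn t g E K R := hs.of_eq (hF.1 0 rfl) (hF.1 1 rfl) (hF.1 3 rfl) (hF.1 4 rfl)
      (hF.1 5 rfl)
    have htr : Ranked t g E K := hr.of_eq (hF.1 7 rfl) (hF.1 8 rfl) (hF.1 9 rfl)
    have h₁' : t.nat 20 0 0 = h.1 := by rw [hF.1 20 rfl, h₁]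
    have h₂' : t.nat 21 0 0 = h.2.toNat := by rw [hF.1 21 rfl, h₂]
    have hiff := ht.linked_iff htr (j := .var 20) (e := .var 21) (j' := .var 22) (e' := .var 23)
      (h := h) (h' := h') h₁' h₂' h₅ h₆
    refine Hoare.ite (fun hc => ?_) fun hc => ?_
    · have hp := partner_eq (hiff.1 hc)
      simp only [hoare_seq, hoare_setNat, NatExpr.eval_var, State.nat_setNat]
      refine ⟨⟨h', by rw [hp, if_pos (by omega)], by simp [h₁', h₂', h₅], by simp [h₁', h₂', h₆]⟩,
        fun i j hij => ?_⟩
      simpa [h₁', h₂', hij] using h₉ i j hij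
    · have hp : key (partner g E K R h) < key h' + 1 ↔ key (partner g E K R h) < key h' ∨
          partner g E K R h = h' := by
        rw [Nat.lt_succ_iff_lt_or_eq, key_injective.eq_iff]
      rw [hoare_skip]
      refine ⟨⟨x, ?_, h₇, h₈⟩, h₉⟩
      rw [hx]
      by_cases hph : partner g E K R h = h'
      -- The test fails although `h'` is the value of `partner`: then `h` is unmatched and `h' = h`.
      · have hself : partner g E K R h = h := by
          by_contra hne
          have := linked_partner hne
          rw [hph] at this
          exact hc (hiff.2 this)
        rw [hself]
        simp
      · simp only [hp, hph, or_false]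

theorem hoare_partnerProg {s : State} (hs : Drawn s g E K R) (hr : Ranked s g E K) :
    Hoare partnerProg s fun t => ∀ h : Fin n × Bool,
      t.nat 10 h.1 h.2.toNat = (partner g E K R h).1 ∧
      t.nat 11 h.1 h.2.toNat = (partner g E K R h).2.toNat := by
  have := hoare_for_half (a := 20) (b := 21) (s := s) (e := .jobs) (by decide) rfl hs.jobs (fun p t =>
      ∀ h : Fin n × Bool, key h < p → t.nat 10 h.1 h.2.toNat = (partner g E K R h).1 ∧
      t.nat 11 h.1 h.2.toNat = (partner g E K R h).2.toNat) ?_ ?_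
      (c := .seq (.setNat 10 (.var 20) (.var 21) (.var 20))
    (.seq (.setNat 11 (.var 20) (.var 21) (.var 21)) searchProg)) ?_
  · exact Hoare.mono this fun t ht h => ht h (key_lt h)
  · rintro k t x v (rfl | rfl) h <;> simpa using h
  · intro h hh
    omega
  · intro h t hF h₁ h₂ ht
    have htd : Drawn t g E K R := hs.of_eq (hF.1 0 rfl) (hF.1 1 rfl) (hF.1 3 rfl) (hF.1 4 rfl)
      (hF.1 5 rfl)
    have htr : Ranked t g E K := hr.of_eq (hF.1 7 rfl) (hF.1 8 rfl) (hF.1 9 rfl)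
    simp only [hoare_seq, hoare_setNat, NatExpr.eval_var]
    refine Hoare.mono (hoare_searchProg (h := h) (htd.of_eq ?_ ?_ ?_ ?_ ?_)
      (htr.of_eq ?_ ?_ ?_) ?_ ?_ ?_ ?_) ?_
    all_goals try (simp [h₁, h₂]; done)
    rintro t' ⟨a₁, a₂, a₃⟩ x hx
    by_cases hxh : x = h
    · subst hxh
      exact ⟨a₁, a₂⟩
    · have h₅ : ¬ ((x.1 : ℕ) = h.1 ∧ x.2.toNat = h.2.toNat) := fun h₅ => hxh (half_eq_iff.1 h₅)
      obtain ⟨a₄, a₅⟩ := a₃ _ _ h₅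
      have hk : key x < key h := by
        have : key x ≠ key h := fun e => hxh (key_injective e)
        omega
      rw [a₄, a₅]
      simpa only [State.nat_setNat, Nat.reduceEqDiff, false_and, if_false, true_and, h₁, h₂, h₅]
        using ht x hk

end Matching

/-! ## Phases by union-find -/

namespace Links

theorem transGen_mono {α : Type*} {r p : α → α → Prop} {a b : α} (h : ∀ x y, r x y → p x y)
    (H : Relation.ReflTransGen r a b) : Relation.ReflTransGen p a b := by
  induction H with
  | refl => exact .refl
  | tail _ h₁ ih => exact ih.tail (h _ _ h₁)

variable {n : ℕ} {L : Links n}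

/-- The invariant of the union-find phase: `comp` are the labels of the components and `done` are
the half-edges that were treated. -/
structure UnionFind (L : Links n) (B : ℕ) (lev : Fin n × Bool → ℕ) (comp : Fin n → ℕ)
    (ph : Fin n → Bool) (done : Fin n × Bool → Prop) : Prop where
  comp_eq : ∀ h, done h → comp h.1 = comp (L.α h).1
  connected : ∀ x y, comp x = comp y → Relation.ReflTransGen
    (fun x y => ∃ g, L.α g ≠ g ∧ done g ∧ L.Sat ph g ∧ g.1 = x ∧ (L.α g).1 = y) x y
  bridged : ∀ h, done h → L.α h ≠ h → ¬ L.Sat ph h → Relation.ReflTransGen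
    (fun x y => ∃ g, L.α g ≠ g ∧ done g ∧ L.Sat ph g ∧ L.el B lev g ≤ L.el B lev h ∧ g.1 = x ∧
      (L.α g).1 = y) h.1 (L.α h).1

theorem el_α {B : ℕ} {lev : Fin n × Bool → ℕ} (h : Fin n × Bool) :
    L.el B lev (L.α h) = L.el B lev h := by
  unfold el
  rw [canon_α]
  by_cases h₁ : L.Joinable h
  · rw [if_pos h₁, if_pos (joinable_α.2 h₁)]
  · rw [if_neg h₁, if_neg (mt joinable_α.1 h₁)]

theorem UnionFind.congr {B : ℕ} {lev : Fin n × Bool → ℕ} {comp : Fin n → ℕ} {ph : Fin n → Bool}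
    {done done' : Fin n × Bool → Prop} (hu : UnionFind L B lev comp ph done)
    (h : ∀ g, done' g ↔ done g) : UnionFind L B lev comp ph done' := by
  obtain rfl : done' = done := funext fun g => propext (h g)
  exact hu

theorem UnionFind.init (B : ℕ) (lev : Fin n × Bool → ℕ) {comp : Fin n → ℕ}
    (hc : ∀ x y, comp x = comp y → x = y) (ph : Fin n → Bool) :
    UnionFind L B lev comp ph fun _ => False where
  comp_eq _ h := h.elim
  connected x y h := by rw [hc x y h]
  bridged _ h := h.elim

theorem UnionFind.final {B : ℕ} {lev : Fin n × Bool → ℕ} {comp : Fin n → ℕ} {ph : Fin n → Bool}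
    {done : Fin n × Bool → Prop} (hu : UnionFind L B lev comp ph done) (hd : ∀ h, done h) :
    L.Bridged B lev ph := by
  intro h hh hs
  refine transGen_mono ?_ (hu.bridged h (hd h) hh hs)
  rintro x y ⟨g, h₁, -, h₂, h₃, h₄, h₅⟩
  exact ⟨g, h₁, h₂, h₃, h₄, h₅⟩

/-- Both jobs are already connected by satisfied links treated earlier, hence of at most the present
level. If the new link is unsatisfied, these bridge it. -/
theorem UnionFind.skip {B : ℕ} {lev : Fin n × Bool → ℕ} {comp : Fin n → ℕ} {ph : Fin n → Bool}
    {done : Fin n × Bool → Prop} (hu : UnionFind L B lev comp ph done) {h : Fin n × Bool}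
    (hlev : ∀ g, done g → L.el B lev g ≤ L.el B lev h) (hc : comp h.1 = comp (L.α h).1) :
    UnionFind L B lev comp ph fun g => done g ∨ g = h ∨ g = L.α h where
  comp_eq := by
    rintro g (hg | rfl | rfl)
    · exact hu.comp_eq g hg
    · exact hc
    · rw [L.inv]; exact hc.symm
  connected x y hxy := by
    refine transGen_mono ?_ (hu.connected x y hxy)
    rintro x y ⟨g, h₁, h₂, h₃⟩
    exact ⟨g, h₁, Or.inl h₂, h₃⟩
  bridged := by
    have key : ∀ g, L.el B lev g = L.el B lev h → comp g.1 = comp (L.α g).1 →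
        Relation.ReflTransGen (fun x y => ∃ g', L.α g' ≠ g' ∧ (done g' ∨ g' = h ∨ g' = L.α h) ∧
          L.Sat ph g' ∧ L.el B lev g' ≤ L.el B lev g ∧ g'.1 = x ∧ (L.α g').1 = y)
          g.1 (L.α g).1 := by
      intro g hg hcg
      refine transGen_mono ?_ (hu.connected _ _ hcg)
      rintro x y ⟨g', h₁, h₂, h₃, h₄⟩
      exact ⟨g', h₁, Or.inl h₂, h₃, hg ▸ hlev g' h₂, h₄⟩
    rintro g (hg | rfl | rfl) hne hs
    · refine transGen_mono ?_ (hu.bridged g hg hne hs)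
      rintro x y ⟨g', h₁, h₂, h₃⟩
      exact ⟨g', h₁, Or.inl h₂, h₃⟩
    · exact key _ rfl hc
    · exact key _ (el_α h) (by rw [L.inv]; exact hc.symm)

/-- Two components are united by the new link, which is made satisfied by reversing, if necessary,
all phases of one of them. -/
theorem UnionFind.merge {B : ℕ} {lev : Fin n × Bool → ℕ} {comp comp' : Fin n → ℕ}
    {ph ph' : Fin n → Bool}
    {done : Fin n × Bool → Prop} (hu : UnionFind L B lev comp ph done) {h : Fin n × Bool}
    (hh : L.α h ≠ h) (hc : comp h.1 ≠ comp (L.α h).1)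
    (hcomp : ∀ x, comp' x = if comp x = comp (L.α h).1 then comp h.1 else comp x)
    (hph : ∀ x, (comp x = comp (L.α h).1 ∧ ¬ L.Sat ph h → ph' x = !ph x) ∧
      (¬ (comp x = comp (L.α h).1 ∧ ¬ L.Sat ph h) → ph' x = ph x)) :
    UnionFind L B lev comp' ph' fun g => done g ∨ g = h ∨ g = L.α h := by
  -- A treated link lies inside one component, whose phases are all reversed or all kept.
  have sat_done : ∀ g, done g → (L.Sat ph' g ↔ L.Sat ph g) := by
    intro g hg
    have h₁ := hu.comp_eq g hg
    unfold Sat Act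
    by_cases hx : comp g.1 = comp (L.α h).1 ∧ ¬ L.Sat ph h
    · rw [(hph g.1).1 hx, (hph (L.α g).1).1 (by rwa [← h₁])]
      cases ph g.1 <;> cases ph (L.α g).1 <;> cases g.2 <;> cases (L.α g).2 <;> simp
    · rw [(hph g.1).2 hx, (hph (L.α g).1).2 (by rwa [← h₁])]
  have sat_h : L.Sat ph' h := by
    have e₁ : ph' h.1 = ph h.1 := (hph h.1).2 fun hx => hc hx.1
    by_cases hs : L.Sat ph h
    · unfold Sat Act at hs ⊢
      rw [e₁, (hph (L.α h).1).2 fun hx => hx.2 hs]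
      exact hs
    · have e₂ := (hph (L.α h).1).1 ⟨rfl, hs⟩
      unfold Sat Act at hs ⊢
      rw [e₁, e₂]
      revert hs
      cases ph h.1 <;> cases ph (L.α h).1 <;> cases h.2 <;> cases (L.α h).2 <;> simp
  have sat_αh : L.Sat ph' (L.α h) := L.sat_α.2 sat_h
  have conn : ∀ x y, comp x = comp y → Relation.ReflTransGen
      (fun x y => ∃ g, L.α g ≠ g ∧ (done g ∨ g = h ∨ g = L.α h) ∧ L.Sat ph' g ∧ g.1 = x ∧
        (L.α g).1 = y) x y := by
    intro x y hxy
    refine transGen_mono ?_ (hu.connected x y hxy)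
    rintro x y ⟨g, h₁, h₂, h₃, h₄⟩
    exact ⟨g, h₁, Or.inl h₂, (sat_done g h₂).2 h₃, h₄⟩
  refine ⟨?_, ?_, ?_⟩
  · rintro g (hg | rfl | rfl)
    · rw [hcomp, hcomp, hu.comp_eq g hg]
    · rw [hcomp, hcomp, if_pos rfl, if_neg hc]
    · rw [hcomp, hcomp, if_pos rfl, L.inv, if_neg hc]
  · intro x y hxy
    rw [hcomp, hcomp] at hxy
    split_ifs at hxy with h₁ h₂ h₂
    · exact conn x y (h₁.trans h₂.symm)
    · exact (conn x _ h₁).trans (Relation.ReflTransGen.head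
        ⟨L.α h, α_ne_iff.2 hh, Or.inr (Or.inr rfl), sat_αh, rfl, by rw [L.inv]⟩ (conn _ y hxy))
    · exact (conn x _ hxy).trans (Relation.ReflTransGen.head
        ⟨h, hh, Or.inr (Or.inl rfl), sat_h, rfl, rfl⟩ (conn _ y h₂.symm))
    · exact conn x y hxy
  · rintro g (hg | rfl | rfl) hne hs
    · refine transGen_mono ?_
        (hu.bridged g hg hne fun h₁ => hs ((sat_done g hg).2 h₁))
      rintro x y ⟨g', h₁, h₂, h₃, h₄⟩
      exact ⟨g', h₁, Or.inl h₂, (sat_done g' h₂).2 h₃, h₄⟩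
    · exact absurd sat_h hs
    · exact absurd sat_αh hs

end Links

/-! ## Tests on the matching -/

section MatchingTests

variable {n : ℕ}

/-- The matching is stored in the memory. -/
structure Matched (s : State) (L : Links n) : Prop where
  jobs : s.nat 0 2 0 = n
  mach : ∀ h : Fin n × Bool, s.nat 1 (s.nat 3 h.1 h.2.toNat) 0 = L.mach h
  fst : ∀ h : Fin n × Bool, s.nat 10 h.1 h.2.toNat = (L.α h).1
  snd : ∀ h : Fin n × Bool, s.nat 11 h.1 h.2.toNat = (L.α h).2.toNat

theorem Matched.of_eq {s t : State} {L : Links n} (h : Matched s L) (h₀ : t.nat 0 = s.nat 0)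
    (h₁ : t.nat 1 = s.nat 1) (h₃ : t.nat 3 = s.nat 3) (h₁₀ : t.nat 10 = s.nat 10)
    (h₁₁ : t.nat 11 = s.nat 11) : Matched t L := by
  obtain ⟨a, b, c, d⟩ := h
  refine ⟨?_, ?_, ?_, ?_⟩ <;> simpa only [h₀, h₁, h₃, h₁₀, h₁₁]

/-- The two expressions denote a half-edge. -/
def Denotes (s : State) (j e : NatExpr) (h : Fin n × Bool) : Prop :=
  j.eval s = h.1 ∧ e.eval s = h.2.toNat

theorem Denotes.neg {s : State} {j e : NatExpr} {h : Fin n × Bool} (hd : Denotes s j e h) :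
    Denotes s j e.neg (fl h) :=
  ⟨hd.1, by rw [NatExpr.eval_neg, hd.2, one_sub_toNat]; rfl⟩

/-- The job of the partner. -/
def NatExpr.partnerJob (j e : NatExpr) : NatExpr := .read 10 j e

/-- The end of the partner. -/
def NatExpr.partnerEnd (j e : NatExpr) : NatExpr := .read 11 j e

variable {s : State} {L : Links n} {j e : NatExpr} {h : Fin n × Bool}

theorem Matched.denotes_partner (hs : Matched s L) (hd : Denotes s j e h) :
    Denotes s (.partnerJob j e) (.partnerEnd j e) (L.α h) := by
  constructor
  · rw [NatExpr.partnerJob, NatExpr.eval_read, hd.1, hd.2, hs.fst]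
  · rw [NatExpr.partnerEnd, NatExpr.eval_read, hd.1, hd.2, hs.snd]

theorem Matched.eval_machineOf (hs : Matched s L) (hd : Denotes s j e h) :
    (NatExpr.machineOf j e).eval s = L.mach h := by
  simp only [NatExpr.machineOf, NatExpr.groupOf, NatExpr.eval_read, NatExpr.eval_lit, hd.1, hd.2,
    hs.mach]

theorem Matched.partnerJob_ne_iff (hs : Matched s L) (hd : Denotes s j e h) :
    (Test.natNe (.partnerJob j e) j).Holds s ↔ L.α h ≠ h := by
  rw [Test.holds_natNe, (hs.denotes_partner hd).1, hd.1, ne_eq, ← Fin.ext_iff]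
  exact ⟨fun h₁ h₂ => h₁ (congrArg Prod.fst h₂), Links.job_ne⟩

/-- Test for validity of a half-edge. -/
def Test.valid (j e : NatExpr) : Test :=
  .and (.natNe (.partnerJob j e) j) (.and (.natNe (.partnerJob j e.neg) j)
    (.and (.natNe (.machineOf (.partnerJob j e) (.neg (.partnerEnd j e))) (.machineOf j e.neg))
      (.natNe (.machineOf j e)
        (.machineOf (.partnerJob j e.neg) (.neg (.partnerEnd j e.neg))))))

theorem Matched.valid_iff (hs : Matched s L) (hd : Denotes s j e h) :
    (Test.valid j e).Holds s ↔ L.Valid h := by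
  have h₁ := hs.partnerJob_ne_iff hd
  have h₂ := hs.partnerJob_ne_iff hd.neg
  simp only [Test.valid, Test.holds_and, h₁, h₂, Links.Valid]
  rw [Test.holds_natNe, Test.holds_natNe, hs.eval_machineOf hd, hs.eval_machineOf hd.neg,
    hs.eval_machineOf (hs.denotes_partner hd).neg, hs.eval_machineOf (hs.denotes_partner hd.neg).neg]

/-- Test for joinability of a link. -/
def Test.joinable (j e : NatExpr) : Test :=
  .or (.valid j e) (.valid (.partnerJob j e) (.partnerEnd j e))

theorem Matched.joinable_iff (hs : Matched s L) (hd : Denotes s j e h) :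
    (Test.joinable j e).Holds s ↔ L.Joinable h := by
  rw [Test.joinable, Test.holds_or, hs.valid_iff hd, hs.valid_iff (hs.denotes_partner hd)]
  rfl

/-- Test for the level of a link. -/
def Test.level (B : ℕ) (b j e : NatExpr) : Test :=
  .or (.and (.joinable j e) (.natEq b (.lit B))) (.and (.not (.joinable j e))
    (.or (.and (.natLt j (.partnerJob j e)) (.natEq (.read 6 j e) b))
      (.and (.not (.natLt j (.partnerJob j e)))
        (.natEq (.read 6 (.partnerJob j e) (.partnerEnd j e)) b))))

theorem Matched.level_iff (hs : Matched s L) (hd : Denotes s j e h) {lev : Fin n × Bool → ℕ}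
    (hl : ∀ h : Fin n × Bool, s.nat 6 h.1 h.2.toNat = lev h) {B : ℕ} {b : NatExpr} :
    (Test.level B b j e).Holds s ↔ L.el B lev h = b.eval s := by
  have hp := hs.denotes_partner hd
  simp only [Test.level, Test.holds_or, Test.holds_and, Test.holds_not, hs.joinable_iff hd,
    Test.holds_natEq, Test.holds_natLt, NatExpr.eval_read, NatExpr.eval_lit, hp.1, hp.2, hd.1, hd.2,
    hl, Links.el, Links.canon, Fin.val_fin_lt]
  by_cases h₁ : L.Joinable h
  · simp [h₁, eq_comm]
  · by_cases h₂ : h.1 < (L.α h).1 <;> simp [h₁, h₂]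

/-- The phases are stored in the memory. -/
def Phased (s : State) (ph : Fin n → Bool) : Prop := ∀ x : Fin n, s.nat 13 x 0 = (ph x).toNat

/-- Test whether a half-edge is selected. -/
def Test.act (j e : NatExpr) : Test := .natEq (.read 13 j (.lit 0)) e

theorem Phased.act_iff {ph : Fin n → Bool} (hp : Phased s ph) (hd : Denotes s j e h) :
    (Test.act j e).Holds s ↔ Links.Act ph h := by
  rw [Test.act, Test.holds_natEq, NatExpr.eval_read, hd.1, hd.2, NatExpr.eval_lit, hp, toNat_inj]
  rfl

/-- Test whether a link is satisfied. -/
def Test.sat (j e : NatExpr) : Test :=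
  .iff (.act j e) (.act (.partnerJob j e) (.partnerEnd j e))

theorem Matched.sat_iff (hs : Matched s L) {ph : Fin n → Bool} (hp : Phased s ph)
    (hd : Denotes s j e h) : (Test.sat j e).Holds s ↔ L.Sat ph h := by
  rw [Test.sat, Test.holds_iff, hp.act_iff hd, hp.act_iff (hs.denotes_partner hd)]
  rfl

/-! ## The union-find program -/

/-- Initialize the components and the phases. -/
def initProg : Program :=
  .loop 20 .jobs (.seq (.setNat 12 (.var 20) (.lit 0) (.var 20))
    (.setNat 13 (.var 20) (.lit 0) (.lit 0)))

theorem hoare_initProg {s : State} (hn : s.nat 0 2 0 = n) :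
    Hoare initProg s fun t => (∀ x : Fin n, t.nat 12 x 0 = x) ∧
      Phased t (fun _ : Fin n => false) := by
  have := hoare_for (a := 20) (s := s) (e := .jobs) hn (fun k t =>
    ∀ x : Fin n, (x : ℕ) < k → t.nat 12 x 0 = x ∧ t.nat 13 x 0 = 0)
    (c := .seq (.setNat 12 (.var 20) (.lit 0) (.var 20))
      (.setNat 13 (.var 20) (.lit 0) (.lit 0))) ?_ ?_ ?_
  · exact Hoare.mono this fun t ht => ⟨fun x => (ht x x.2).1, fun x => (ht x x.2).2⟩
  · intro k t v h
    simpa using h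
  · intro x hx
    omega
  · intro k t hF hk ht
    simp only [hoare_seq, hoare_setNat, NatExpr.eval_var, NatExpr.eval_lit, State.nat_setNat,
      Nat.reduceEqDiff, false_and, if_false, true_and, and_true, hk]
    intro x hx
    rcases Nat.lt_succ_iff_lt_or_eq.1 hx with h₁ | h₁
    · rw [if_neg h₁.ne, if_neg h₁.ne]
      exact ht x h₁
    · rw [if_pos h₁, if_pos h₁, h₁]
      exact ⟨rfl, rfl⟩

/-- Relabel a component, and flip its phases if the entry `(2, 0)` of the array `14` is one. -/
def relabelProg : Program :=
  .loop 22 .jobs (.ite (.natEq (.read 12 (.var 22) (.lit 0)) (.read 14 (.lit 0) (.lit 0)))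
    (.seq (.setNat 12 (.var 22) (.lit 0) (.read 14 (.lit 1) (.lit 0)))
      (.ite (.natEq (.read 14 (.lit 2) (.lit 0)) (.lit 1))
        (.setNat 13 (.var 22) (.lit 0) (.neg (.read 13 (.var 22) (.lit 0)))) .skip)) .skip)

/-- The labels and the flag are read from a copy in array `14`, because the labels in array `12`
change during the loop. -/
theorem hoare_relabelProg {s : State} (hn : s.nat 0 2 0 = n) :
    Hoare relabelProg s fun t => ∀ x : Fin n,
      t.nat 12 x 0 = (if s.nat 12 x 0 = s.nat 14 0 0 then s.nat 14 1 0 else s.nat 12 x 0) ∧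
      t.nat 13 x 0 = if s.nat 12 x 0 = s.nat 14 0 0 ∧ s.nat 14 2 0 = 1 then 1 - s.nat 13 x 0
        else s.nat 13 x 0 := by
  have := hoare_for (a := 22) (s := s) (e := .jobs) hn (fun k t =>
    ∀ x : Fin n, ((x : ℕ) < k →
      t.nat 12 x 0 = (if s.nat 12 x 0 = s.nat 14 0 0 then s.nat 14 1 0 else s.nat 12 x 0) ∧
      t.nat 13 x 0 = if s.nat 12 x 0 = s.nat 14 0 0 ∧ s.nat 14 2 0 = 1 then 1 - s.nat 13 x 0
        else s.nat 13 x 0) ∧ (k ≤ (x : ℕ) → t.nat 12 x 0 = s.nat 12 x 0 ∧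
          t.nat 13 x 0 = s.nat 13 x 0))
    (c := .ite (.natEq (.read 12 (.var 22) (.lit 0)) (.read 14 (.lit 0) (.lit 0)))
    (.seq (.setNat 12 (.var 22) (.lit 0) (.read 14 (.lit 1) (.lit 0)))
      (.ite (.natEq (.read 14 (.lit 2) (.lit 0)) (.lit 1))
        (.setNat 13 (.var 22) (.lit 0) (.neg (.read 13 (.var 22) (.lit 0)))) .skip)) .skip) ?_ ?_ ?_
  · exact Hoare.mono this fun t ht x => (ht x).1 x.2
  · intro k t v h
    simpa using h
  · exact fun x => ⟨fun hx => by omega, fun _ => ⟨rfl, rfl⟩⟩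
  · intro k t hF hk ht
    have h14 : t.nat 14 = s.nat 14 := hF.1 14 rfl
    have hk12 := ((ht k).2 le_rfl).1
    have hk13 := ((ht k).2 le_rfl).2
    have other : ∀ t' : State, (∀ x : Fin n, x ≠ k → t'.nat 12 x 0 = t.nat 12 x 0 ∧
        t'.nat 13 x 0 = t.nat 13 x 0) →
        (t'.nat 12 k 0 = (if s.nat 12 k 0 = s.nat 14 0 0 then s.nat 14 1 0 else s.nat 12 k 0) ∧
        t'.nat 13 k 0 = if s.nat 12 k 0 = s.nat 14 0 0 ∧ s.nat 14 2 0 = 1 then 1 - s.nat 13 k 0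
          else s.nat 13 k 0) →
        ∀ x : Fin n, ((x : ℕ) < k + 1 →
        t'.nat 12 x 0 = (if s.nat 12 x 0 = s.nat 14 0 0 then s.nat 14 1 0 else s.nat 12 x 0) ∧
        t'.nat 13 x 0 = if s.nat 12 x 0 = s.nat 14 0 0 ∧ s.nat 14 2 0 = 1 then 1 - s.nat 13 x 0
          else s.nat 13 x 0) ∧ ((k : ℕ) + 1 ≤ (x : ℕ) → t'.nat 12 x 0 = s.nat 12 x 0 ∧
            t'.nat 13 x 0 = s.nat 13 x 0) := by
      intro t' h₁ h₂ x
      by_cases hx : x = k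
      · subst hx
        exact ⟨fun _ => h₂, fun h₃ => by omega⟩
      · have hx' : (x : ℕ) ≠ k := fun h₃ => hx (Fin.ext h₃)
        rw [(h₁ x hx).1, (h₁ x hx).2]
        exact ⟨fun h₃ => (ht x).1 (by omega), fun h₃ => (ht x).2 (by omega)⟩
    have vk : ∀ x : Fin n, x ≠ k → ¬ (x : ℕ) = k := fun x hx h₃ => hx (Fin.ext h₃)
    refine Hoare.ite (fun hc => ?_) fun hc => ?_
    · simp only [Test.holds_natEq, NatExpr.eval_read, NatExpr.eval_var, NatExpr.eval_lit, hk, hk12,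
        h14] at hc
      rw [hoare_seq, hoare_setNat]
      refine Hoare.ite (fun hf => ?_) fun hf => ?_
      · simp only [Test.holds_natEq, NatExpr.eval_read, NatExpr.eval_lit, State.nat_setNat,
          Nat.reduceEqDiff, false_and, if_false, h14] at hf
        rw [hoare_setNat]
        refine other _ (fun x hx => ?_) ?_
        · simp [hk, vk x hx]
        · simp [hk, hc, hf, h14, hk13]
      · simp only [Test.holds_natEq, NatExpr.eval_read, NatExpr.eval_lit, State.nat_setNat,
          Nat.reduceEqDiff, false_and, if_false, h14] at hf
        rw [hoare_skip]
        refine other _ (fun x hx => ?_) ?_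
        · simp [hk, vk x hx]
        · simp [hk, hc, hf, h14, hk13]
    · simp only [Test.holds_natEq, NatExpr.eval_read, NatExpr.eval_var, NatExpr.eval_lit, hk, hk12,
        h14] at hc
      rw [hoare_skip]
      exact other _ (fun x hx => ⟨rfl, rfl⟩) (by simp [hc, hk12, hk13])

/-- Treat the link of a half-edge. -/
def uniteProg : Program :=
  .ite (.and (.level numLevels (.var 24) (.var 20) (.var 21))
    (.and (.natNe (.partnerJob (.var 20) (.var 21)) (.var 20))
      (.natNe (.read 12 (.var 20) (.lit 0))
        (.read 12 (.partnerJob (.var 20) (.var 21)) (.lit 0)))))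
    (.seq (.setNat 14 (.lit 0) (.lit 0) (.read 12 (.partnerJob (.var 20) (.var 21)) (.lit 0)))
      (.seq (.setNat 14 (.lit 1) (.lit 0) (.read 12 (.var 20) (.lit 0)))
        (.seq (.ite (.sat (.var 20) (.var 21)) (.setNat 14 (.lit 2) (.lit 0) (.lit 0))
          (.setNat 14 (.lit 2) (.lit 0) (.lit 1))) relabelProg)))
    .skip

/-- Treat all links in the order of their levels. -/
def unionProg : Program :=
  .loop 24 (.lit (numLevels + 1)) (.loop 20 .jobs (.loop 21 (.lit 2) uniteProg))

theorem hoare_uniteProg {s : State} {lev : Fin n × Bool → ℕ} (hs : Matched s L)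
    (hl : ∀ h : Fin n × Bool, s.nat 6 h.1 h.2.toNat = lev h) (hd : Denotes s (.var 20) (.var 21) h)
    {ph : Fin n → Bool} (hp : Phased s ph) {done : Fin n × Bool → Prop}
    (hu : L.UnionFind numLevels lev (fun x => s.nat 12 x 0) ph done)
    (hlev : ∀ g, done g → L.el numLevels lev g ≤ s.nat 24 0 0) :
    Hoare uniteProg s fun t => ∃ ph', Phased t ph' ∧
      L.UnionFind numLevels lev (fun x => t.nat 12 x 0) ph' fun g => done g ∨
        (L.el numLevels lev g = s.nat 24 0 0 ∧ (g = h ∨ g = L.α h)) := by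
  have hpart := hs.denotes_partner hd
  have e₁ : s.nat 20 0 0 = h.1 := hd.1
  have e₂ : s.nat 21 0 0 = h.2.toNat := hd.2
  have hel : (Test.level numLevels (.var 24) (.var 20) (.var 21)).Holds s
      ↔ L.el numLevels lev h = s.nat 24 0 0 := hs.level_iff hd hl
  have done_iff : L.el numLevels lev h = s.nat 24 0 0 → ∀ g, (done g ∨
        (L.el numLevels lev g = s.nat 24 0 0 ∧ (g = h ∨ g = L.α h)))
        ↔ done g ∨ g = h ∨ g = L.α h := by
    intro he g
    constructor
    · rintro (h₁ | h₁)
      · exact Or.inl h₁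
      · exact Or.inr h₁.2
    · rintro (h₁ | rfl | rfl)
      · exact Or.inl h₁
      · exact Or.inr ⟨he, Or.inl rfl⟩
      · exact Or.inr ⟨by rw [Links.el_α, he], Or.inr rfl⟩
  have comp₂ : (NatExpr.read 12 (.partnerJob (.var 20) (.var 21)) (.lit 0)).eval s
      = s.nat 12 (L.α h).1 0 := by
    rw [NatExpr.eval_read, hpart.1, NatExpr.eval_lit]
  have comp₁ : (NatExpr.read 12 (.var 20) (.lit 0)).eval s = s.nat 12 h.1 0 := by
    rw [NatExpr.eval_read, hd.1, NatExpr.eval_lit]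
  refine Hoare.ite (fun hc => ?_) fun hc => ?_
  · simp only [Test.holds_and, hel, hs.partnerJob_ne_iff hd] at hc
    rw [Test.holds_natNe, comp₁, comp₂] at hc
    obtain ⟨he, hne, hcomp⟩ := hc
    rw [hoare_seq, hoare_setNat, comp₂, hoare_seq, hoare_setNat, hoare_seq]
    have comp₁' : (NatExpr.read 12 (.var 20) (.lit 0)).eval
        (s.setNat 14 ((NatExpr.lit 0).eval s) ((NatExpr.lit 0).eval s) (s.nat 12 (L.α h).1 0))
        = s.nat 12 h.1 0 := by simp [e₁]
    rw [comp₁']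
    set s₂ := (s.setNat 14 ((NatExpr.lit 0).eval s) ((NatExpr.lit 0).eval s)
      (s.nat 12 (L.α h).1 0)).setNat 14 _ _ (s.nat 12 h.1 0) with hs₂
    have k₂ : ∀ b, b ≠ 14 → s₂.nat b = s.nat b := fun b hb => by
      rw [hs₂, State.setNat_nat_ne hb.symm, State.setNat_nat_ne hb.symm]
    have m₂ : Matched s₂ L := hs.of_eq (k₂ 0 (by decide)) (k₂ 1 (by decide)) (k₂ 3 (by decide))
      (k₂ 10 (by decide)) (k₂ 11 (by decide))
    have p₂ : Phased s₂ ph := fun x => by rw [k₂ 13 (by decide)]; exact hp x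
    have d₂ : Denotes s₂ (.var 20) (.var 21) h := by
      constructor
      · rw [NatExpr.eval_var, k₂ 20 (by decide)]; exact e₁
      · rw [NatExpr.eval_var, k₂ 21 (by decide)]; exact e₂
    have v₀ : s₂.nat 14 0 0 = s.nat 12 (L.α h).1 0 := by simp [hs₂]
    have v₁ : s₂.nat 14 1 0 = s.nat 12 h.1 0 := by simp [hs₂]
    have flag : Hoare (.ite (.sat (.var 20) (.var 21)) (.setNat 14 (.lit 2) (.lit 0) (.lit 0))
        (.setNat 14 (.lit 2) (.lit 0) (.lit 1))) s₂ fun t => (∀ b, b ≠ 14 → t.nat b = s.nat b) ∧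
          t.nat 14 0 0 = s.nat 12 (L.α h).1 0 ∧ t.nat 14 1 0 = s.nat 12 h.1 0 ∧
          (t.nat 14 2 0 = 1 ↔ ¬ L.Sat ph h) := by
      refine Hoare.ite (fun hf => ?_) fun hf => ?_ <;> rw [m₂.sat_iff p₂ d₂] at hf <;>
        rw [hoare_setNat] <;>
        refine ⟨fun b hb => by rw [State.setNat_nat_ne hb.symm, k₂ b hb], ?_, ?_, ?_⟩ <;>
        simp [v₀, v₁, hf]
    refine flag.mono ?_
    rintro t ⟨k, w₀, w₁, w₂⟩
    refine (hoare_relabelProg (n := n) (by rw [k 0 (by decide)]; exact hs.jobs)).mono ?_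
    intro t' ht'
    have c' : ∀ x : Fin n, t'.nat 12 x 0
        = if s.nat 12 x 0 = s.nat 12 (L.α h).1 0 then s.nat 12 h.1 0 else s.nat 12 x 0 := by
      intro x
      rw [(ht' x).1, w₀, w₁, k 12 (by decide)]
    classical
    refine ⟨fun x => if s.nat 12 x 0 = s.nat 12 (L.α h).1 0 ∧ ¬ L.Sat ph h then !ph x else ph x,
      fun x => ?_, ?_⟩
    · rw [(ht' x).2, w₀, k 12 (by decide), k 13 (by decide), hp x]
      simp only [w₂]
      split_ifs
      · exact one_sub_toNat _
      · rfl
    · refine (hu.merge hne hcomp c' fun x => ⟨fun h₁ => if_pos h₁, fun h₁ => if_neg h₁⟩).congr ?_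
      exact done_iff he
  · rw [hoare_skip]
    refine ⟨ph, hp, ?_⟩
    by_cases he : L.el numLevels lev h = s.nat 24 0 0
    · refine (hu.skip (h := h) (fun g hg => he ▸ hlev g hg) ?_).congr (done_iff he)
      by_cases hne : L.α h = h
      · rw [hne]
      · by_contra hcomp
        refine hc ?_
        simp only [Test.holds_and, hel, hs.partnerJob_ne_iff hd]
        rw [Test.holds_natNe, comp₁, comp₂]
        exact ⟨he, hne, hcomp⟩
    · refine hu.congr fun g => ⟨fun h₁ => h₁.resolve_right ?_, Or.inl⟩
      rintro ⟨h₂, rfl | rfl⟩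
      · exact he h₂
      · exact he (by rw [← Links.el_α, h₂])

/-- Kruskal's order: before the round `b` of the outer loop exactly the links of level below `b`
have been treated. -/
theorem hoare_unionProg {s : State} {lev : Fin n × Bool → ℕ} (hs : Matched s L)
    (hl : ∀ h : Fin n × Bool, s.nat 6 h.1 h.2.toNat = lev h) (hlt : ∀ h, lev h < numLevels)
    {ph : Fin n → Bool} (hp : Phased s ph) (hc : ∀ x : Fin n, s.nat 12 x 0 = x) :
    Hoare unionProg s fun t => ∃ ph', Phased t ph' ∧ L.Bridged numLevels lev ph' := by
  have el_le : ∀ h, L.el numLevels lev h ≤ numLevels := by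
    intro h
    unfold Links.el
    split_ifs
    · exact le_rfl
    · exact (hlt _).le
  -- The level `numLevels` belongs to the joinable links and requires one round more.
  have := hoare_for (a := 24) (s := s) (e := .lit (numLevels + 1)) (n := numLevels + 1) rfl
    (fun b t => ∃ ph', Phased t ph' ∧
      L.UnionFind numLevels lev (fun x => t.nat 12 x 0) ph' fun g => L.el numLevels lev g < b)
    (c := .loop 20 .jobs (.loop 21 (.lit 2) uniteProg)) ?_ ?_ ?_
  · refine Hoare.mono this ?_
    rintro t ⟨ph', h₁, h₂⟩
    exact ⟨ph', h₁, h₂.final fun h => Nat.lt_succ_of_le (el_le h)⟩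
  · rintro k t v ⟨ph', h₁, h₂⟩
    exact ⟨ph', by simpa [Phased] using h₁, by simpa using h₂⟩
  · refine ⟨ph, hp, (Links.UnionFind.init numLevels lev ?_ ph).congr fun g => by simp⟩
    intro x y hxy
    rw [hc, hc] at hxy
    exact Fin.ext hxy
  · rintro b t hF hb ⟨ph', h₁, h₂⟩
    have hj : t.nat 0 2 0 = n := by rw [hF.1 0 rfl]; exact hs.jobs
    -- A link counts as treated as soon as one of its two half-edges has been scanned.
    have := hoare_for_half (a := 20) (b := 21) (s := t) (e := .jobs) (by decide) rfl hj (fun p t =>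
      ∃ ph', Phased t ph' ∧ L.UnionFind numLevels lev (fun x => t.nat 12 x 0) ph' fun g =>
        L.el numLevels lev g < b ∨
          (L.el numLevels lev g = b ∧ (key g < p ∨ key (L.α g) < p))) (c := uniteProg) ?_ ?_ ?_
    · refine Hoare.mono this ?_
      rintro t' ⟨ph', h₃, h₄⟩
      refine ⟨ph', h₃, h₄.congr fun g => ?_⟩
      have := key_lt g
      rw [Nat.lt_succ_iff_lt_or_eq]
      tauto
    · rintro k t x v hx ⟨ph', h₁, h₂⟩
      refine ⟨ph', ?_, ?_⟩
      · rcases hx with rfl | rfl <;> simpa [Phased] using h₁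
      · rcases hx with rfl | rfl <;> simpa using h₂
    · exact ⟨ph', h₁, h₂.congr fun g => by simp⟩
    · rintro h t' hF' h₃ h₄ ⟨ph'', h₅, h₆⟩
      have e : ∀ a, Program.keepsNat a unionProg = true → t'.nat a = s.nat a := by
        intro a ha
        have ha' := ha
        rw [unionProg, Program.keepsNat, Bool.and_eq_true] at ha'
        rw [hF'.1 a ha'.2, hF.1 a ha]
      have hm : Matched t' L := hs.of_eq (e 0 rfl) (e 1 rfl) (e 3 rfl) (e 10 rfl) (e 11 rfl)
      have h24 : t'.nat 24 0 0 = b := by rw [hF'.1 24 rfl, hb]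
      refine (hoare_uniteProg (h := h) hm (lev := lev) (fun h => by rw [e 6 rfl]; exact hl h)
        ⟨h₃, h₄⟩ h₅ h₆ ?_).mono ?_
      · intro g hg
        rw [h24]
        omega
      · rintro t'' ⟨ph₃, h₇, h₈⟩
        refine ⟨ph₃, h₇, h₈.congr fun g => ?_⟩
        rw [h24]
        have k₁ : key g < key h + 1 ↔ key g < key h ∨ g = h := by
          rw [Nat.lt_succ_iff_lt_or_eq, key_injective.eq_iff]
        have k₂ : key (L.α g) < key h + 1 ↔ key (L.α g) < key h ∨ g = L.α h := by
          rw [Nat.lt_succ_iff_lt_or_eq, key_injective.eq_iff]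
          refine or_congr Iff.rfl ⟨fun h => by rw [← h, L.inv], fun h => by rw [h, L.inv]⟩
        rw [k₁, k₂]
        tauto

end MatchingTests

/-! ## Coins -/

/-- Store a random bit that is one with probability `p / q`. -/
def Program.bit (p q : RealExpr) (a : ℕ) (i j : NatExpr) : Program :=
  .flip p q (.setNat a i j (.lit 1)) (.setNat a i j (.lit 0))

theorem mix_bit (p q : RealExpr) (a : ℕ) (i j : NatExpr) (s : State) :
    Mix ((Program.bit p q a i j).exec s) (coin (p.eval s / q.eval s))
      fun b t => t = s.setNat a (i.eval s) (j.eval s) b.toNat := by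
  have := Mix.flip (p := p) (q := q) (s := s) (c := .setNat a i j (.lit 1))
    (d := .setNat a i j (.lit 0)) (G := PMF.pure)
    (Q := fun b t => t = s.setNat a (i.eval s) (j.eval s) b.toNat)
    (Mix.of_hoare (hoare_setNat.2 rfl)) (Mix.of_hoare (hoare_setNat.2 rfl))
  rwa [PMF.bind_pure] at this

/-- Flip a fair coin for every job. -/
def coinsProg : Program :=
  .loop 20 .jobs (.bit (.ofNat (.lit 1)) (.ofNat (.lit 2)) 16 (.var 20) (.lit 0))

theorem mix_coinsProg {n : ℕ} {s : State} (hn : s.nat 0 2 0 = n) :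
    Mix (coinsProg.exec s) (coinsPMF n) fun coins t => ∀ j : Fin n,
      t.nat 16 j 0 = (coins j).toNat := by
  refine Mix.loop_pi (fun _ => fair) (e := .jobs) hn (fun j b t => t.nat 16 j 0 = b.toNat) ?_
  intro k t _
  have := mix_bit (.ofNat (.lit 1)) (.ofNat (.lit 2)) 16 (.var 20) (.lit 0) (t.setNat 20 0 0 k)
  simp only [RealExpr.eval_ofNat, NatExpr.eval_lit, Nat.cast_one, Nat.cast_ofNat,
    NatExpr.eval_var, State.nat_setNat, and_self, if_true] at this
  refine this.mono ?_
  rintro b _ rfl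
  refine ⟨by simp, fun i hi b' h => ?_⟩
  have : ¬ (i : ℕ) = k := fun h' => hi.ne (Fin.ext h')
  simpa [this] using h

/-! ## The output phase -/

section Output

variable {n : ℕ} {L : Links n} {s : State} {j e : NatExpr} {h : Fin n × Bool}

/-- Flip all phases if the global coin shows one. -/
def shiftProg : Program :=
  .ite (.natEq (.var 15) (.lit 1))
    (.loop 20 .jobs (.setNat 13 (.var 20) (.lit 0) (.neg (.read 13 (.var 20) (.lit 0))))) .skip

theorem hoare_shiftProg (hn : s.nat 0 2 0 = n) {β : Bool} (hβ : s.nat 15 0 0 = β.toNat)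
    {ph : Fin n → Bool} (hp : Phased s ph) :
    Hoare shiftProg s fun t => Phased t (Links.shift β ph) := by
  have hb : (Test.natEq (.var 15) (.lit 1)).Holds s ↔ β = true := by
    rw [Test.holds_natEq, NatExpr.eval_var, NatExpr.eval_lit, hβ, toNat_eq_one_iff]
  refine Hoare.ite (fun hc => ?_) fun hc => ?_
  · obtain rfl := hb.1 hc
    have := hoare_for (a := 20) (s := s) (e := .jobs) hn (fun k t => ∀ x : Fin n,
      t.nat 13 x 0 = if (x : ℕ) < k then (!ph x).toNat else (ph x).toNat)
      (c := .setNat 13 (.var 20) (.lit 0) (.neg (.read 13 (.var 20) (.lit 0)))) ?_ ?_ ?_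
    · refine this.mono fun t ht x => ?_
      rw [ht x, if_pos x.2, Links.shift, Bool.true_xor]
    · intro k t v h
      simpa using h
    · intro x
      simpa using hp x
    · intro k t _ hk ht
      rw [hoare_setNat]
      intro x
      simp only [NatExpr.eval_var, NatExpr.eval_lit, NatExpr.eval_neg, NatExpr.eval_read, hk,
        State.nat_setNat, true_and, and_true, ← Fin.ext_iff, ht, lt_irrefl, if_false, one_sub_toNat]
      by_cases hx : x = k
      · subst hx
        simp
      · have : (x : ℕ) ≠ k := fun h' => hx (Fin.ext h')
        rw [if_neg hx]
        exact if_congr (by omega) rfl rfl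
  · have hβ : β = false := by
      rw [hb] at hc
      simpa using hc
    rw [hoare_skip, hβ]
    intro x
    rw [hp x, Links.shift, Bool.false_xor]

/-- Test whether a job joins. -/
def Test.joins (j e : NatExpr) : Test :=
  .and (.valid j e) (.and (.act (.partnerJob j e.neg) (.partnerEnd j e.neg))
    (.sat (.partnerJob j e.neg) (.neg (.partnerEnd j e.neg))))

theorem Matched.joins_iff (hs : Matched s L) {ph : Fin n → Bool} (hp : Phased s ph)
    (hd : Denotes s j e h) : (Test.joins j e).Holds s ↔ L.Joins ph h := by
  have h₁ := hs.denotes_partner hd.neg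
  rw [Test.joins, Test.holds_and, Test.holds_and, hs.valid_iff hd, hp.act_iff h₁,
    hs.sat_iff hp h₁.neg]
  rfl

/-- The coin of a job. -/
def NatExpr.coinOf (j : NatExpr) : NatExpr := .read 16 j (.lit 0)

/-- Compute the bit for a half-edge. -/
def leadProg (j e : NatExpr) : Program :=
  .ite (.natNe (.partnerJob j e) j)
    (.ite (.act (.partnerJob j e) (.partnerEnd j e))
      (.ite (.natLt j (.partnerJob j e)) (.setNat 17 (.lit 0) (.lit 0) (.coinOf j))
        (.setNat 17 (.lit 0) (.lit 0) (.neg (.coinOf (.partnerJob j e)))))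
      (.ite (.joins (.partnerJob j e) (.partnerEnd j e))
        (.ite (.natLt (.partnerJob j e) (.partnerJob (.partnerJob j e) (.neg (.partnerEnd j e))))
          (.setNat 17 (.lit 0) (.lit 0) (.coinOf (.partnerJob j e)))
          (.setNat 17 (.lit 0) (.lit 0)
            (.neg (.coinOf (.partnerJob (.partnerJob j e) (.neg (.partnerEnd j e)))))))
        (.setNat 17 (.lit 0) (.lit 0) (.coinOf j))))
    (.setNat 17 (.lit 0) (.lit 0) (.coinOf j))

theorem hoare_leadProg (hs : Matched s L) {ph coins : Fin n → Bool} (hp : Phased s ph)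
    (hc : ∀ x : Fin n, s.nat 16 x 0 = (coins x).toNat) {x : Fin n}
    (hd : Denotes s j e (Links.sel ph x)) :
    Hoare (leadProg j e) s fun t =>
      t.nat 17 0 0 = (xor (coins (L.lead ph x).1) (L.lead ph x).2).toNat := by
  have hk := hs.denotes_partner hd
  have hm := hs.denotes_partner hk.neg
  have coin_eq : ∀ {j e : NatExpr} {h : Fin n × Bool}, Denotes s j e h →
      (NatExpr.coinOf j).eval s = (coins h.1).toNat := by
    intro j e h hd
    rw [NatExpr.coinOf, NatExpr.eval_read, hd.1, NatExpr.eval_lit, hc]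
  have hx : (Links.sel ph x).1 = x := rfl
  unfold Links.lead
  refine Hoare.ite (fun h₁ => ?_) fun h₁ => ?_
  · rw [hs.partnerJob_ne_iff hd] at h₁
    simp only [if_neg h₁]
    refine Hoare.ite (fun h₂ => ?_) fun h₂ => ?_
    · rw [hp.act_iff hk] at h₂
      simp only [if_pos h₂]
      refine Hoare.ite (fun h₃ => ?_) fun h₃ => ?_ <;>
        rw [Test.holds_natLt, hk.1, hd.1, Fin.val_fin_lt, hx] at h₃
      · rw [hoare_setNat, coin_eq hd, if_pos h₃]
        simp [hx]
      · rw [hoare_setNat, NatExpr.eval_neg, coin_eq hk, if_neg h₃]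
        simp [one_sub_toNat]
    · rw [hp.act_iff hk] at h₂
      simp only [if_neg h₂]
      refine Hoare.ite (fun h₃ => ?_) fun h₃ => ?_ <;> rw [hs.joins_iff hp hk] at h₃
      · simp only [if_pos h₃]
        refine Hoare.ite (fun h₄ => ?_) fun h₄ => ?_ <;>
          rw [Test.holds_natLt, hk.1, hm.1, Fin.val_fin_lt] at h₄
        · rw [hoare_setNat, coin_eq hk, if_pos h₄]
          simp
        · rw [hoare_setNat, NatExpr.eval_neg, coin_eq hm, if_neg h₄]
          simp [one_sub_toNat]
      · rw [hoare_setNat, coin_eq hd, if_neg h₃]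
        simp [hx]
  · rw [hs.partnerJob_ne_iff hd, not_not] at h₁
    rw [hoare_setNat, coin_eq hd]
    simp [if_pos h₁, hx]

/-- Write the output. -/
def outputProg : Program :=
  .loop 20 .jobs (.seq (leadProg (.var 20) (.read 13 (.var 20) (.lit 0)))
    (.ite (.natEq (.var 17) (.lit 1))
      (.setNat 2 (.var 20) (.lit 0) (.groupOf (.var 20) (.read 13 (.var 20) (.lit 0))))
      (.setNat 2 (.var 20) (.lit 0) (.groupOf (.var 20) (.neg (.read 13 (.var 20) (.lit 0)))))))

theorem hoare_outputProg {U : ℕ} {E : Fin n × Bool → Fin U} (hs : Matched s L)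
    (hE : ∀ h : Fin n × Bool, s.nat 3 h.1 h.2.toNat = E h)
    {ph coins : Fin n → Bool} (hp : Phased s ph)
    (hc : ∀ x : Fin n, s.nat 16 x 0 = (coins x).toNat) :
    Hoare outputProg s fun t => ∀ x : Fin n, t.nat 2 x 0 = E (L.chosen ph coins x) := by
  have := hoare_for (a := 20) (s := s) (e := .jobs) hs.jobs (fun k t => ∀ x : Fin n,
      (x : ℕ) < k → t.nat 2 x 0 = E (L.chosen ph coins x)) (c := .seq
        (leadProg (.var 20) (.read 13 (.var 20) (.lit 0)))
    (.ite (.natEq (.var 17) (.lit 1))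
      (.setNat 2 (.var 20) (.lit 0) (.groupOf (.var 20) (.read 13 (.var 20) (.lit 0))))
      (.setNat 2 (.var 20) (.lit 0) (.groupOf (.var 20) (.neg (.read 13 (.var 20) (.lit 0)))))))
      ?_ ?_ ?_
  · exact this.mono fun t ht x => ht x x.2
  · intro k t v h
    simpa using h
  · intro x hx
    omega
  · intro k t hF hk ht
    have mt : Matched t L := hs.of_eq (hF.1 0 rfl) (hF.1 1 rfl) (hF.1 3 rfl) (hF.1 10 rfl)
      (hF.1 11 rfl)
    have pt : Phased t ph := fun x => by rw [hF.1 13 rfl]; exact hp x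
    have dt : Denotes t (.var 20) (.read 13 (.var 20) (.lit 0)) (Links.sel ph k) :=
      ⟨hk, by rw [NatExpr.eval_read, NatExpr.eval_var, hk, NatExpr.eval_lit, pt]; rfl⟩
    rw [hoare_seq]
    refine (hoare_leadProg mt pt (fun x => by rw [hF.1 16 rfl]; exact hc x) dt).frame.mono ?_
    rintro t' ⟨hF', h₁⟩
    have pt' : t'.nat 13 k 0 = (ph k).toNat := by rw [hF'.1 13 rfl]; exact pt k
    have hk' : t'.nat 20 0 0 = k := by rw [hF'.1 20 rfl, hk]
    have et' : ∀ h : Fin n × Bool, t'.nat 3 h.1 h.2.toNat = E h := fun h => by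
      rw [hF'.1 3 rfl, hF.1 3 rfl, hE]
    have ot' : t'.nat 2 = t.nat 2 := hF'.1 2 rfl
    have fin : ∀ v, v = (E (L.chosen ph coins k) : ℕ) → ∀ x : Fin n, (x : ℕ) < k + 1 →
        (t'.setNat 2 k 0 v).nat 2 x 0 = E (L.chosen ph coins x) := by
      intro v hv x hx
      rw [State.nat_setNat]
      by_cases hxk : x = k
      · subst hxk
        simpa using hv
      · have : (x : ℕ) ≠ k := fun h' => hxk (Fin.ext h')
        simp only [this, false_and, and_false, if_false, ot']
        exact ht x (by omega)
    have e₁ := et' (Links.sel ph k)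
    have e₂ := et' (fl (Links.sel ph k))
    simp only [Links.sel, fl] at e₁ e₂
    refine Hoare.ite (fun hb => ?_) fun hb => ?_ <;>
      rw [Test.holds_natEq, NatExpr.eval_var, NatExpr.eval_lit, h₁, toNat_eq_one_iff] at hb <;>
      simp only [hoare_setNat, NatExpr.eval_var, NatExpr.eval_lit, NatExpr.groupOf,
        NatExpr.eval_read, NatExpr.eval_neg, hk', pt', one_sub_toNat, e₁, e₂] <;>
      refine fin _ ?_ <;> unfold Links.chosen
    · rw [if_pos hb]; rfl
    · rw [if_neg hb]; rfl

/-- Draw the coins and write the output. -/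
def finishProg : Program :=
  .seq (.bit (.ofNat (.lit 1)) (.ofNat (.lit 2)) 15 (.lit 0) (.lit 0))
    (.seq coinsProg (.seq shiftProg outputProg))

theorem mix_finishProg {U : ℕ} {E : Fin n × Bool → Fin U} (hs : Matched s L)
    (hE : ∀ h : Fin n × Bool, s.nat 3 h.1 h.2.toNat = E h) {ph : Fin n → Bool}
    (hp : Phased s ph) :
    Mix (finishProg.exec s) (fair.bind fun β => (coinsPMF n).map (Prod.mk β)) fun a t =>
      ∀ x : Fin n, t.nat 2 x 0 = E (L.chosen (Links.shift a.1 ph) a.2 x) := by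
  have h₁ := mix_bit (.ofNat (.lit 1)) (.ofNat (.lit 2)) 15 (.lit 0) (.lit 0) s
  simp only [RealExpr.eval_ofNat, NatExpr.eval_lit, Nat.cast_one, Nat.cast_ofNat] at h₁
  refine Mix.seq h₁ ?_
  rintro β _ rfl
  set t := s.setNat 15 0 0 β.toNat with ht
  have kt : ∀ b, b ≠ 15 → t.nat b = s.nat b := fun b hb => State.setNat_nat_ne hb.symm
  have hj : t.nat 0 2 0 = n := by rw [kt 0 (by decide)]; exact hs.jobs
  have h15 : t.nat 15 0 0 = β.toNat := by simp [ht]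
  refine ((mix_coinsProg hj).frame.hoare (c := .seq shiftProg outputProg) ?_).map
    (φ := Prod.mk β) (Q := fun coins t => ∀ x : Fin n,
      t.nat 2 x 0 = E (L.chosen (Links.shift β ph) coins x)) fun a s h => h
  rintro coins t' ⟨hF, hc⟩
  have kt' : ∀ b, b ≠ 15 → coinsProg.keepsNat b = true → t'.nat b = s.nat b := fun b hb hb' => by
    rw [hF.1 b hb', kt b hb]
  rw [hoare_seq]
  refine (hoare_shiftProg (n := n) (β := β) (ph := ph) ?_ ?_ ?_).frame.mono ?_
  · rw [kt' 0 (by decide) rfl]; exact hs.jobs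
  · rw [hF.1 15 rfl, h15]
  · intro x
    rw [kt' 13 (by decide) rfl]
    exact hp x
  · rintro t'' ⟨hF', hp'⟩
    refine hoare_outputProg (hs.of_eq ?_ ?_ ?_ ?_ ?_) (fun h => ?_) hp' fun x => ?_
    · rw [hF'.1 0 rfl, kt' 0 (by decide) rfl]
    · rw [hF'.1 1 rfl, kt' 1 (by decide) rfl]
    · rw [hF'.1 3 rfl, kt' 3 (by decide) rfl]
    · rw [hF'.1 10 rfl, kt' 10 (by decide) rfl]
    · rw [hF'.1 11 rfl, kt' 11 (by decide) rfl]
    · rw [hF'.1 3 rfl, kt' 3 (by decide) rfl, hE]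
    · rw [hF'.1 16 rfl, hc]

end Output

/-! ## Building the matching and the phases -/

/-- Compute the matching and the phases from the random choices. -/
def matchProg : Program :=
  .seq parityProg (.seq rankProg (.seq partnerProg (.seq initProg unionProg)))

/-- The choices being fixed, this phase flips no coins. The parity table and the counters rely on
entries that are initially zero. -/
theorem hoare_matchProg {n U : ℕ} {g : Fin U → ℕ} {E : Fin n × Bool → Fin U}
    {K : Fin n × Bool → Bool} {R : Fin U → (k : Fin n) → Fin (k + 1)} {lev : Fin n × Bool → ℕ}
    {s : State} (hs : Drawn s g E K R) (h₇ : s.nat 7 0 0 = 0) (h₈ : ∀ i j, s.nat 8 i j = 0)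
    (hl : ∀ h : Fin n × Bool, s.nat 6 h.1 h.2.toNat = lev h) (hlt : ∀ h, lev h < numLevels) :
    Hoare matchProg s fun t => Matched t (links g E K R) ∧
      (∀ h : Fin n × Bool, t.nat 3 h.1 h.2.toNat = E h) ∧
      ∃ ph, Phased t ph ∧ (links g E K R).Bridged numLevels lev ph := by
  rw [matchProg, hoare_seq]
  refine (hoare_parityProg hs.jobs h₇).frame.mono ?_
  rintro s₁ ⟨f₁, p₁⟩
  have d₁ : Drawn s₁ g E K R :=
    hs.of_eq (f₁.1 0 rfl) (f₁.1 1 rfl) (f₁.1 3 rfl) (f₁.1 4 rfl) (f₁.1 5 rfl)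
  rw [hoare_seq]
  refine (hoare_rankProg d₁ fun c u => by rw [f₁.1 8 rfl, h₈]).frame.mono ?_
  rintro s₂ ⟨f₂, c₂, r₂⟩
  have d₂ : Drawn s₂ g E K R :=
    d₁.of_eq (f₂.1 0 rfl) (f₂.1 1 rfl) (f₂.1 3 rfl) (f₂.1 4 rfl) (f₂.1 5 rfl)
  have t₂ : Ranked s₂ g E K := ⟨by rw [f₂.1 7 rfl]; exact p₁, c₂, r₂⟩
  rw [hoare_seq]
  refine (hoare_partnerProg d₂ t₂).frame.mono ?_
  rintro s₃ ⟨f₃, p₃⟩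
  have d₃ : Drawn s₃ g E K R :=
    d₂.of_eq (f₃.1 0 rfl) (f₃.1 1 rfl) (f₃.1 3 rfl) (f₃.1 4 rfl) (f₃.1 5 rfl)
  have m₃ : Matched s₃ (links g E K R) := by
    refine ⟨d₃.jobs, fun h => ?_, fun h => (p₃ h).1, fun h => (p₃ h).2⟩
    rw [d₃.group, d₃.machine]
    rfl
  rw [hoare_seq]
  refine (hoare_initProg d₃.jobs).frame.mono ?_
  rintro s₄ ⟨f₄, i₄, p₄⟩
  have d₄ : Drawn s₄ g E K R :=
    d₃.of_eq (f₄.1 0 rfl) (f₄.1 1 rfl) (f₄.1 3 rfl) (f₄.1 4 rfl) (f₄.1 5 rfl)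
  have m₄ : Matched s₄ (links g E K R) :=
    m₃.of_eq (f₄.1 0 rfl) (f₄.1 1 rfl) (f₄.1 3 rfl) (f₄.1 10 rfl) (f₄.1 11 rfl)
  refine (hoare_unionProg m₄ (lev := lev) (fun h => ?_) hlt p₄ i₄).frame.mono ?_
  · rw [f₄.1 6 rfl, f₃.1 6 rfl, f₂.1 6 rfl, f₁.1 6 rfl, hl]
  · rintro t ⟨f₅, hp⟩
    exact ⟨m₄.of_eq (f₅.1 0 rfl) (f₅.1 1 rfl) (f₅.1 3 rfl) (f₅.1 10 rfl) (f₅.1 11 rfl),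
      fun h => by rw [f₅.1 3 rfl, d₄.group], hp⟩

/-! ## Sequential sampling -/

section Sampling

theorem Mix.to_hoare {α : Type*} {c : Program} {s : State} {D : PMF α} {Q : α → State → Prop}
    (h : Mix (c.exec s) D Q) : Hoare c s fun t => ∃ a, Q a t := by
  obtain ⟨γ, h₁, h₂, h₃⟩ := h
  intro t ht
  rw [← h₂, PMF.mem_support_map_iff] at ht
  obtain ⟨x, hx, rfl⟩ := ht
  exact ⟨x.1, h₃ x hx⟩

theorem Mix.and_hoare {α : Type*} {c : Program} {s : State} {D : PMF α} {Q : α → State → Prop}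
    (h : Mix (c.exec s) D Q) {Q' : State → Prop} (h' : Hoare c s Q') :
    Mix (c.exec s) D fun a t => Q a t ∧ Q' t := by
  obtain ⟨γ, h₁, h₂, h₃⟩ := h
  refine ⟨γ, h₁, h₂, fun x hx => ⟨h₃ x hx, h' _ ?_⟩⟩
  rw [← h₂, PMF.mem_support_map_iff]
  exact ⟨x, hx, rfl⟩

theorem replaceBy_zero {α : Type*} (D : PMF α) (a : α) : replaceBy D 0 a = D := by
  have : coin 0 = PMF.pure false := ext_ev fun f => by
    rw [ev_coin le_rfl zero_le_one]
    simp
  rw [replaceBy, this, PMF.pure_bind, if_neg (by decide)]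

theorem bind_replaceBy {α : Type*} (D : PMF α) (x : ℝ) (a : α) :
    (D.bind fun y => replaceBy (PMF.pure y) x a) = replaceBy D x a := by
  unfold replaceBy
  rw [PMF.bind_comm]
  congr 1
  funext b
  cases b
  · simp
  · simp

/-- Correctness of reservoir sampling. The initial law `D` with weight `W 0` is kept general so that
the rows of a double loop can be chained. -/
theorem ev_iterLabel_replaceBy {α : Type*} [Fintype α] {w W : ℕ → ℝ} (hw : ∀ l, 0 ≤ w l)
    (hW : ∀ l, 0 ≤ W l) (hs : ∀ l, W (l + 1) = W l + w l) (a : ℕ → α) (D : PMF α) (f : α → ℝ)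
    (m : ℕ) : W m * ev (D.bind fun y => iterLabel (fun l y =>
        replaceBy (PMF.pure y) (w l / (W l + w l)) (a l)) y m) f
      = W 0 * ev D f + ∑ l ∈ Finset.range m, w l * f (a l) := by
  induction m with
  | zero => simp [iterLabel]
  | succ m ih =>
    simp only [iterLabel]
    rw [← PMF.bind_bind, bind_replaceBy, hs, ev_replaceBy (hw m) (hW m), ih, Finset.sum_range_succ]
    ring

/-- Store in the entry `(i, j)` of the array `a` a random number below the value of `e`, where
`i` and `j` are the counters `20` and `21`. -/
def unifProg (a : ℕ) (b e : NatExpr) : Program :=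
  .seq (.setNat a (.var 20) (.var 21) (.lit 0))
    (.loop 22 b (.ite (.natLt (.var 22) e)
      (.flip (.ofNat (.lit 1)) (.ofNat (.add (.var 22) (.lit 1)))
        (.setNat a (.var 20) (.var 21) (.var 22)) .skip) .skip))

/-- The loop runs up to `b` and not to `e`, because only literals and sizes are admitted as loop
bounds; rounds beyond `e` do nothing. -/
theorem mix_unifProg {a : ℕ} {b e : NatExpr} {s : State} (ha : a < 20) {k : ℕ}
    (hb : k + 1 ≤ b.eval (s.setNat a (s.nat 20 0 0) (s.nat 21 0 0) 0))
    (he : ∀ t : State, t.nat 21 = s.nat 21 → e.eval t = k + 1) :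
    Mix ((unifProg a b e).exec s) (unif k) fun v t =>
      t.nat a (s.nat 20 0 0) (s.nat 21 0 0) = v ∧
      ∀ i j, ¬ (i = s.nat 20 0 0 ∧ j = s.nat 21 0 0) → t.nat a i j = s.nat a i j := by
  classical
  set s₁ := s.setNat a (s.nat 20 0 0) (s.nat 21 0 0) 0 with hs₁
  -- Uniform sampling is reservoir sampling with weight one for the first `k + 1` candidates and
  -- zero afterwards. The reduction in `num` below only makes the candidate total.
  set w : ℕ → ℝ := fun l => if l < k + 1 then 1 else 0 with hw
  set W : ℕ → ℝ := fun l => min (l : ℝ) (k + 1) with hW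
  set num : ℕ → Fin (k + 1) := fun l => ⟨l % (k + 1), Nat.mod_lt _ k.succ_pos⟩ with hnum
  have a20 : a ≠ 20 := by omega
  have a21 : a ≠ 21 := by omega
  have a22 : a ≠ 22 := by omega
  have key := Mix.loop (a := 22) (e := b) (s := s₁) (x := num 0)
    (c := .ite (.natLt (.var 22) e) (.flip (.ofNat (.lit 1)) (.ofNat (.add (.var 22) (.lit 1)))
        (.setNat a (.var 20) (.var 21) (.var 22)) .skip) .skip)
    (G := fun l y => replaceBy (PMF.pure y) (w l / (W l + w l)) (num l))
    (fun _ v t => t.nat a (s.nat 20 0 0) (s.nat 21 0 0) = v ∧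
      ∀ i j, ¬ (i = s.nat 20 0 0 ∧ j = s.nat 21 0 0) → t.nat a i j = s.nat a i j) ?_ ?_
  · have hlabel : iterLabel (fun l y => replaceBy (PMF.pure y) (w l / (W l + w l)) (num l))
        (num 0) (b.eval s₁) = unif k := by
      refine ext_ev fun f => ?_
      have h₁ := ev_iterLabel_replaceBy (w := w) (W := W) (fun l => by simp only [hw]; positivity)
        (fun l => by simp only [hW]; positivity) ?_ num (PMF.pure (num 0)) f (b.eval s₁)
      · rw [PMF.pure_bind] at h₁
        have h₂ : W (b.eval s₁) = k + 1 := min_eq_right (by exact_mod_cast hb)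
        have h₃ : W 0 = 0 := by
          simp only [hW, Nat.cast_zero]
          exact min_eq_left (by positivity)
        have h₄ : ∑ l ∈ Finset.range (b.eval s₁), w l * f (num l) = ∑ v : Fin (k + 1), f v := by
          rw [← Finset.sum_subset (Finset.range_mono hb), Finset.sum_range]
          · refine Finset.sum_congr rfl fun v _ => ?_
            have : num v = v := Fin.ext (Nat.mod_eq_of_lt v.2)
            rw [this, hw]
            simp only [v.2, if_true, one_mul]
          · intro l _ hl
            rw [Finset.mem_range] at hl
            simp only [hw, hl, if_false, zero_mul]
        rw [h₂, h₃, h₄, zero_mul, zero_add] at h₁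
        rw [ev_unif, ← h₁]
        field_simp
      · intro l
        simp only [hW, hw, Nat.cast_add, Nat.cast_one]
        split_ifs with hl
        · have : (l : ℝ) + 1 ≤ k + 1 := by exact_mod_cast hl
          rw [min_eq_left this, min_eq_left (by linarith)]
        · have : (k : ℝ) + 1 ≤ l := by exact_mod_cast not_lt.1 hl
          rw [min_eq_right this, min_eq_right (by linarith), add_zero]
    rw [hlabel] at key
    have hseq : (unifProg a b e).exec s = (Program.loop 22 b (.ite (.natLt (.var 22) e)
        (.flip (.ofNat (.lit 1)) (.ofNat (.add (.var 22) (.lit 1)))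
        (.setNat a (.var 20) (.var 21) (.var 22)) .skip) .skip)).exec s₁ := by
      rw [unifProg, Program.exec, Program.exec, PMF.pure_bind]
      rfl
    rw [hseq]
    exact key
  · refine ⟨?_, fun i j hij => ?_⟩
    · simp [hs₁, hnum]
    · simp [hs₁, hij]
  · rintro l - v t hF ⟨h₁, h₂⟩
    have e20 : t.nat 20 = s.nat 20 := by
      rw [hF.1 20 (by simp [Program.keepsNat, a20]), hs₁, State.setNat_nat_ne a20]
    have e21 : t.nat 21 = s.nat 21 := by
      rw [hF.1 21 (by simp [Program.keepsNat, a21]), hs₁, State.setNat_nat_ne a21]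
    have he' : e.eval (t.setNat 22 0 0 l) = k + 1 := he _ (by
      rw [State.setNat_nat_ne (by decide), e21])
    have hcond : (Test.natLt (.var 22) e).Holds (t.setNat 22 0 0 l) ↔ l < k + 1 := by
      rw [Test.holds_natLt, he', NatExpr.eval_var]
      simp
    rw [Program.exec]
    by_cases hl : l < k + 1
    · rw [if_pos (hcond.2 hl)]
      have hWl : W l = l := min_eq_left (by exact_mod_cast hl.le)
      have hwl : w l = 1 := if_pos hl
      rw [hWl, hwl]
      have := Mix.flip (p := .ofNat (.lit 1)) (q := .ofNat (.add (.var 22) (.lit 1)))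
        (c := .setNat a (.var 20) (.var 21) (.var 22)) (d := .skip) (s := t.setNat 22 0 0 l)
        (G := fun b => if b = true then PMF.pure (num l) else PMF.pure v)
        (Q := fun v t => t.nat a (s.nat 20 0 0) (s.nat 21 0 0) = v ∧
          ∀ i j, ¬ (i = s.nat 20 0 0 ∧ j = s.nat 21 0 0) → t.nat a i j = s.nat a i j) ?_ ?_
      · simpa [replaceBy] using this
      · simp only [if_true]
        refine Mix.of_hoare ?_
        rw [hoare_setNat]
        simp only [NatExpr.eval_var, State.nat_setNat, Nat.reduceEqDiff, false_and, if_false, e20,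
          e21, and_self, if_true, a22, true_and]
        refine ⟨(Nat.mod_eq_of_lt hl).symm, fun i j hij => ?_⟩
        rw [if_neg hij]
        exact h₂ i j hij
      · simp only [Bool.false_eq_true, if_false]
        refine Mix.of_hoare ?_
        rw [hoare_skip]
        simpa [a22, -not_and] using And.intro h₁ h₂
    · rw [if_neg (mt hcond.1 hl)]
      have hwl : w l = 0 := if_neg hl
      rw [hwl, zero_div, replaceBy_zero]
      refine Mix.of_hoare ?_
      rw [hoare_skip]
      simpa [a22, -not_and] using And.intro h₁ h₂

/-- Fill a table with independent random numbers. -/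
def tableProg (a : ℕ) (b₁ b₂ b e : NatExpr) : Program :=
  .loop 20 b₁ (.loop 21 b₂ (unifProg a b e))

theorem mix_tableProg {a : ℕ} {b₁ b₂ b e : NatExpr} {s : State} (ha : a < 20) (ha₀ : a ≠ 0)
    {p q : ℕ} {K : Fin q → ℕ} (h₁ : b₁.eval s = p)
    (h₂ : ∀ t : State, t.nat 0 = s.nat 0 → b₂.eval t = q)
    (hb : ∀ t : State, t.nat 0 = s.nat 0 → ∀ k, K k + 1 ≤ b.eval t)
    (he : ∀ (t : State) (k : Fin q), t.nat 21 0 0 = k → e.eval t = K k + 1) :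
    Mix ((tableProg a b₁ b₂ b e).exec s) (piPMF fun _ : Fin p => piPMF fun k => unif (K k))
      fun ω t => ∀ i k, t.nat a (i : Fin p) (k : Fin q) = ω i k := by
  have a20 : a ≠ 20 := by omega
  have a21 : a ≠ 21 := by omega
  have a22 : a ≠ 22 := by omega
  refine Mix.loop_pi (fun _ : Fin p => piPMF fun k : Fin q => unif (K k)) h₁
    (fun i ρ t => ∀ k : Fin q, t.nat a i k = ρ k) ?_
  intro i t hF
  have hF₀ : t.nat 0 = s.nat 0 := hF.1 0 (by simp [Program.keepsNat, unifProg, ha₀])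
  have cellMix : ∀ k : Fin q, ∀ t' : State, t'.nat 0 = s.nat 0 → t'.nat 20 0 0 = i →
      Mix ((unifProg a b e).exec (t'.setNat 21 0 0 k)) (unif (K k)) fun v t'' =>
        t''.nat a i k = v ∧ ∀ i' k', ¬ (i' = (i : ℕ) ∧ k' = (k : ℕ)) →
          t''.nat a i' k' = t'.nat a i' k' := by
    intro k t' h₀ h20
    have := mix_unifProg (a := a) (b := b) (e := e) (s := t'.setNat 21 0 0 k) (k := K k) ha
      (hb _ (by simp [h₀, ha₀]) k) (fun t'' h => he _ _ (by rw [h]; simp))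
    simpa [h20, a21] using this
  -- Filling one row leaves the other rows intact, as `Mix.loop_pi` demands for the outer loop.
  have rows : Hoare (.loop 21 b₂ (unifProg a b e)) (t.setNat 20 0 0 i) fun t' =>
      ∀ i' k', i' ≠ (i : ℕ) → t'.nat a i' k' = t.nat a i' k' := by
    have hn : b₂.eval (t.setNat 20 0 0 i) = q := h₂ _ (by simp [hF₀])
    have := hoare_loop (a := 21) (e := b₂) (c := unifProg a b e) (s := t.setNat 20 0 0 i)
      (fun _ t' => ∀ i' k', i' ≠ (i : ℕ) → t'.nat a i' k' = t.nat a i' k') ?_ ?_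
    · exact this
    · intro i' k' _
      simp [a20]
    · intro k hk t' hF' ht'
      rw [hn] at hk
      have := (cellMix ⟨k, hk⟩ t' ?_ ?_).to_hoare
      · refine this.mono ?_
        rintro t'' ⟨v, -, h₄⟩ i' k' hi'
        rw [h₄ i' k' fun h => hi' h.1, ht' i' k' hi']
      · rw [hF'.1 0 (by simp [Program.keepsNat, unifProg, ha₀]), State.setNat_nat_ne (by decide),
          hF₀]
      · rw [hF'.1 20 (by simp [Program.keepsNat, unifProg, a20])]
        simp
  refine (Mix.and_hoare (Q := fun (ρ : ∀ k : Fin q, Fin (K k + 1)) t' =>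
    ∀ k : Fin q, t'.nat a i k = ρ k) ?_ rows).mono ?_
  · refine Mix.loop_pi (fun k : Fin q => unif (K k)) (h₂ _ (by simp [hF₀]))
      (fun k v t' => t'.nat a i k = v) ?_
    intro k t' hF'
    refine (cellMix k t' ?_ ?_).mono ?_
    · rw [hF'.1 0 (by simp [Program.keepsNat, unifProg, ha₀]), State.setNat_nat_ne (by decide),
        hF₀]
    · rw [hF'.1 20 (by simp [Program.keepsNat, unifProg, a20])]
      simp
    · rintro v t'' ⟨h₃, h₄⟩
      refine ⟨h₃, fun k' hk' v' hv' => ?_⟩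
      rw [h₄ _ _ fun h => hk'.ne (Fin.ext h.2), hv']
  · rintro ρ t' ⟨h₃, h₄⟩
    refine ⟨h₃, fun i' hi' ρ' h k => ?_⟩
    rw [h₄ _ _ fun h' => hi'.ne (Fin.ext h'), h]

theorem map_piPMF_bool {n : ℕ} {A : Type*} [Fintype A] (p : PMF A) :
    ((piPMF fun _ : Fin n => piPMF fun _ : Fin 2 => p).map fun ω (h : Fin n × Bool) =>
      ω h.1 (finTwoEquiv.symm h.2)) = piPMF fun _ => p := by
  refine ext_ev fun f => ?_
  rw [ev_map, ev_piPMF_curry fun _ _ => p]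
  simp only [ev, piPMF, PMF.ofFintype_apply]
  refine Fintype.sum_equiv ((Equiv.prodCongr (Equiv.refl (Fin n)) finTwoEquiv).arrowCongr
    (Equiv.refl A)) _ _ fun ω => ?_
  congr 2
  exact Fintype.prod_equiv (Equiv.prodCongr (Equiv.refl (Fin n)) finTwoEquiv) _ _ fun x => by
    obtain ⟨i, k⟩ := x
    simp

/-- Draw the numbers for the round robins. -/
def ringProg : Program := tableProg 5 .groups .jobs .jobs (.add (.var 21) (.lit 1))

theorem mix_ringProg {n U : ℕ} {s : State} (hU : s.nat 0 1 0 = U) (hn : s.nat 0 2 0 = n) :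
    Mix (ringProg.exec s) (ringPMF n U) fun R t =>
      ∀ (u : Fin U) (k : Fin n), t.nat 5 u k = R u k :=
  mix_tableProg (by decide) (by decide) hU (fun t h => by rw [NatExpr.eval_jobs, h, hn])
    (fun t h k => by rw [NatExpr.eval_jobs, h, hn]; exact k.2)
    (fun t k h => by rw [NatExpr.eval_add, NatExpr.eval_var, h, NatExpr.eval_lit])

/-- Draw the levels. -/
def levelProg : Program :=
  tableProg 6 .jobs (.lit 2) (.lit (numLevels - 1 + 1)) (.lit (numLevels - 1 + 1))

theorem mix_levelProg {n : ℕ} {s : State} (hn : s.nat 0 2 0 = n) :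
    Mix (levelProg.exec s) (levelPMF n) fun lev t =>
      ∀ h : Fin n × Bool, t.nat 6 h.1 h.2.toNat = lev h := by
  have := mix_tableProg (a := 6) (b₁ := .jobs) (b₂ := .lit 2) (b := .lit (numLevels - 1 + 1))
    (e := .lit (numLevels - 1 + 1)) (s := s) (q := 2) (K := fun _ => numLevels - 1) (by decide)
    (by decide) hn (fun _ _ => rfl) (fun _ _ _ => le_rfl) (fun _ _ _ => rfl)
  rw [levelPMF, ← map_piPMF_bool]
  refine this.map fun ω t h x => ?_
  rw [← h]
  obtain ⟨j, e⟩ := x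
  cases e <;> rfl

end Sampling

/-! ## Sampling pairs of groups -/

section Pairs

variable {n U : ℕ} {g : Fin U → ℕ} {y : Fin U → Fin n → ℝ} {s : State}

/-- The instance is stored in the memory. -/
structure Input (s : State) (g : Fin U → ℕ) (y : Fin U → Fin n → ℝ) : Prop where
  groups : s.nat 0 1 0 = U
  jobs : s.nat 0 2 0 = n
  machine : ∀ u : Fin U, s.nat 1 u 0 = g u
  mass : ∀ (u : Fin U) (j : Fin n), s.real 0 u j = y u j

theorem Input.of_eq {t : State} (h : Input s g y) (h₀ : t.nat 0 = s.nat 0)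
    (h₁ : t.nat 1 = s.nat 1) (h₂ : t.real 0 = s.real 0) : Input t g y := by
  obtain ⟨a, b, c, d⟩ := h
  refine ⟨?_, ?_, ?_, ?_⟩ <;> simpa only [h₀, h₁, h₂]

/-- Twice the mass of a job in a group. -/
def RealExpr.share (u j : NatExpr) : RealExpr := .add (.read 0 u j) (.read 0 u j)

theorem Input.eval_share (hs : Input s g y) {a b : NatExpr} {u : Fin U} {j : Fin n}
    (ha : a.eval s = u) (hb : b.eval s = j) : (RealExpr.share a b).eval s = 2 * y u j := by
  rw [RealExpr.share, RealExpr.eval_add, RealExpr.eval_read, ha, hb, hs.mass]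
  ring

/-- Test for the order of the groups. -/
def Test.before (v u : NatExpr) : Test :=
  .or (.natLt (.read 1 v (.lit 0)) (.read 1 u (.lit 0)))
    (.and (.natEq (.read 1 v (.lit 0)) (.read 1 u (.lit 0))) (.natLt v u))

theorem Input.before_iff (hs : Input s g y) {a b : NatExpr} {v u : Fin U} (ha : a.eval s = v)
    (hb : b.eval s = u) : (Test.before a b).Holds s ↔ Before g v u := by
  simp only [Test.before, Test.holds_or, Test.holds_and, Test.holds_natLt, Test.holds_natEq,
    NatExpr.eval_read, NatExpr.eval_lit, ha, hb, hs.machine, Fin.val_fin_lt]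
  rfl

/-- Compute the left end of the group `x` in the entry `(r, 0)`. -/
def endProg (x r : ℕ) : Program :=
  .seq (.setReal 3 (.lit r) (.lit 0) (.ofNat (.lit 0)))
    (.loop 23 .groups (.ite (.before (.var 23) (.var x))
      (.setReal 3 (.lit r) (.lit 0) (.add (.read 3 (.lit r) (.lit 0))
        (.share (.var 23) (.var 20)))) .skip))

theorem hoare_endProg (hs : Input s g y) {j : Fin n} {u : Fin U} {x : ℕ} (r : ℕ)
    (hj : s.nat 20 0 0 = j) (hx : s.nat x 0 0 = u) (hx23 : x ≠ 23) :
    Hoare (endProg x r) s fun t => t.real 3 r 0 = leftEnd g (fun v => 2 * y v j) u ∧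
      ∀ r', r' ≠ r → t.real 3 r' 0 = s.real 3 r' 0 := by
  rw [endProg, hoare_seq, hoare_setReal]
  set s₁ := s.setReal 3 ((NatExpr.lit r).eval s) ((NatExpr.lit 0).eval s)
    ((RealExpr.ofNat (.lit 0)).eval s) with hs₁
  have i₁ : Input s₁ g y := hs.of_eq rfl rfl (State.setReal_real_ne (by decide))
  have n₁ : s₁.nat = s.nat := rfl
  set w : ℕ → ℝ := fun l => if h : l < U then if Before g ⟨l, h⟩ u then 2 * y ⟨l, h⟩ j else 0
    else 0 with hw
  have := hoare_for (a := 23) (s := s₁) (e := .groups) i₁.groups (fun k t =>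
    t.real 3 r 0 = ∑ l ∈ Finset.range k, w l ∧ ∀ r', r' ≠ r → t.real 3 r' 0 = s.real 3 r' 0)
    (c := .ite (.before (.var 23) (.var x)) (.setReal 3 (.lit r) (.lit 0)
      (.add (.read 3 (.lit r) (.lit 0)) (.share (.var 23) (.var 20)))) .skip) ?_ ?_ ?_
  · refine this.mono fun t ht => ⟨?_, ht.2⟩
    rw [ht.1, leftEnd, Finset.sum_filter, Finset.sum_range]
    refine Finset.sum_congr rfl fun v _ => ?_
    simp only [hw, v.2, dif_pos]
  · intro k t v h
    exact h
  · refine ⟨by simp [hs₁], fun r' hr' => ?_⟩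
    simp [hs₁, hr']
  · rintro k t hF hk ⟨h₁, h₂⟩
    have it : Input t g y := i₁.of_eq (hF.1 0 rfl) (hF.1 1 rfl) (hF.2 0 rfl)
    have xt : t.nat x 0 0 = u := by
      rw [hF.1 x (by simp [Program.keepsNat, hx23.symm]), n₁, hx]
    have jt : t.nat 20 0 0 = j := by rw [hF.1 20 rfl, n₁, hj]
    have hb := it.before_iff (a := .var 23) (b := .var x) (v := k) (u := u) hk xt
    have hsh := it.eval_share (a := .var 23) (b := .var 20) (u := k) (j := j) hk jt
    rw [Finset.sum_range_succ]
    have hwk : w k = if Before g k u then 2 * y k j else 0 := by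
      simp only [hw, k.2, dif_pos]
    refine Hoare.ite (fun hc => ?_) fun hc => ?_ <;> rw [hb] at hc
    · rw [hoare_setReal]
      refine ⟨?_, fun r' hr' => ?_⟩
      · simp [hsh, h₁, hwk, hc]
      · simpa [hr'] using h₂ r' hr'
    · rw [hoare_skip, hwk, if_neg hc, add_zero]
      exact ⟨h₁, h₂⟩

/-- Store the minimum. -/
def minProg (r : ℕ) (a b : RealExpr) : Program :=
  .ite (.realLt a b) (.setReal 3 (.lit r) (.lit 0) a) (.setReal 3 (.lit r) (.lit 0) b)

/-- Store the maximum. -/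
def maxProg (r : ℕ) (a b : RealExpr) : Program :=
  .ite (.realLt a b) (.setReal 3 (.lit r) (.lit 0) b) (.setReal 3 (.lit r) (.lit 0) a)

theorem hoare_minProg {r : ℕ} {a b : RealExpr} {Q : State → Prop}
    (h : Q (s.setReal 3 r 0 (min (a.eval s) (b.eval s)))) : Hoare (minProg r a b) s Q := by
  refine Hoare.ite (fun hc => ?_) fun hc => ?_ <;> rw [Test.holds_realLt] at hc <;>
    rw [hoare_setReal]
  · rwa [min_eq_left hc.le] at h
  · rwa [min_eq_right (not_lt.1 hc)] at h

theorem hoare_maxProg {r : ℕ} {a b : RealExpr} {Q : State → Prop}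
    (h : Q (s.setReal 3 r 0 (max (a.eval s) (b.eval s)))) : Hoare (maxProg r a b) s Q := by
  refine Hoare.ite (fun hc => ?_) fun hc => ?_ <;> rw [Test.holds_realLt] at hc <;>
    rw [hoare_setReal]
  · rwa [max_eq_right hc.le] at h
  · rwa [max_eq_left (not_lt.1 hc)] at h

/-- The entry `(r, 0)` of the scratch array. -/
def RealExpr.scratch (r : ℕ) : RealExpr := .read 3 (.lit r) (.lit 0)

/-- Compute the weight of a pair of groups in the entry `(4, 0)`. -/
def weightProg : Program :=
  .seq (endProg 21 0) (.seq (endProg 22 1)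
    (.seq (minProg 2 (.add (.scratch 0) (.share (.var 21) (.var 20)))
        (.sub (.add (.scratch 1) (.share (.var 22) (.var 20))) (.ofNat (.lit 1))))
      (.seq (maxProg 3 (.scratch 0) (.sub (.scratch 1) (.ofNat (.lit 1))))
        (maxProg 4 (.ofNat (.lit 0)) (.sub (.scratch 2) (.scratch 3))))))

theorem hoare_weightProg (hs : Input s g y) {j : Fin n} {u v : Fin U} (hj : s.nat 20 0 0 = j)
    (hu : s.nat 21 0 0 = u) (hv : s.nat 22 0 0 = v) :
    Hoare weightProg s fun t => t.real 3 4 0 = pairWeight g (fun u => 2 * y u j) u v := by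
  rw [weightProg, hoare_seq]
  refine (hoare_endProg hs 0 hj hu (by decide)).frame.mono ?_
  rintro s₁ ⟨f₁, c₁, -⟩
  have i₁ : Input s₁ g y := hs.of_eq (f₁.1 0 rfl) (f₁.1 1 rfl) (f₁.2 0 rfl)
  have j₁ : s₁.nat 20 0 0 = j := by rw [f₁.1 20 rfl, hj]
  have u₁ : s₁.nat 21 0 0 = u := by rw [f₁.1 21 rfl, hu]
  have v₁ : s₁.nat 22 0 0 = v := by rw [f₁.1 22 rfl, hv]
  rw [hoare_seq]
  refine (hoare_endProg i₁ 1 j₁ v₁ (by decide)).frame.mono ?_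
  rintro s₂ ⟨f₂, c₂, d₂⟩
  have i₂ : Input s₂ g y := i₁.of_eq (f₂.1 0 rfl) (f₂.1 1 rfl) (f₂.2 0 rfl)
  have j₂ : s₂.nat 20 0 0 = j := by rw [f₂.1 20 rfl, j₁]
  have u₂ : s₂.nat 21 0 0 = u := by rw [f₂.1 21 rfl, u₁]
  have v₂ : s₂.nat 22 0 0 = v := by rw [f₂.1 22 rfl, v₁]
  have e₂ := d₂ 0 (by decide)
  rw [c₁] at e₂
  rw [hoare_seq]
  refine hoare_minProg ?_
  rw [hoare_seq]
  refine hoare_maxProg (hoare_maxProg ?_)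
  have su := i₂.eval_share (a := .var 21) (b := .var 20) u₂ j₂
  have sv := i₂.eval_share (a := .var 22) (b := .var 20) v₂ j₂
  simp only [RealExpr.eval_add, RealExpr.eval_sub, RealExpr.eval_ofNat, RealExpr.scratch,
    RealExpr.eval_read, NatExpr.eval_lit, su, sv, c₂, e₂, State.real_setReal, Nat.reduceEqDiff,
    Nat.cast_zero, Nat.cast_one, and_true, if_true, if_false, and_false, and_self,
    OfNat.zero_ne_ofNat, OfNat.one_ne_ofNat]
  rfl

/-- Process a pair of groups. -/
def stepProg : Program :=
  .seq weightProg (.seq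
    (.setReal 4 (.lit 0) (.lit 0) (.add (.read 4 (.lit 0) (.lit 0)) (.scratch 4)))
    (.flip (.scratch 4) (.read 4 (.lit 0) (.lit 0))
      (.seq (.setNat 3 (.var 20) (.lit 0) (.var 21)) (.setNat 3 (.var 20) (.lit 1) (.var 22)))
      .skip))

/-- The entries of the job `j` are the pair `q`, and the other jobs are as in `s`. -/
def PairAt (s : State) (j : ℕ) (q : Fin U × Fin U) (t : State) : Prop :=
  t.nat 3 j 0 = q.1 ∧ t.nat 3 j 1 = q.2 ∧ ∀ i e, i ≠ j → t.nat 3 i e = s.nat 3 i e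

/-- The running total is increased before the coin is flipped, so the quotient is the new weight
over the new total. -/
theorem mix_stepProg {t : State} (ht : Input t g y) {j : Fin n} {u v : Fin U}
    (hj : t.nat 20 0 0 = j) (hu : t.nat 21 0 0 = u) (hv : t.nat 22 0 0 = v) {q : Fin U × Fin U}
    (hq : PairAt s j q t) {W : ℝ} (hW : t.real 4 0 0 = W) :
    Mix (stepProg.exec t) (replaceBy (PMF.pure q)
      (pairWeight g (fun u => 2 * y u j) u v / (W + pairWeight g (fun u => 2 * y u j) u v)) (u, v))
      fun q t => PairAt s j q t ∧ t.real 4 0 0 = W + pairWeight g (fun u => 2 * y u j) u v := by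
  have h₁ := Mix.of_hoare (a := ()) (Q := fun _ t' => weightProg.Frame t t' ∧
    t'.real 3 4 0 = pairWeight g (fun u => 2 * y u j) u v) (hoare_weightProg ht hj hu hv).frame
  have h₂ := h₁.seq (d := .seq
    (.setReal 4 (.lit 0) (.lit 0) (.add (.read 4 (.lit 0) (.lit 0)) (.scratch 4)))
    (.flip (.scratch 4) (.read 4 (.lit 0) (.lit 0))
      (.seq (.setNat 3 (.var 20) (.lit 0) (.var 21)) (.setNat 3 (.var 20) (.lit 1) (.var 22)))
      .skip)) (G := fun _ => replaceBy (PMF.pure q)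
      (pairWeight g (fun u => 2 * y u j) u v / (W + pairWeight g (fun u => 2 * y u j) u v)) (u, v))
    (Q' := fun q t => PairAt s j q t ∧
      t.real 4 0 0 = W + pairWeight g (fun u => 2 * y u j) u v) ?_
  · rwa [PMF.pure_bind] at h₂
  · rintro - t' ⟨hF, hw⟩
    rw [Program.exec, Program.exec, PMF.pure_bind]
    set t₁ := t'.setReal 4 ((NatExpr.lit 0).eval t') ((NatExpr.lit 0).eval t')
      ((RealExpr.add (.read 4 (.lit 0) (.lit 0)) (.scratch 4)).eval t') with ht₁
    have r₁ : t₁.real 4 0 0 = W + pairWeight g (fun u => 2 * y u j) u v := by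
      simp [ht₁, RealExpr.scratch, hw, hF.2 4 rfl, hW]
    have w₁ : t₁.real 3 4 0 = pairWeight g (fun u => 2 * y u j) u v := by
      simp [ht₁, hw]
    have n₁ : t₁.nat = t'.nat := rfl
    obtain ⟨q₁, q₂, q₃⟩ := hq
    have k₃ : t₁.nat 3 = t.nat 3 := hF.1 3 rfl
    have h₃ := Mix.flip (p := .scratch 4) (q := .read 4 (.lit 0) (.lit 0))
      (c := .seq (.setNat 3 (.var 20) (.lit 0) (.var 21))
        (.setNat 3 (.var 20) (.lit 1) (.var 22))) (d := .skip) (s := t₁)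
      (G := fun b => if b = true then PMF.pure (u, v) else PMF.pure q)
      (Q := fun q t => PairAt s j q t ∧
        t.real 4 0 0 = W + pairWeight g (fun u => 2 * y u j) u v) ?_ ?_
    · simpa only [RealExpr.scratch, RealExpr.eval_read, NatExpr.eval_lit, r₁, w₁, replaceBy]
        using h₃
    · simp only [if_true]
      refine Mix.of_hoare ?_
      have e20 : t₁.nat 20 0 0 = j := by rw [n₁, hF.1 20 rfl, hj]
      have e21 : t₁.nat 21 0 0 = u := by rw [n₁, hF.1 21 rfl, hu]
      have e22 : t₁.nat 22 0 0 = v := by rw [n₁, hF.1 22 rfl, hv]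
      rw [hoare_seq, hoare_setNat, hoare_setNat]
      refine ⟨⟨?_, ?_, fun i e hi => ?_⟩, r₁⟩
      · simp [e20, e21]
      · simp [e20, e22]
      · simp [e20, hi, k₃, q₃ i e hi]
    · simp only [Bool.false_eq_true, if_false]
      refine Mix.of_hoare ?_
      rw [hoare_skip]
      exact ⟨⟨by rw [k₃, q₁], by rw [k₃, q₂], fun i e hi => by rw [k₃, q₃ i e hi]⟩, r₁⟩

/-- The total weight of the pairs before `(k, l)`. -/
noncomputable def pairTotal (w : ℕ → ℕ → ℝ) (m k l : ℕ) : ℝ :=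
  ∑ k' ∈ Finset.range k, ∑ l' ∈ Finset.range m, w k' l' + ∑ l' ∈ Finset.range l, w k l'

/-- Reservoir sampling of a pair. -/
noncomputable def reservoir {α : Type*} (w : ℕ → ℕ → ℝ) (a : ℕ → ℕ → α) (m : ℕ) (a₀ : α) :
    PMF α :=
  iterLabel (fun k y => iterLabel (fun l y =>
    replaceBy (PMF.pure y) (w k l / (pairTotal w m k l + w k l)) (a k l)) y m) a₀ m

/-- The total weight is one, so the unnormalized identity for the whole double loop is already the
expectation, and the initial value `a₀`, which has weight zero, disappears. -/
theorem ev_reservoir {α : Type*} [Fintype α] {w : ℕ → ℕ → ℝ} (hw : ∀ k l, 0 ≤ w k l)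
    (a : ℕ → ℕ → α) {m : ℕ} (a₀ : α)
    (h : ∑ k ∈ Finset.range m, ∑ l ∈ Finset.range m, w k l = 1) (f : α → ℝ) :
    ev (reservoir w a m a₀) f
      = ∑ k ∈ Finset.range m, ∑ l ∈ Finset.range m, w k l * f (a k l) := by
  have key : ∀ k, (∑ k' ∈ Finset.range k, ∑ l ∈ Finset.range m, w k' l)
      * ev (iterLabel (fun k y => iterLabel (fun l y =>
        replaceBy (PMF.pure y) (w k l / (pairTotal w m k l + w k l)) (a k l)) y m) a₀ k) f
      = ∑ k' ∈ Finset.range k, ∑ l ∈ Finset.range m, w k' l * f (a k' l) := by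
    intro k
    induction k with
    | zero => simp
    | succ k ih =>
      have := ev_iterLabel_replaceBy (w := w k) (W := pairTotal w m k) (hw k)
        (fun l => add_nonneg (Finset.sum_nonneg fun _ _ => Finset.sum_nonneg fun _ _ => hw _ _)
          (Finset.sum_nonneg fun _ _ => hw _ _))
        (fun l => by simp only [pairTotal, Finset.sum_range_succ]; ring) (a k)
        (iterLabel (fun k y => iterLabel (fun l y =>
          replaceBy (PMF.pure y) (w k l / (pairTotal w m k l + w k l)) (a k l)) y m) a₀ k) f m
      rw [Finset.sum_range_succ, Finset.sum_range_succ, ← ih, iterLabel]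
      rw [pairTotal, pairTotal, Finset.sum_range_zero, add_zero] at this
      exact this
  have := key m
  rwa [h, one_mul] at this

/-- The group with a given number. -/
def groupNum (hU : 0 < U) (k : ℕ) : Fin U := ⟨k % U, Nat.mod_lt _ hU⟩

theorem groupNum_val (hU : 0 < U) (u : Fin U) : groupNum hU u = u :=
  Fin.ext (Nat.mod_eq_of_lt u.2)

/-- The random pair of groups of a job with masses `x`. -/
noncomputable def pairPMF (hU : 0 < U) (g : Fin U → ℕ) (x : Fin U → ℝ) : PMF (Fin U × Fin U) :=
  reservoir (fun k l => pairWeight g x (groupNum hU k) (groupNum hU l))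
    (fun k l => (groupNum hU k, groupNum hU l)) U (groupNum hU 0, groupNum hU 0)

theorem ev_pairPMF (hU : 0 < U) (g : Fin U → ℕ) {x : Fin U → ℝ} (hx : ∀ u, 0 ≤ x u)
    (h : ∑ u, x u = 2) (f : Fin U × Fin U → ℝ) :
    ev (pairPMF hU g x) f = ∑ u, ∑ v, pairWeight g x u v * f (u, v) := by
  rw [pairPMF, ev_reservoir fun k l => pairWeight_nonneg _ _]
  · simp only [Finset.sum_range, groupNum_val]
  · simp only [Finset.sum_range, groupNum_val]
    exact sum_sum_pairWeight hx h

/-- Draw the pair of groups of a job. -/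
def pairProg : Program :=
  .seq (.setReal 4 (.lit 0) (.lit 0) (.ofNat (.lit 0)))
    (.seq (.setNat 3 (.var 20) (.lit 0) (.lit 0)) (.seq (.setNat 3 (.var 20) (.lit 1) (.lit 0))
      (.loop 21 .groups (.loop 22 .groups stepProg))))

theorem mix_pairProg (hU : 0 < U) (hs : Input s g y) {j : Fin n} (hj : s.nat 20 0 0 = j) :
    Mix (pairProg.exec s) (pairPMF hU g fun u => 2 * y u j) fun q t => PairAt s j q t := by
  rw [pairProg, Program.exec, Program.exec, PMF.pure_bind, Program.exec, Program.exec,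
    PMF.pure_bind, Program.exec, Program.exec, PMF.pure_bind]
  set s₁ := ((s.setReal 4 _ _ _).setNat 3 _ _ _).setNat 3 _ _ _ with hs₁
  have k₁ : ∀ b, b ≠ 3 → s₁.nat b = s.nat b := fun b hb => by
    rw [hs₁, State.setNat_nat_ne hb.symm, State.setNat_nat_ne hb.symm]
    rfl
  have i₁ : Input s₁ g y := hs.of_eq (k₁ 0 (by decide)) (k₁ 1 (by decide)) (by
    rw [hs₁, State.real_setNat, State.real_setNat, State.setReal_real_ne (by decide)])
  have r₁ : s₁.real 4 0 0 = 0 := by simp [hs₁]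
  have p₁ : PairAt s j (groupNum hU 0, groupNum hU 0) s₁ := by
    refine ⟨?_, ?_, fun i e hi => ?_⟩
    · simp [hs₁, hj, groupNum]
    · simp [hs₁, hj, groupNum]
    · simp [hs₁, hj, hi]
  have j₁ : s₁.nat 20 0 0 = j := by rw [k₁ 20 (by decide), hj]
  set w : ℕ → ℕ → ℝ := fun k l =>
    pairWeight g (fun u => 2 * y u j) (groupNum hU k) (groupNum hU l) with hw
  have key := Mix.loop (a := 21) (e := .groups) (c := .loop 22 .groups stepProg) (s := s₁)
    (x := (groupNum hU 0, groupNum hU 0)) (G := fun k y => iterLabel (fun l y =>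
      replaceBy (PMF.pure y) (w k l / (pairTotal w U k l + w k l))
        (groupNum hU k, groupNum hU l)) y U)
    (fun k q t => PairAt s j q t ∧ t.real 4 0 0 = pairTotal w U k 0) ?_ ?_
  · rw [NatExpr.eval_groups, i₁.groups] at key
    exact key.mono fun q t h => h.1
  · refine ⟨p₁, ?_⟩
    rw [r₁]
    simp [pairTotal]
  · rintro k hk q t hF ⟨h₁, h₂⟩
    rw [NatExpr.eval_groups, i₁.groups] at hk
    have it : Input t g y := i₁.of_eq (hF.1 0 rfl) (hF.1 1 rfl) (hF.2 0 rfl)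
    have hg : NatExpr.groups.eval (t.setNat 21 0 0 k) = U := by
      rw [NatExpr.eval_groups, State.setNat_nat_ne (by decide), it.groups]
    have inner := Mix.loop (a := 22) (e := .groups) (c := stepProg) (s := t.setNat 21 0 0 k)
      (x := q) (G := fun l y => replaceBy (PMF.pure y) (w k l / (pairTotal w U k l + w k l))
        (groupNum hU k, groupNum hU l))
      (fun l q t => PairAt s j q t ∧ t.real 4 0 0 = pairTotal w U k l) ?_ ?_
    · rw [hg] at inner
      refine inner.mono fun q t h => ⟨h.1, ?_⟩
      rw [h.2, pairTotal, pairTotal, Finset.sum_range_succ, Finset.sum_range_zero, add_zero]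
    · refine ⟨?_, h₂⟩
      obtain ⟨a, b, c⟩ := h₁
      exact ⟨by simpa using a, by simpa using b, by simpa using c⟩
    · rintro l hl q' t' hF' ⟨h₃, h₄⟩
      rw [hg] at hl
      have it' : Input (t'.setNat 22 0 0 l) g y := it.of_eq
        (by rw [State.setNat_nat_ne (by decide), hF'.1 0 rfl, State.setNat_nat_ne (by decide)])
        (by rw [State.setNat_nat_ne (by decide), hF'.1 1 rfl, State.setNat_nat_ne (by decide)])
        (by rw [State.real_setNat, hF'.2 0 rfl, State.real_setNat])
      refine (mix_stepProg (s := s) (u := groupNum hU k) (v := groupNum hU l) (j := j) (q := q')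
        (W := pairTotal w U k l) it' ?_ ?_ ?_ ?_ h₄).mono ?_
      · rw [State.setNat_nat_ne (by decide), hF'.1 20 rfl, State.setNat_nat_ne (by decide),
          hF.1 20 rfl, j₁]
      · rw [State.setNat_nat_ne (by decide), hF'.1 21 rfl]
        simp [groupNum, Nat.mod_eq_of_lt hk]
      · simp [groupNum, Nat.mod_eq_of_lt hl]
      · obtain ⟨a, b, c⟩ := h₃
        exact ⟨by simpa using a, by simpa using b, by simpa using c⟩
      · rintro q'' t'' ⟨h₅, h₆⟩
        refine ⟨h₅, ?_⟩
        rw [h₆, pairTotal, pairTotal, Finset.sum_range_succ, ← add_assoc]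

/-! ## Drawing for all jobs -/

/-- Draw the class of a half-edge. -/
def classProg (e : ℕ) : Program :=
  .bit (.sub (.ofNat (.lit 5)) (.add (.share (.read 3 (.var 20) (.lit e)) (.var 20))
    (.share (.read 3 (.var 20) (.lit e)) (.var 20)))) (.ofNat (.lit 5)) 4 (.var 20) (.lit e)

/-- Without multiplication the probability is realized as the quotient of `5 - 4y`, formed by
repeated addition, and `5`. -/
theorem mix_classProg (hs : Input s g y) {j : Fin n} (hj : s.nat 20 0 0 = j) {e : ℕ} {u : Fin U}
    (hu : s.nat 3 j e = u) :
    Mix ((classProg e).exec s) (coin (1 - 2 / 5 * (2 * y u j))) fun b t =>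
      t = s.setNat 4 j e b.toNat := by
  have := mix_bit (.sub (.ofNat (.lit 5)) (.add (.share (.read 3 (.var 20) (.lit e)) (.var 20))
    (.share (.read 3 (.var 20) (.lit e)) (.var 20)))) (.ofNat (.lit 5)) 4 (.var 20) (.lit e) s
  have hu' : (NatExpr.read 3 (.var 20) (.lit e)).eval s = u := by simp [hj, hu]
  rw [RealExpr.eval_sub, RealExpr.eval_add, hs.eval_share (b := .var 20) (j := j) hu' hj, RealExpr.eval_ofNat,
    NatExpr.eval_lit, NatExpr.eval_var, NatExpr.eval_lit, hj] at this
  rw [show 1 - 2 / 5 * (2 * y u j) = (((5 : ℕ) : ℝ) - (2 * y u j + 2 * y u j)) / ((5 : ℕ) : ℝ) by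
    push_cast; ring]
  exact this

/-- Draw the pair of groups and the classes of a job. -/
def jobProg : Program := .seq pairProg (.seq (classProg 0) (classProg 1))

/-- The choices of a job are stored in the memory. -/
def JobAt (j : ℕ) (d : Draw U) (t : State) : Prop :=
  ∀ e : Bool, t.nat 3 j e.toNat = drawEnd d e ∧ t.nat 4 j e.toNat = (drawClass d e).toNat

theorem mix_jobProg (hU : 0 < U) (hs : Input s g y) {j : Fin n} (hj : s.nat 20 0 0 = j) :
    Mix (jobProg.exec s) (drawPMF (pairPMF hU g fun u => 2 * y u j)
      fun u => 1 - 2 / 5 * (2 * y u j)) fun d t => JobAt j d t ∧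
        ∀ i e, i ≠ (j : ℕ) → t.nat 3 i e = s.nat 3 i e ∧ t.nat 4 i e = s.nat 4 i e := by
  refine Mix.seq (mix_pairProg hU hs hj).frame ?_
  rintro q t ⟨hF, h₁, h₂, h₃⟩
  have it : Input t g y := hs.of_eq (hF.1 0 rfl) (hF.1 1 rfl) (hF.2 0 rfl)
  have jt : t.nat 20 0 0 = j := by rw [hF.1 20 rfl, hj]
  refine Mix.seq (mix_classProg it jt h₁) ?_
  rintro a _ rfl
  have it' : Input (t.setNat 4 j 0 a.toNat) g y := it.of_eq (State.setNat_nat_ne (by decide))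
    (State.setNat_nat_ne (by decide)) rfl
  refine (mix_classProg (u := q.2) it' (e := 1) (j := j) ?_ ?_).map (φ := fun b => (q, a, b)) ?_
  · rw [State.setNat_nat_ne (by decide), jt]
  · rw [State.setNat_nat_ne (by decide), h₂]
  · rintro b _ rfl
    refine ⟨fun e => ?_, fun i e hi => ?_⟩
    · cases e
      · simp [drawEnd, drawClass, h₁]
      · simp [drawEnd, drawClass, h₂]
    · simp [hi, h₃ i e hi, hF.1 4 rfl]

/-- Draw the pairs of groups and the classes. -/
def drawProg : Program := .loop 20 .jobs jobProg

theorem mix_drawProg (hU : Fin n → 0 < U) (hs : Input s g y) :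
    Mix (drawProg.exec s) (piPMF (jobPMF (fun u j => 2 * y u j)
      fun j => pairPMF (hU j) g fun u => 2 * y u j)) fun ω t =>
        ∀ h : Fin n × Bool, t.nat 3 h.1 h.2.toNat = endOf ω h ∧
          t.nat 4 h.1 h.2.toNat = (classOf ω h).toNat := by
  refine (Mix.loop_pi (e := .jobs) _ hs.jobs (fun j d t => JobAt (U := U) j d t) ?_).mono
    fun ω t ht h => ht h.1 h.2
  intro k t hF
  refine (mix_jobProg (hU k) (g := g) (y := y) (j := k) (hs.of_eq ?_ ?_ ?_) ?_).mono ?_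
  · rw [State.setNat_nat_ne (by decide), hF.1 0 rfl]
  · rw [State.setNat_nat_ne (by decide), hF.1 1 rfl]
  · rw [State.real_setNat, hF.2 0 rfl]
  · simp
  · rintro d t' ⟨h₁, h₂⟩
    refine ⟨h₁, fun i hi d' hd' e => ?_⟩
    obtain ⟨h₃, h₄⟩ := h₂ i e.toNat fun h => hi.ne (Fin.ext h)
    rw [h₃, h₄]
    simpa using hd' e

end Pairs

/-! ## The algorithm -/

/-- Make the random choices, and compute the matching and the phases. -/
def sampleProg : Program := .seq drawProg (.seq ringProg (.seq levelProg matchProg))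

/-- The rounding algorithm. -/
def roundingProg : Program := .seq sampleProg finishProg

section Algorithm

variable {n U : ℕ} {g : Fin U → ℕ} {y : Fin U → Fin n → ℝ} {s : State}

theorem mix_sampleProg (hU : Fin n → 0 < U) (hs : Input s g y) (h₇ : s.nat 7 0 0 = 0)
    (h₈ : ∀ i j, s.nat 8 i j = 0) :
    Mix (sampleProg.exec s) ((piPMF (jobPMF (fun u j => 2 * y u j)
      fun j => pairPMF (hU j) g fun u => 2 * y u j)).bind fun ω =>
        (ringPMF n U).bind fun R => (levelPMF n).map fun lev => (ω, R, lev)) fun a t =>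
      Matched t (links g (endOf a.1) (classOf a.1) a.2.1) ∧
      (∀ h : Fin n × Bool, t.nat 3 h.1 h.2.toNat = endOf a.1 h) ∧
      ∃ ph, Phased t ph ∧ (links g (endOf a.1) (classOf a.1) a.2.1).Bridged numLevels
        (fun h => (a.2.2 h : ℕ)) ph := by
  refine Mix.seq (mix_drawProg hU hs).frame ?_
  rintro ω s₁ ⟨f₁, c₁⟩
  refine Mix.seq (mix_ringProg (n := n) (U := U) ?_ ?_).frame ?_
  · rw [f₁.1 0 rfl, hs.groups]
  · rw [f₁.1 0 rfl, hs.jobs]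
  rintro R s₂ ⟨f₂, c₂⟩
  have key := ((mix_levelProg (n := n) (s := s₂) ?_).frame.hoare (c := matchProg)
    (Q' := fun lev t => Matched t (links g (endOf ω) (classOf ω) R) ∧
      (∀ h : Fin n × Bool, t.nat 3 h.1 h.2.toNat = endOf ω h) ∧
      ∃ ph, Phased t ph ∧ (links g (endOf ω) (classOf ω) R).Bridged numLevels
        (fun h => (lev h : ℕ)) ph) ?_).map (φ := fun lev => (ω, R, lev))
    (Q' := fun a t =>
      Matched t (links g (endOf a.1) (classOf a.1) a.2.1) ∧
      (∀ h : Fin n × Bool, t.nat 3 h.1 h.2.toNat = endOf a.1 h) ∧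
      ∃ ph, Phased t ph ∧ (links g (endOf a.1) (classOf a.1) a.2.1).Bridged numLevels
        (fun h => (a.2.2 h : ℕ)) ph) fun lev t h => h
  · exact key
  · rw [f₂.1 0 rfl, f₁.1 0 rfl, hs.jobs]
  · rintro lev s₃ ⟨f₃, c₃⟩
    refine hoare_matchProg ⟨?_, fun u => ?_, fun h => ?_, fun h => ?_, fun u k => ?_⟩ ?_ ?_ c₃
      fun h => (lev h).2
    · rw [f₃.1 0 rfl, f₂.1 0 rfl, f₁.1 0 rfl, hs.jobs]
    · rw [f₃.1 1 rfl, f₂.1 1 rfl, f₁.1 1 rfl, hs.machine]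
    · rw [f₃.1 3 rfl, f₂.1 3 rfl, (c₁ h).1]
    · rw [f₃.1 4 rfl, f₂.1 4 rfl, (c₁ h).2]
    · rw [f₃.1 5 rfl, c₂]
    · rw [f₃.1 7 rfl, f₂.1 7 rfl, f₁.1 7 rfl, h₇]
    · intro i j
      rw [f₃.1 8 rfl, f₂.1 8 rfl, f₁.1 8 rfl, h₈]

/-- The assignment in the output array. -/
def decode (hU : Fin n → 0 < U) (s : State) (j : Fin n) : Fin U := groupNum (hU j) (s.nat 2 j 0)

/-- The probability of an output event in terms of the coins. -/
theorem outer_finishProg (hU : Fin n → 0 < U) {L : Links n} {E : Fin n × Bool → Fin U}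
    {ph : Fin n → Bool} {t : State} (hs : Matched t L)
    (hE : ∀ h : Fin n × Bool, t.nat 3 h.1 h.2.toNat = E h) (hp : Phased t ph)
    (A : (Fin n → Fin U) → Prop) [DecidablePred A] :
    (finishProg.exec t).toOuterMeasure {t | A (decode hU t)}
      = ENNReal.ofReal (ev fair fun β => ev (coinsPMF n) fun coins =>
        if A fun j => E (L.chosen (Links.shift β ph) coins j) then 1 else 0) := by
  have := Mix.outer_eq (mix_finishProg hs hE hp) (f := PMF.pure) (S := {t | A (decode hU t)})
    (G := fun a => if A fun j => E (L.chosen (Links.shift a.1 ph) a.2 j) then 1 else 0) ?_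
    fun a => by split_ifs <;> norm_num
  · rw [PMF.bind_pure, ev_bind] at this
    simpa only [ev_map] using this
  · intro a t' ht'
    have : decode hU t' = fun j => E (L.chosen (Links.shift a.1 ph) a.2 j) := by
      funext j
      rw [decode, ht', groupNum_val]
    rw [PMF.toOuterMeasure_pure_apply, Set.mem_ofPred_eq, this]
    split_ifs <;> simp

theorem ev_triple_fst {α β γ : Type*} [Fintype α] [Fintype β] [Fintype γ] (p : PMF α) (q : PMF β)
    (r : PMF γ) (f : α → ℝ) :
    ev (p.bind fun a => q.bind fun b => r.map fun c => (a, b, c)) (fun x => f x.1) = ev p f := by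
  simp only [ev_bind, ev_map, ev_const]

theorem ev_triple {α β γ : Type*} [Fintype α] [Fintype β] [Fintype γ] (p : PMF α) (q : PMF β)
    (r : PMF γ) (f : α → β → γ → ℝ) :
    ev (p.bind fun a => q.bind fun b => r.map fun c => (a, b, c)) (fun x => f x.1 x.2.1 x.2.2)
      = ev p fun a => ev q fun b => ev r fun c => f a b c := by
  simp only [ev_bind, ev_map]

/-- Every possible output consists of numbers of groups, so the reduction modulo `U` in `decode`
changes nothing. -/
theorem hoare_roundingProg (hU : Fin n → 0 < U) (hs : Input s g y) (h₇ : s.nat 7 0 0 = 0)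
    (h₈ : ∀ i j, s.nat 8 i j = 0) : Hoare roundingProg s fun t => ∀ j : Fin n, ∃ u : Fin U,
    t.nat 2 j 0 = u := by
  rw [roundingProg, hoare_seq]
  refine (mix_sampleProg hU hs h₇ h₈).to_hoare.mono ?_
  rintro t ⟨a, h₁, h₂, ph, h₃, -⟩
  refine (mix_finishProg h₁ h₂ h₃).to_hoare.mono ?_
  rintro t' ⟨b, hb⟩ j
  exact ⟨_, hb j⟩

variable (hU : Fin n → 0 < U) (hs : Input s g y) (h₇ : s.nat 7 0 0 = 0)
  (h₈ : ∀ i j, s.nat 8 i j = 0)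
  (hL : PairLaw g (fun u j => 2 * y u j) fun j => pairPMF (hU j) g fun u => 2 * y u j)

include hs h₇ h₈ hL

theorem outer_single (j : Fin n) (u : Fin U) :
    (roundingProg.exec s).toOuterMeasure {t | decode hU t j = u} = ENNReal.ofReal (y u j) := by
  have := Mix.outer_eq (mix_sampleProg hU hs h₇ h₈) (f := finishProg.exec)
    (S := {t | decode hU t j = u})
    (G := fun a => ∑ e, (if endOf a.1 (j, e) = u then 1 else 0) * (1 / 2)) ?_ ?_
  · rw [ev_triple_fst _ _ _ fun ω => ∑ e, (if endOf ω (j, e) = u then 1 else 0) * (1 / 2),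
      hL.ev_marginal u j] at this
    rw [show y u j = 2 * y u j / 2 by ring]
    exact this
  · rintro a t ⟨h₁, h₂, ph, h₃, -⟩
    rw [outer_finishProg hU h₁ h₂ h₃ fun σ => σ j = u, ev_single]
  · intro a
    exact Finset.sum_nonneg fun e _ => by split_ifs <;> norm_num

theorem outer_pair {j j' : Fin n} (hjj : j ≠ j') {u u' : Fin U} (hu : g u = g u') :
    (roundingProg.exec s).toOuterMeasure {t | decode hU t j = u ∧ decode hU t j' = u'}
      ≤ ENNReal.ofReal (y u j * y u' j') := by
  have := Mix.outer_le (mix_sampleProg hU hs h₇ h₈) (f := finishProg.exec)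
    (S := {t | decode hU t j = u ∧ decode hU t j' = u'})
    (G := fun a => ∑ e, ∑ e', (if endOf a.1 (j, e) = u then 1 else 0)
        * (if endOf a.1 (j', e') = u' then 1 else 0) * (1 / 4)) ?_ ?_
  · rw [ev_triple_fst _ _ _ fun ω => ∑ e, ∑ e', (if endOf ω (j, e) = u then 1 else 0)
        * (if endOf ω (j', e') = u' then 1 else 0) * (1 / 4), hL.ev_quarter u u' hjj] at this
    rw [show y u j * y u' j' = 2 * y u j / 2 * (2 * y u' j' / 2) by ring]
    exact this
  · rintro a t ⟨h₁, h₂, ph, h₃, -⟩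
    rw [outer_finishProg hU h₁ h₂ h₃ fun σ => σ j = u ∧ σ j' = u']
    exact ENNReal.ofReal_le_ofReal (pairProb_le_quarter hu hjj a.1 a.2.1 ph)
  · intro a
    exact Finset.sum_nonneg fun e _ => Finset.sum_nonneg fun e' _ => by split_ifs <;> norm_num

/-- The phases belong to the state and not to the label; `meetBound` is valid for all bridged
phases, so `Mix.outer_le` applies. -/
theorem outer_meet {j j' : Fin n} (hjj : j ≠ j') {u : Fin U}
    (hd : ∑ v with g v = g u, 2 * y v j ≤ 1) (hd' : ∑ v with g v = g u, 2 * y v j' ≤ 1) :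
    (roundingProg.exec s).toOuterMeasure {t | decode hU t j = u ∧ decode hU t j' = u}
      ≤ ENNReal.ofReal ((1 - 0.1561) * (y u j * y u j')) := by
  have := Mix.outer_le (mix_sampleProg hU hs h₇ h₈) (f := finishProg.exec)
    (S := {t | decode hU t j = u ∧ decode hU t j' = u})
    (G := fun a => meetBound g u j j' a.1 a.2.1 a.2.2) ?_ ?_
  · rw [ev_triple _ _ _ (meetBound g u j j')] at this
    refine this.trans (ENNReal.ofReal_le_ofReal ((hL.ev_meetBound hjj hd hd').trans_eq ?_))
    ring
  · rintro a t ⟨h₁, h₂, ph, h₃, h₄⟩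
    rw [outer_finishProg hU h₁ h₂ h₃ fun σ => σ j = u ∧ σ j' = u]
    exact ENNReal.ofReal_le_ofReal (pairProb_le_meetBound hjj a.1 a.2.1 a.2.2 h₄)
  · intro a
    exact meetBound_nonneg g u j j' a.1 a.2.1 a.2.2

end Algorithm

/-! ## Instances -/

theorem Instance.numGroups_pos (I : Instance) (j : Fin I.numJobs) : 0 < I.numGroups := by
  by_contra h
  have : IsEmpty (Fin I.numGroups) := by
    rw [Nat.eq_zero_of_not_pos h]
    infer_instance
  have := I.job_eq_one j
  rw [Finset.univ_eq_empty, Finset.sum_empty] at this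
  norm_num at this

theorem Instance.input (I : Instance) : Input I.start (fun u => (I.g u : ℕ)) I.y where
  groups := rfl
  jobs := rfl
  machine u := by simp [start]
  mass u j := by simp [start]

theorem Instance.pairLaw (I : Instance) : PairLaw (fun u => (I.g u : ℕ)) (fun u j => 2 * I.y u j)
    fun j => pairPMF (I.numGroups_pos j) (fun u => (I.g u : ℕ)) fun u => 2 * I.y u j := by
  have h₀ : ∀ u j, 0 ≤ 2 * I.y u j := fun u j => by linarith [(I.y_mem u j).1]
  have h₁ : ∀ j, ∑ u, 2 * I.y u j = 2 := fun j => by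
    rw [← Finset.mul_sum, I.job_eq_one, mul_one]
  refine ⟨h₀, fun u j => by linarith [(I.y_mem u j).2], fun u => ?_, h₁, fun j f =>
    ev_pairPMF (I.numGroups_pos j) _ (fun u => h₀ u j) (h₁ j) f⟩
  rw [← Finset.mul_sum]
  linarith [I.group_le_one u]

theorem Instance.sum_le_one_of_not_dominates {I : Instance} {u : Fin I.numGroups}
    {j : Fin I.numJobs} (h : ¬ I.Dominates (I.g u) j) :
    ∑ v with (I.g v : ℕ) = I.g u, 2 * I.y v j ≤ 1 := by
  rw [Dominates, not_lt] at h
  simp only [← Fin.ext_iff]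
  rw [← Finset.mul_sum]
  linarith

theorem map_eq_map_of_support {α β : Type*} {p : PMF α} {f f' : α → β}
    (h : ∀ a ∈ p.support, f a = f' a) : p.map f = p.map f' := by
  classical
  ext b
  rw [PMF.map_apply, PMF.map_apply]
  refine tsum_congr fun a => ?_
  by_cases ha : a ∈ p.support
  · rw [h a ha]
  · rw [PMF.mem_support_iff, not_not] at ha
    simp [ha]

/-- The random assignment. -/
noncomputable def Instance.assignment (I : Instance) :
    PMF (Fin I.numJobs → Fin I.numGroups) :=
  (roundingProg.run I.start).map (decode I.numGroups_pos)

/-- The assignment is defined by decoding the output array, so it suffices that decoding is faithful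
on the support. -/
theorem Instance.outputs_assignment (I : Instance) : roundingProg.Outputs I I.assignment := by
  rw [Program.Outputs, assignment, PMF.map_comp]
  refine map_eq_map_of_support fun s hs => funext fun j => ?_
  have hs' : s.unclock ∈ (roundingProg.exec I.start).support := by
    rw [← show I.start.unclock = I.start from rfl, ← Program.map_run, PMF.mem_support_map_iff]
    exact ⟨s, hs, rfl⟩
  obtain ⟨u, hu⟩ := hoare_roundingProg I.numGroups_pos I.input (by simp [start])
    (fun i j => by simp [start]) _ hs' j
  have hu : s.nat 2 j 0 = u := hu
  rw [Function.comp_apply, decode, hu, groupNum_val]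

theorem Instance.real_assignment (I : Instance)
    (A : (Fin I.numJobs → Fin I.numGroups) → Prop) :
    I.assignment.toMeasure.real {σ | A σ}
      = ((roundingProg.exec I.start).toOuterMeasure
        {t | A (decode I.numGroups_pos t)}).toReal := by
  rw [MeasureTheory.Measure.real,
    PMF.toMeasure_apply_eq_toOuterMeasure_apply _ (Set.toFinite _).measurableSet, assignment,
    PMF.toOuterMeasure_map_apply, ← show I.start.unclock = I.start from rfl, ← Program.map_run,
    PMF.toOuterMeasure_map_apply]
  rfl

end SNC

/-! ### The rounding theorem -/

theorem theorem2 :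
    ∃ (c : SNC.Program) (T : Polynomial ℕ), ∀ I : SNC.Instance,
      c.HaltsWithin I (T.eval (I.numMachines + I.numGroups + I.numJobs)) ∧
      ∃ μ : PMF (Fin I.numJobs → Fin I.numGroups), c.Outputs I μ ∧
        (∀ u j, μ.toMeasure.real {σ | σ j = u} = I.y u j) ∧
        (∀ j j' u u', j ≠ j' → I.g u = I.g u' →
          μ.toMeasure.real {σ | σ j = u ∧ σ j' = u'} ≤ I.y u j * I.y u' j') ∧
        (∀ j j' u, j ≠ j' → ¬ I.Dominates (I.g u) j → ¬ I.Dominates (I.g u) j' →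
          μ.toMeasure.real {σ | σ j = u ∧ σ j' = u} ≤ (1 - 0.1561) * (I.y u j * I.y u j')) := by
  refine ⟨SNC.roundingProg, SNC.roundingProg.cost, fun I => ⟨fun s hs => ?_, I.assignment,
    I.outputs_assignment, fun u j => ?_, fun j j' u u' hjj hu => ?_, fun j j' u hjj hd hd' => ?_⟩⟩
  -- That the program is tame is checked by evaluation. The sum of the three sizes bounds every loop
  -- bound that is not a literal.
  · have := (SNC.Program.run_bound (c := SNC.roundingProg) rfl
      (N := I.numMachines + I.numGroups + I.numJobs) (s := I.start) ?_ hs).2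
    · simpa [SNC.Instance.start] using this
    · intro i hi
      interval_cases i <;> simp [SNC.Instance.start] <;> omega
  · rw [I.real_assignment fun σ => σ j = u, SNC.outer_single I.numGroups_pos I.input
      (by simp [SNC.Instance.start]) (fun i j => by simp [SNC.Instance.start]) I.pairLaw,
      ENNReal.toReal_ofReal (I.y_mem u j).1]
  · rw [I.real_assignment fun σ => σ j = u ∧ σ j' = u']
    exact ENNReal.toReal_le_of_le_ofReal (mul_nonneg (I.y_mem _ _).1 (I.y_mem _ _).1)
      (SNC.outer_pair I.numGroups_pos I.input (by simp [SNC.Instance.start])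
        (fun i j => by simp [SNC.Instance.start]) I.pairLaw hjj (congrArg Fin.val hu))
  · rw [I.real_assignment fun σ => σ j = u ∧ σ j' = u]
    exact ENNReal.toReal_le_of_le_ofReal
      (mul_nonneg (by norm_num) (mul_nonneg (I.y_mem _ _).1 (I.y_mem _ _).1))
      (SNC.outer_meet I.numGroups_pos I.input (by simp [SNC.Instance.start])
        (fun i j => by simp [SNC.Instance.start]) I.pairLaw hjj
        (SNC.Instance.sum_le_one_of_not_dominates hd)
        (SNC.Instance.sum_le_one_of_not_dominates hd'))
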